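/- Let $I=[0,1]$, $0<T<\infty$, $k\ge 1$. For functions on $I$ put $(v,w)_{0,r}=\int_0^1 v\,w\,r\,dr$, $\|v\|_{0,r}^2=(v,v)_{0,r}$, $(v,w)_{H^1_r}=(\partial_r v,\partial_r w)_{0,r}+(\tfrac vr,\tfrac wr)_{0,r}$, $\|v\|_{H^1_r}^2=(v,v)_{H^1_r}$. Let $H^1_{r,0}$ be the space of $v$ with $\|v\|_{H^1_r}<\infty$ and $v(0)=v(1)=0$, let $\mathcal E(v)=\tfrac12\int_0^1\big((\partial_r v)^2+\tfrac{\sin^2 v}{r^2}\big)r\,dr$, and $\mathcal E_1=\{v\in H^1_{r,0} : \mathcal E(v)\le 2\}$. Let $u=u(t,r)$ be a solution on $[0,T]\times I$ of $$\partial_t u=\partial_{rr}u+\tfrac1r\partial_r u-\tfrac{\sin(2u)}{2r^2},\qquad u(0,\cdot)=u_0,\qquad u(t,0)=u(t,1)=0,$$ that satisfies the regularity assumption $$\max_{t\in[0,T]}\big\{\|u(t)\|_{W^{k+1}_\infty(I)}+\|\partial_t u(t)\|_{H^1(I)}+\|\partial_{tt}u(t)\|_{L^2(I)}\big\}\le M<\infty,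 \qquad (1)$$ and let $u_0\in H^{k+1}(I)\cap\mathcal E_1$. For $h=1/N$ ($N\ge1$) let $S^k_{h,0}$ be the space of continuous functions on $I$ that are polynomials of degree at most $k$ on each $[ih,(i+1)h]$, $0\le i<N$, and vanish at $0$ and $1$. Let $\tau=T/J$ ($J\ge 1$), $t_j=j\tau$, $f(z)=z-\tfrac12\sin(2z)$. Given $u_h^0\in S^k_{h,0}\cap\mathcal E_1$, let $u_h^{j+1}\in S^k_{h,0}$, $0\le j<J$, solve the semi-implicit Euler scheme $$\Big(\frac{u_h^{j+1}-u_h^j}{\tau},v_h\Big)_{0,r}+(u_h^{j+1},v_h)_{H^1_r}=\Big(\frac{f(u_h^j)}{r^2},v_h\Big)_{0,r}\qquad\text{for all } v_h\in S^k_{h,0},$$ and put $e_h^j=u_h^j-u(t_j)$. (a) There are constants $C,c>0$ depending only on $k$, $T$ and the bound $M$ in (1) (in particular not on $h$, $\tau$) such that for all $N,J\ge 1$ and $1\le j\le J$ $$\|\partial_r e_h^j\|_{0,r}\le C(\tau+h^k)+c\,\|u_0-u_h^0\|_{H^1_r}.$$ (b) For every constant $c_0$ there are constants $C,h_0,\tau_0>0$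 depending only on $k,T,M,c_0$ such that, if $h\le h_0$, $\tau\le\tau_0$ and $\|u_0-u_h^0\|_{H^1_r}\le c_0h^k$, then for $1\le j\le J$ $$\|e_h^j\|_{H^1_r}\le C(\tau+h^k).$$ -/

import Mathlib

open Real Set MeasureTheory

namespace HeatFlow

noncomputable section

/-! ### Functions on the unit interval

A function on `[0,1]` is represented by a function `ℝ → ℝ`; the values off `[0,1]` never matter. -/

/-- The unit interval `I = [0,1]`. -/
abbrev I : Set ℝ := Icc (0 : ℝ) 1

/-- Lebesgue measure on `[0,1]`. -/
abbrev volI : Measure ℝ := volume.restrict I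

/-- The derivative `∂_r v` on `[0,1]` (one-sided at the end points). For a locally absolutely
continuous function it exists almost everywhere and is the weak derivative. -/
def D (v : ℝ → ℝ) : ℝ → ℝ := derivWithin v I

/-- The `i`-th derivative on `[0,1]`. -/
def Dn (i : ℕ) (v : ℝ → ℝ) : ℝ → ℝ := iteratedDerivWithin i v I

/-- The Sobolev space `W^{m,p}(I)`, through the absolutely continuous representative:
`v, v', …, v^{(m-1)}` are absolutely continuous on `[0,1]` and `v, …, v^{(m)}` are in `L^p(I)`. -/
def MemSobolev (p : ENNReal) (m : ℕ) (v : ℝ → ℝ) : Prop :=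
  (∀ i < m, AbsolutelyContinuousOnInterval (Dn i v) 0 1) ∧ ∀ i ≤ m, MemLp (Dn i v) p volI

/-- The norm of `L²(I)`. -/
def normL2 (v : ℝ → ℝ) : ℝ := √(∫ r in (0 : ℝ)..1, v r ^ 2)

/-- The norm of `H^m(I) = W^{m,2}(I)`. -/
def normH (m : ℕ) (v : ℝ → ℝ) : ℝ := √(∑ i ∈ Finset.range (m + 1), normL2 (Dn i v) ^ 2)

/-- The norm of `W^m_∞(I)`: the sum of the essential suprema of the derivatives up to order `m`. -/
def normWInf (m : ℕ) (v : ℝ → ℝ) : ℝ :=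
  ∑ i ∈ Finset.range (m + 1), (eLpNorm (Dn i v) ⊤ volI).toReal

/-! ### Weighted scalar products, the energy -/

/-- `(v,w)_{0,r} = ∫₀¹ v w r dr`. -/
def inner0 (v w : ℝ → ℝ) : ℝ := ∫ r in (0 : ℝ)..1, v r * w r * r

/-- `(v,w)_{H^1_r} = (∂_r v, ∂_r w)_{0,r} + (v/r, w/r)_{0,r}`. -/
def innerH (v w : ℝ → ℝ) : ℝ :=
  inner0 (D v) (D w) + inner0 (fun r => v r / r) (fun r => w r / r)

/-- `‖v‖_{0,r}`. -/
def norm0 (v : ℝ → ℝ) : ℝ := √(inner0 v v)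

/-- `‖v‖_{H^1_r}`. -/
def normHr (v : ℝ → ℝ) : ℝ := √(innerH v v)

/-- The space `H^1_{r,0}`: functions that are locally absolutely continuous on `(0,1]`, vanish at
`0` and `1`, and have a finite `H^1_r` norm (which bounds the `L²_r` norm). -/
def MemHr0 (v : ℝ → ℝ) : Prop :=
  (∀ a ∈ Ioo (0 : ℝ) 1, AbsolutelyContinuousOnInterval v a 1) ∧ v 0 = 0 ∧ v 1 = 0 ∧
    IntegrableOn (fun r => D v r ^ 2 * r) I ∧ IntegrableOn (fun r => (v r / r) ^ 2 * r) I

/-- The energy `𝓔(v) = ½ ∫₀¹ ((∂_r v)² + sin² v / r²) r dr`. -/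
def energy (v : ℝ → ℝ) : ℝ :=
  1 / 2 * ∫ r in (0 : ℝ)..1, (D v r ^ 2 + sin (v r) ^ 2 / r ^ 2) * r

/-- The set `𝓔_b = {v ∈ H^1_{r,0} | 𝓔(v) ≤ 2b}`. -/
def energyBall (b : ℝ) : Set (ℝ → ℝ) := {v | MemHr0 v ∧ energy v ≤ 2 * b}

/-! ### The continuous problem -/

/-- `u` is a classical solution on `[0,T]` of
`∂_t u = ∂_{rr} u + (1/r) ∂_r u - sin(2u)/(2r²)`, `u(0,·) = u₀`, `u(·,0) = u(·,1) = 0`,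
with time derivative `ut` (one-sided at `t = 0` and `t = T`). -/
structure IsSolution (T : ℝ) (u₀ : ℝ → ℝ) (u ut : ℝ → ℝ → ℝ) : Prop where
  continuousOn : ContinuousOn (Function.uncurry u) (Icc 0 T ×ˢ I)
  contDiffOn : ∀ t ∈ Ioc 0 T, ContDiffOn ℝ 2 (u t) (Ioo 0 1)
  hasDeriv_time : ∀ t ∈ Icc 0 T, ∀ r ∈ I,
    HasDerivWithinAt (fun s => u s r) (ut t r) (Icc 0 T) t
  equation : ∀ t ∈ Ioc 0 T, ∀ r ∈ Ioo (0 : ℝ) 1,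
    ut t r = deriv (deriv (u t)) r + 1 / r * deriv (u t) r - sin (2 * u t r) / (2 * r ^ 2)
  initial : ∀ r ∈ I, u 0 r = u₀ r
  boundary : ∀ t ∈ Icc 0 T, u t 0 = 0 ∧ u t 1 = 0

/-- `z` is the (weak) time derivative of `w` on `[0,T]`: for almost every `r` the function
`t ↦ w(t,r)` is absolutely continuous with derivative `z(·,r)`. -/
def IsTimeDeriv (T : ℝ) (w z : ℝ → ℝ → ℝ) : Prop :=
  AEStronglyMeasurable (Function.uncurry z) (volume.restrict (Icc 0 T ×ˢ I)) ∧
    ∀ᵐ r ∂volI, IntervalIntegrable (fun s => z s r) volume 0 T ∧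
      ∀ t ∈ Icc 0 T, w t r = w 0 r + ∫ s in (0 : ℝ)..t, z s r

/-- The regularity assumption
`max_{t ∈ [0,T]} (‖u(t)‖_{W^{k+1}_∞} + ‖∂_t u(t)‖_{H^1} + ‖∂_{tt} u(t)‖_{L²}) ≤ M`,
where `ut = ∂_t u` and `utt = ∂_{tt} u`. -/
structure HasRegularity (k : ℕ) (T M : ℝ) (u ut utt : ℝ → ℝ → ℝ) : Prop where
  isTimeDeriv : IsTimeDeriv T ut utt
  mem_space : ∀ t ∈ Icc 0 T, MemSobolev ⊤ (k + 1) (u t)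
  mem_time : ∀ t ∈ Icc 0 T, MemSobolev 2 1 (ut t)
  mem_time2 : ∀ t ∈ Icc 0 T, MemLp (utt t) 2 volI
  bound : ∀ t ∈ Icc 0 T, normWInf (k + 1) (u t) + normH 1 (ut t) + normL2 (utt t) ≤ M

/-! ### The discrete problem -/

/-- The finite element space `S^k_{h,0}`, `h = 1/N`: continuous functions on `[0,1]` that are
polynomials of degree at most `k` on each `[i/N, (i+1)/N]` and vanish at `0` and `1`. -/
def FESpace (k N : ℕ) : Set (ℝ → ℝ) :=
  {v | ContinuousOn v I ∧ v 0 = 0 ∧ v 1 = 0 ∧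
    ∀ i < N, ∃ p : Polynomial ℝ, p.natDegree ≤ k ∧
      ∀ r ∈ Icc ((i : ℝ) / N) (((i : ℝ) + 1) / N), v r = p.eval r}

/-- The nonlinearity `f(z) = z - ½ sin(2z)`. -/
def nonlin (z : ℝ) : ℝ := z - 1 / 2 * sin (2 * z)

/-- `uh 0, …, uh J` is a solution of the semi-implicit Euler / `P_k` finite element scheme
with mesh size `1/N` and time step `τ`. -/
structure IsDiscreteSolution (k N J : ℕ) (τ : ℝ) (uh : ℕ → ℝ → ℝ) : Prop where
  mem : ∀ j ≤ J, uh j ∈ FESpace k N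
  scheme : ∀ j < J, ∀ v ∈ FESpace k N,
    inner0 (fun r => (uh (j + 1) r - uh j r) / τ) v + innerH (uh (j + 1)) v
      = inner0 (fun r => nonlin (uh j r) / r ^ 2) v

end

end HeatFlow

/-! The function `nonlin` is the derivative of the convex function (z² - sin² z)/2, so the scheme
treats the convex quadratic part of the energy implicitly and the concave remainder explicitly.
Hence the discrete energy never increases, whatever τ and h (`IsDiscreteSolution.energy_le`), and
twice the energy dominates the square of the weighted norm of ∂_r. The derivative of the discrete
solution is thus bounded by 2 and that of u by M. This proves (a) as soon as τ + h^k + ‖u₀ - u_h⁰‖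
exceeds a fixed threshold δ. Below δ both parts follow from a bound in the full norm,
`exists_error_estimate_of_small`; the restrictions in (b) keep the data below δ.

Below the threshold the error is split at a comparison sequence U: the solution of the linear
implicit Euler scheme with load f(u(t_j))/r², started at the Ritz projection of u₀. Three properties
of U carry the proof (`exists_linear_comparison`). (1) U - u is of order τ + h^k in H^1_r. Since ∂_t
u is only in H^1, its Ritz error cannot be used with order h^k. The Ritz error ρ of u itself is
O(h^{k+1}) in L²_r by Aubin-Nitsche duality and enters the scheme as a time difference. Summation by
parts and parabolic smoothing bound its effect in the energy norm by √λ ‖ρ‖, where λ is the largest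
discrete eigenvalue, and λ = O(h⁻²) by the inverse estimate. No relation between τ and h is needed.
(2) |U| ≤ C√r uniformly in h, because the discrete operator applied to U is bounded in L²_r. (3) The
sum of the norms of U_{j+1} - U_j is bounded, by dissipation of the discrete time derivative.

The difference ε = u_h - U solves the scheme linearized around nothing: its forcing is the exact
difference of nonlinearities at U + ε and U plus a defect (f(U) - f(u))/r². By (2) the slope of f
between U and u is O(r), so the defect is O(τ + h^k) by (1). Testing with the increment of ε, and
using convexity of the potential, produces a relative energy: half the squared norm of ε minus the
second order Taylor remainder of the potential at U, plus a multiple of the L²_r norm squared. By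
(2) it is coercive as long as ε is small; by (3) the cost of moving the base point from U_j to
U_{j+1} is summable. A discrete Gronwall argument closes the estimate. One step enlarges ε by at
most a fixed factor, so smallness propagates from one step to the next. -/

open Real Set MeasureTheory

namespace HeatFlow

/-! ### Bounded measurable functions on the unit interval -/

/-- Essentially bounded measurable functions on `I`. -/
def IsBdd (g : ℝ → ℝ) : Prop := MemLp g ⊤ volI

theorem isBdd_const (c : ℝ) : IsBdd fun _ => c := memLp_top_const c

theorem IsBdd.of_bound {g : ℝ → ℝ} (hg : AEStronglyMeasurable g volI) (B : ℝ)
    (hB : ∀ᵐ r ∂volI, |g r| ≤ B) : IsBdd g :=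
  memLp_top_of_bound hg B hB

theorem IsBdd.meas {g : ℝ → ℝ} (hg : IsBdd g) : AEStronglyMeasurable g volI := hg.1

theorem isBdd_of_continuousOn {g : ℝ → ℝ} (hg : ContinuousOn g I) : IsBdd g := by
  obtain ⟨B, hB⟩ := isCompact_Icc.exists_bound_of_continuousOn hg
  refine IsBdd.of_bound (hg.aestronglyMeasurable measurableSet_Icc) B ?_
  filter_upwards [ae_restrict_mem measurableSet_Icc] with r hr using hB r hr

theorem IsBdd.congr {g g' : ℝ → ℝ} (hg : IsBdd g) (h : g =ᵐ[volI] g') : IsBdd g' :=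
  (memLp_congr_ae h).1 hg

theorem IsBdd.add {g g' : ℝ → ℝ} (hg : IsBdd g) (hg' : IsBdd g') : IsBdd fun r => g r + g' r :=
  MemLp.add hg hg'

theorem IsBdd.sub {g g' : ℝ → ℝ} (hg : IsBdd g) (hg' : IsBdd g') : IsBdd fun r => g r - g' r :=
  MemLp.sub hg hg'

theorem IsBdd.mul {g g' : ℝ → ℝ} (hg : IsBdd g) (hg' : IsBdd g') : IsBdd fun r => g r * g' r :=
  MemLp.mul (p := ⊤) (q := ⊤) (r := ⊤) hg' hg

theorem IsBdd.const_mul {g : ℝ → ℝ} (hg : IsBdd g) (c : ℝ) : IsBdd fun r => c * g r :=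
  MemLp.const_mul hg c

theorem isBdd_id : IsBdd fun r => r := isBdd_of_continuousOn continuousOn_id

theorem IsBdd.integrable {g : ℝ → ℝ} (hg : IsBdd g) : Integrable g volI :=
  MemLp.integrable le_top hg

theorem ae_Ioo : ∀ᵐ r ∂volI, r ∈ Ioo (0 : ℝ) 1 := by
  have : volI = volume.restrict (Ioo (0 : ℝ) 1) := Measure.restrict_congr_set Ioo_ae_eq_Icc.symm
  rw [this]
  exact ae_restrict_mem measurableSet_Ioo

theorem integral_eq_volI (g : ℝ → ℝ) : ∫ r in (0 : ℝ)..1, g r = ∫ r, g r ∂volI := by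
  rw [intervalIntegral.integral_of_le zero_le_one, integral_Icc_eq_integral_Ioc]

theorem inner0_eq (v w : ℝ → ℝ) : inner0 v w = ∫ r, v r * w r * r ∂volI := integral_eq_volI _

theorem inner0_congr {v v' w w' : ℝ → ℝ} (hv : v =ᵐ[volI] v') (hw : w =ᵐ[volI] w') :
    inner0 v w = inner0 v' w' := by
  rw [inner0_eq, inner0_eq]
  refine integral_congr_ae ?_
  filter_upwards [hv, hw] with r h1 h2
  rw [h1, h2]

theorem inner0_comm (v w : ℝ → ℝ) : inner0 v w = inner0 w v := by
  simp only [inner0, mul_comm (v _)]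

theorem IsBdd.integrable_mul {v w : ℝ → ℝ} (hv : IsBdd v) (hw : IsBdd w) :
    Integrable (fun r => v r * w r * r) volI := ((hv.mul hw).mul isBdd_id).integrable

theorem inner0_add_left {v v' w : ℝ → ℝ} (hv : IsBdd v) (hv' : IsBdd v') (hw : IsBdd w) :
    inner0 (fun r => v r + v' r) w = inner0 v w + inner0 v' w := by
  rw [inner0_eq, inner0_eq, inner0_eq, ← integral_add (hv.integrable_mul hw) (hv'.integrable_mul hw)]
  congr 1; ext r; ring

theorem inner0_smul_left (c : ℝ) (v w : ℝ → ℝ) :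
    inner0 (fun r => c * v r) w = c * inner0 v w := by
  rw [inner0_eq, inner0_eq, ← integral_const_mul]
  congr 1; ext r; ring

theorem inner0_sub_left {v v' w : ℝ → ℝ} (hv : IsBdd v) (hv' : IsBdd v') (hw : IsBdd w) :
    inner0 (fun r => v r - v' r) w = inner0 v w - inner0 v' w := by
  rw [inner0_eq, inner0_eq, inner0_eq, ← integral_sub (hv.integrable_mul hw) (hv'.integrable_mul hw)]
  congr 1; ext r; ring

theorem inner0_sum_left {ι : Type*} (s : Finset ι) {g : ι → ℝ → ℝ} {w : ℝ → ℝ}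
    (hg : ∀ i, IsBdd (g i)) (hw : IsBdd w) :
    inner0 (fun r => ∑ i ∈ s, g i r) w = ∑ i ∈ s, inner0 (g i) w := by
  simp only [inner0_eq, Finset.sum_mul]
  exact integral_finsetSum s fun i _ => (hg i).integrable_mul hw

theorem inner0_self_nonneg (v : ℝ → ℝ) : 0 ≤ inner0 v v := by
  rw [inner0_eq]
  refine integral_nonneg_of_ae ?_
  filter_upwards [ae_Ioo] with r hr
  exact mul_nonneg (mul_self_nonneg _) hr.1.le

theorem norm0_nonneg (v : ℝ → ℝ) : 0 ≤ norm0 v := Real.sqrt_nonneg _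

theorem norm0_sq (v : ℝ → ℝ) : norm0 v ^ 2 = inner0 v v := Real.sq_sqrt (inner0_self_nonneg v)

/-- The discriminant argument for Cauchy-Schwarz, isolated because both `inner0` and `innerH` need
it. -/
theorem abs_le_sqrt_mul_sqrt_of_quadratic_nonneg {a b c : ℝ} (ha : 0 ≤ a)
    (h : ∀ t : ℝ, 0 ≤ a + 2 * t * b + t ^ 2 * c) : |b| ≤ √a * √c := by
  have hd := discrim_le_zero (a := c) (b := 2 * b) (c := a) fun t => by nlinarith [h t]
  rw [discrim] at hd
  rw [← Real.sqrt_mul ha]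
  exact Real.abs_le_sqrt (by nlinarith)

theorem inner0_self_le {v w : ℝ → ℝ} (hw : IsBdd w)
    (h : ∀ᵐ r ∂volI, |v r| ≤ |w r|) : inner0 v v ≤ inner0 w w := by
  rw [inner0_eq, inner0_eq]
  refine integral_mono_of_nonneg ?_ (hw.integrable_mul hw) ?_
  · filter_upwards [ae_Ioo] with r hr
    exact mul_nonneg (mul_self_nonneg _) hr.1.le
  · filter_upwards [ae_Ioo, h] with r hr h
    exact mul_le_mul_of_nonneg_right (abs_le_iff_mul_self_le.1 h) hr.1.le

theorem norm0_mono {v w : ℝ → ℝ} (hw : IsBdd w)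
    (h : ∀ᵐ r ∂volI, |v r| ≤ |w r|) : norm0 v ≤ norm0 w :=
  Real.sqrt_le_sqrt (inner0_self_le hw h)

theorem norm0_smul (c : ℝ) (v : ℝ → ℝ) : norm0 (fun r => c * v r) = |c| * norm0 v := by
  rw [norm0, inner0_smul_left, inner0_comm, inner0_smul_left, ← mul_assoc,
    Real.sqrt_mul (mul_self_nonneg c), Real.sqrt_mul_self_eq_abs, norm0]

theorem abs_inner0_le {v w : ℝ → ℝ} (hv : IsBdd v) (hw : IsBdd w) :
    |inner0 v w| ≤ norm0 v * norm0 w := by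
  refine abs_le_sqrt_mul_sqrt_of_quadratic_nonneg (inner0_self_nonneg v)
    fun t => ?_
  have h := inner0_self_nonneg (fun r => v r + t * w r)
  have ht := hw.const_mul t
  rw [inner0_add_left hv ht (hv.add ht), inner0_comm v, inner0_comm (fun r => t * w r),
    inner0_add_left hv ht hv, inner0_add_left hv ht ht, inner0_smul_left, inner0_smul_left,
    inner0_comm v (fun r => t * w r), inner0_comm w (fun r => t * w r), inner0_smul_left,
    inner0_smul_left, inner0_comm w v] at h
  linarith

theorem norm0_add_le {v w : ℝ → ℝ} (hv : IsBdd v) (hw : IsBdd w) :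
    norm0 (fun r => v r + w r) ≤ norm0 v + norm0 w := by
  refine Real.sqrt_le_iff.2 ⟨add_nonneg (norm0_nonneg _) (norm0_nonneg _), ?_⟩
  rw [inner0_add_left hv hw (hv.add hw), inner0_comm v, inner0_comm w,
    inner0_add_left hv hw hv, inner0_add_left hv hw hw, inner0_comm w v, ← norm0_sq, ← norm0_sq]
  nlinarith [le_of_abs_le (abs_inner0_le hv hw)]

theorem norm0_le_of_bound {v : ℝ → ℝ} {B : ℝ} (hB : 0 ≤ B)
    (h : ∀ᵐ r ∂volI, |v r| ≤ B) : norm0 v ≤ B := by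
  refine (norm0_mono (isBdd_const B) (h.mono fun r hr => hr.trans (le_abs_self B))).trans ?_
  refine Real.sqrt_le_iff.2 ⟨hB, ?_⟩
  rw [inner0, intervalIntegral.integral_const_mul, integral_id]
  nlinarith [sq_nonneg B]

/-! ### Lipschitz functions vanishing at the end points -/

/-- Lipschitz functions on `I` vanishing at both end points. -/
structure Lip0 (v : ℝ → ℝ) : Prop where
  lip : ∃ K : NNReal, LipschitzOnWith K v I
  zero : v 0 = 0
  one : v 1 = 0

theorem D_eq_deriv (v : ℝ → ℝ) {r : ℝ} (hr : r ∈ Ioo (0 : ℝ) 1) : D v r = deriv v r :=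
  derivWithin_of_mem_nhds (Icc_mem_nhds hr.1 hr.2)

theorem D_ae_eq (v : ℝ → ℝ) : D v =ᵐ[volI] deriv v :=
  ae_Ioo.mono fun _ hr => D_eq_deriv v hr

theorem D_ae_congr {v w : ℝ → ℝ} (h : ∀ r ∈ I, v r = w r) : D v =ᵐ[volI] D w := by
  filter_upwards [ae_Ioo] with r hr
  exact derivWithin_congr h (h r ⟨hr.1.le, hr.2.le⟩)

theorem aestronglyMeasurable_D (v : ℝ → ℝ) : AEStronglyMeasurable (D v) volI :=
  ⟨deriv v, (measurable_deriv v).stronglyMeasurable, D_ae_eq v⟩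

theorem ae_differentiableAt_of_lipschitzOn {v : ℝ → ℝ} {K : NNReal} (h : LipschitzOnWith K v I) :
    ∀ᵐ r ∂volI, DifferentiableAt ℝ v r := by
  filter_upwards [h.ae_differentiableWithinAt_real measurableSet_Icc, ae_Ioo] with r hr hr'
  exact hr.differentiableAt (Icc_mem_nhds hr'.1 hr'.2)

theorem ae_abs_D_le {v : ℝ → ℝ} {K : NNReal} (h : LipschitzOnWith K v I) :
    ∀ᵐ r ∂volI, |D v r| ≤ K := by
  filter_upwards [ae_Ioo] with r hr
  rw [D_eq_deriv v hr]
  exact norm_deriv_le_of_lipschitzOn (Icc_mem_nhds hr.1 hr.2) h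

theorem isBdd_D {v : ℝ → ℝ} {K : NNReal} (h : LipschitzOnWith K v I) : IsBdd (D v) :=
  IsBdd.of_bound (aestronglyMeasurable_D v) K (ae_abs_D_le h)

theorem Lip0.bddD {v : ℝ → ℝ} (hv : Lip0 v) : IsBdd (D v) := by
  obtain ⟨K, hK⟩ := hv.lip
  exact isBdd_D hK

theorem Lip0.continuousOn {v : ℝ → ℝ} (hv : Lip0 v) : ContinuousOn v I := by
  obtain ⟨K, hK⟩ := hv.lip
  exact hK.continuousOn

theorem Lip0.bdd {v : ℝ → ℝ} (hv : Lip0 v) : IsBdd v := isBdd_of_continuousOn hv.continuousOn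

theorem abs_le_mul_of_lipschitzOn {v : ℝ → ℝ} {K : NNReal} (h : LipschitzOnWith K v I)
    (h0 : v 0 = 0) {r : ℝ} (hr : r ∈ I) : |v r| ≤ K * r := by
  have := h.dist_le_mul r hr 0 ⟨le_rfl, zero_le_one⟩
  rwa [Real.dist_eq, Real.dist_eq, h0, sub_zero, sub_zero, abs_of_nonneg hr.1] at this

theorem aestronglyMeasurable_div {g : ℝ → ℝ} (hg : AEStronglyMeasurable g volI) (n : ℕ) :
    AEStronglyMeasurable (fun r => g r / r ^ n) volI :=
  (hg.aemeasurable.div (measurable_id.pow_const n).aemeasurable).aestronglyMeasurable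

theorem Lip0.bdd_div {v : ℝ → ℝ} (hv : Lip0 v) : IsBdd fun r => v r / r := by
  obtain ⟨K, hK⟩ := hv.lip
  refine IsBdd.of_bound (by simpa using aestronglyMeasurable_div hv.bdd.meas 1) K ?_
  filter_upwards [ae_Ioo] with r hr
  rw [abs_div, abs_of_pos hr.1, div_le_iff₀ hr.1]
  exact abs_le_mul_of_lipschitzOn hK hv.zero ⟨hr.1.le, hr.2.le⟩

theorem Lip0.ae_differentiableAt {v : ℝ → ℝ} (hv : Lip0 v) :
    ∀ᵐ r ∂volI, DifferentiableAt ℝ v r := by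
  obtain ⟨K, hK⟩ := hv.lip
  exact ae_differentiableAt_of_lipschitzOn hK

theorem Lip0.ac {v : ℝ → ℝ} (hv : Lip0 v) : AbsolutelyContinuousOnInterval v 0 1 := by
  obtain ⟨K, hK⟩ := hv.lip
  exact LipschitzOnWith.absolutelyContinuousOnInterval (K := K) (by rwa [uIcc_of_le zero_le_one])

theorem Lip0.congr {v w : ℝ → ℝ} (hv : Lip0 v) (h : ∀ r ∈ I, v r = w r) : Lip0 w := by
  obtain ⟨K, hK⟩ := hv.lip
  refine ⟨⟨K, fun x hx y hy => ?_⟩, ?_, ?_⟩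
  · rw [← h x hx, ← h y hy]; exact hK hx hy
  · rw [← h 0 (by simp), hv.zero]
  · rw [← h 1 (by simp), hv.one]

theorem Lip0.add {v w : ℝ → ℝ} (hv : Lip0 v) (hw : Lip0 w) : Lip0 fun r => v r + w r := by
  obtain ⟨K, hK⟩ := hv.lip
  obtain ⟨K', hK'⟩ := hw.lip
  exact ⟨⟨K + K', hK.add hK'⟩, by simp [hv.zero, hw.zero], by simp [hv.one, hw.one]⟩

theorem Lip0.const_mul {v : ℝ → ℝ} (hv : Lip0 v) (c : ℝ) : Lip0 fun r => c * v r := by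
  obtain ⟨K, hK⟩ := hv.lip
  refine ⟨⟨‖c‖₊ * K, LipschitzOnWith.of_dist_le_mul fun x hx y hy => ?_⟩, by simp [hv.zero],
    by simp [hv.one]⟩
  have := hK.dist_le_mul x hx y hy
  rw [Real.dist_eq] at this ⊢
  rw [← mul_sub, abs_mul, NNReal.coe_mul, coe_nnnorm, Real.norm_eq_abs, mul_assoc]
  exact mul_le_mul_of_nonneg_left this (abs_nonneg c)

theorem Lip0.sub {v w : ℝ → ℝ} (hv : Lip0 v) (hw : Lip0 w) : Lip0 fun r => v r - w r := by
  have := hv.add (hw.const_mul (-1))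
  refine this.congr fun r _ => by ring

theorem lip0_zero : Lip0 fun _ => 0 :=
  ⟨⟨0, LipschitzOnWith.of_dist_le_mul fun x _ y _ => by simp⟩, rfl, rfl⟩

theorem Lip0.sum {ι : Type*} {s : Finset ι} {v : ι → ℝ → ℝ} (hv : ∀ i, Lip0 (v i)) :
    Lip0 fun r => ∑ i ∈ s, v i r := by
  classical
  induction s using Finset.induction_on with
  | empty => simpa using lip0_zero
  | insert a s ha ih => simpa [Finset.sum_insert ha] using (hv a).add ih

theorem Lip0.D_add {v w : ℝ → ℝ} (hv : Lip0 v) (hw : Lip0 w) :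
    D (fun r => v r + w r) =ᵐ[volI] fun r => D v r + D w r := by
  filter_upwards [hv.ae_differentiableAt, hw.ae_differentiableAt, ae_Ioo] with r h1 h2 hr
  rw [D_eq_deriv _ hr, D_eq_deriv _ hr, D_eq_deriv _ hr]
  exact deriv_fun_add h1 h2

theorem D_const_mul (c : ℝ) (v : ℝ → ℝ) : D (fun r => c * v r) = fun r => c * D v r := by
  ext r
  exact derivWithin_const_mul_field c

theorem Lip0.D_sub {v w : ℝ → ℝ} (hv : Lip0 v) (hw : Lip0 w) :
    D (fun r => v r - w r) =ᵐ[volI] fun r => D v r - D w r := by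
  filter_upwards [hv.ae_differentiableAt, hw.ae_differentiableAt, ae_Ioo] with r h1 h2 hr
  rw [D_eq_deriv _ hr, D_eq_deriv _ hr, D_eq_deriv _ hr]
  exact deriv_fun_sub h1 h2

theorem innerH_congr {v v' w w' : ℝ → ℝ} (hv : ∀ r ∈ I, v r = v' r) (hw : ∀ r ∈ I, w r = w' r) :
    innerH v w = innerH v' w' := by
  have aux : ∀ {g g' : ℝ → ℝ}, (∀ r ∈ I, g r = g' r) →
      (fun r => g r / r) =ᵐ[volI] fun r => g' r / r := fun h => by
    filter_upwards [ae_restrict_mem measurableSet_Icc] with r hr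
    rw [h r hr]
  rw [innerH, innerH, inner0_congr (D_ae_congr hv) (D_ae_congr hw), inner0_congr (aux hv) (aux hw)]

theorem innerH_comm (v w : ℝ → ℝ) : innerH v w = innerH w v := by
  rw [innerH, innerH, inner0_comm, inner0_comm (fun r => v r / r)]

theorem innerH_add_left {v v' w : ℝ → ℝ} (hv : Lip0 v) (hv' : Lip0 v') (hw : Lip0 w) :
    innerH (fun r => v r + v' r) w = innerH v w + innerH v' w := by
  simp only [innerH, add_div]
  rw [inner0_congr (hv.D_add hv') (Filter.EventuallyEq.refl _ (D w)),
    inner0_add_left hv.bddD hv'.bddD hw.bddD, inner0_add_left hv.bdd_div hv'.bdd_div hw.bdd_div]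
  ring

theorem innerH_smul_left (c : ℝ) (v w : ℝ → ℝ) :
    innerH (fun r => c * v r) w = c * innerH v w := by
  simp only [innerH, mul_div_assoc]
  rw [D_const_mul, inner0_smul_left, inner0_smul_left]
  ring

theorem innerH_sub_left {v v' w : ℝ → ℝ} (hv : Lip0 v) (hv' : Lip0 v') (hw : Lip0 w) :
    innerH (fun r => v r - v' r) w = innerH v w - innerH v' w := by
  simp only [innerH, sub_div]
  rw [inner0_congr (hv.D_sub hv') (Filter.EventuallyEq.refl _ (D w)),
    inner0_sub_left hv.bddD hv'.bddD hw.bddD, inner0_sub_left hv.bdd_div hv'.bdd_div hw.bdd_div]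
  ring

theorem innerH_sum_left {ι : Type*} (s : Finset ι) {v : ι → ℝ → ℝ} {w : ℝ → ℝ}
    (hv : ∀ i, Lip0 (v i)) (hw : Lip0 w) :
    innerH (fun r => ∑ i ∈ s, v i r) w = ∑ i ∈ s, innerH (v i) w := by
  classical
  induction s using Finset.induction_on with
  | empty =>
    have := innerH_smul_left 0 (fun _ => 0) w
    simpa using this
  | insert a s ha ih =>
    simp only [Finset.sum_insert ha]
    rw [innerH_add_left (hv a) (Lip0.sum hv) hw, ih]

theorem innerH_self_nonneg (v : ℝ → ℝ) : 0 ≤ innerH v v :=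
  add_nonneg (inner0_self_nonneg _) (inner0_self_nonneg _)

theorem normHr_nonneg (v : ℝ → ℝ) : 0 ≤ normHr v := Real.sqrt_nonneg _

theorem normHr_sq (v : ℝ → ℝ) : normHr v ^ 2 = innerH v v := Real.sq_sqrt (innerH_self_nonneg v)

theorem abs_innerH_le {v w : ℝ → ℝ} (hv : Lip0 v) (hw : Lip0 w) :
    |innerH v w| ≤ normHr v * normHr w := by
  refine abs_le_sqrt_mul_sqrt_of_quadratic_nonneg (innerH_self_nonneg v)
    fun t => ?_
  have h := innerH_self_nonneg (fun r => v r + t * w r)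
  have ht := hw.const_mul t
  rw [innerH_add_left hv ht (hv.add ht), innerH_comm v, innerH_comm (fun r => t * w r),
    innerH_add_left hv ht hv, innerH_add_left hv ht ht, innerH_smul_left, innerH_smul_left,
    innerH_comm v (fun r => t * w r), innerH_comm w (fun r => t * w r), innerH_smul_left,
    innerH_smul_left, innerH_comm w v] at h
  linarith

theorem normHr_smul (c : ℝ) (v : ℝ → ℝ) : normHr (fun r => c * v r) = |c| * normHr v := by
  rw [normHr, innerH_smul_left, innerH_comm, innerH_smul_left, ← mul_assoc,
    Real.sqrt_mul (mul_self_nonneg c), Real.sqrt_mul_self_eq_abs, normHr]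

theorem normHr_congr {v w : ℝ → ℝ} (h : ∀ r ∈ I, v r = w r) : normHr v = normHr w := by
  rw [normHr, normHr, innerH_congr h h]

theorem normHr_add_le {v w : ℝ → ℝ} (hv : Lip0 v) (hw : Lip0 w) :
    normHr (fun r => v r + w r) ≤ normHr v + normHr w := by
  refine Real.sqrt_le_iff.2 ⟨add_nonneg (normHr_nonneg _) (normHr_nonneg _), ?_⟩
  rw [innerH_add_left hv hw (hv.add hw), innerH_comm v, innerH_comm w,
    innerH_add_left hv hw hv, innerH_add_left hv hw hw, innerH_comm w v, ← normHr_sq, ← normHr_sq]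
  nlinarith [le_of_abs_le (abs_innerH_le hv hw)]

theorem normHr_sub_comm (v w : ℝ → ℝ) :
    normHr (fun r => v r - w r) = normHr (fun r => w r - v r) := by
  have := normHr_smul (-1) (fun r => w r - v r)
  rw [abs_neg, abs_one, one_mul] at this
  rw [← this]
  exact normHr_congr fun r _ => by ring

theorem normHr_sub_le {v w z : ℝ → ℝ} (hv : Lip0 v) (hw : Lip0 w) (hz : Lip0 z) :
    normHr (fun r => v r - z r) ≤ normHr (fun r => v r - w r) + normHr (fun r => w r - z r) := by
  refine le_of_eq_of_le (normHr_congr fun r _ => ?_) (normHr_add_le (hv.sub hw) (hw.sub hz))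
  ring

/-! ### Embeddings -/

theorem norm0_D_le_normHr (v : ℝ → ℝ) : norm0 (D v) ≤ normHr v :=
  Real.sqrt_le_sqrt (le_add_of_nonneg_right (inner0_self_nonneg _))

theorem norm0_div_le_normHr (v : ℝ → ℝ) : norm0 (fun r => v r / r) ≤ normHr v :=
  Real.sqrt_le_sqrt (le_add_of_nonneg_left (inner0_self_nonneg _))

theorem Lip0.norm0_le_normHr {v : ℝ → ℝ} (hv : Lip0 v) : norm0 v ≤ normHr v := by
  refine le_trans (norm0_mono hv.bdd_div ?_) (norm0_div_le_normHr v)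
  filter_upwards [ae_Ioo] with r hr
  rw [abs_div, abs_of_pos hr.1, le_div_iff₀ hr.1]
  exact mul_le_of_le_one_right (abs_nonneg _) hr.2.le

theorem innerH_self_eq {v : ℝ → ℝ} (hv : Lip0 v) :
    innerH v v = ∫ r, D v r * D v r * r + v r / r * (v r / r) * r ∂volI := by
  rw [innerH, inner0_eq, inner0_eq, integral_add (hv.bddD.integrable_mul hv.bddD)
    (hv.bdd_div.integrable_mul hv.bdd_div)]

/-- The sup norm is bounded by the norm of `H^1_r`. -/
theorem Lip0.abs_le_normHr {v : ℝ → ℝ} (hv : Lip0 v) {r : ℝ} (hr : r ∈ I) : |v r| ≤ normHr v := by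
  refine Real.abs_le_sqrt ?_
  have hac : AbsolutelyContinuousOnInterval v 0 r :=
    hv.ac.mono (by rw [uIcc_of_le hr.1, uIcc_of_le zero_le_one]; exact Icc_subset_Icc_right hr.2)
  -- Here v(r)² = 2∫ v v' ds = 2∫ v' (v/s) s ds, and Young's inequality bounds the integrand by the
  -- density of the squared norm.
  have h := hac.integral_deriv_mul_eq_sub hac
  rw [hv.zero, mul_zero, sub_zero] at h
  rw [sq, ← h, innerH_self_eq hv, intervalIntegral.integral_of_le hr.1,
    ← integral_Icc_eq_integral_Ioc]
  have hi : Integrable (fun r => D v r * D v r * r + v r / r * (v r / r) * r) volI :=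
    (hv.bddD.integrable_mul hv.bddD).add (hv.bdd_div.integrable_mul hv.bdd_div)
  have hnn : ∀ᵐ s ∂volI, 0 ≤ D v s * D v s * s + v s / s * (v s / s) * s := by
    filter_upwards [ae_Ioo] with s hs
    have := hs.1.le
    have := mul_self_nonneg (D v s)
    have := mul_self_nonneg (v s / s)
    positivity
  have hle : volume.restrict (Icc 0 r) ≤ volI := Measure.restrict_mono (Icc_subset_Icc_right hr.2) le_rfl
  refine le_trans (integral_mono_ae ?_ (hi.mono_measure hle) ?_) (integral_mono_measure hle hnn hi)
  · have hb : IsBdd fun s => deriv v s * v s + v s * deriv v s := by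
      have hd : IsBdd (deriv v) := hv.bddD.congr (D_ae_eq v)
      exact (hd.mul hv.bdd).add (hv.bdd.mul hd)
    exact hb.integrable.mono_measure hle
  · filter_upwards [ae_mono hle ae_Ioo] with s hs
    rw [D_eq_deriv v hs]
    have h1 : v s = v s / s * s := by field_simp [hs.1.ne']
    have h2 := mul_nonneg hs.1.le (sq_nonneg (deriv v s - v s / s))
    calc deriv v s * v s + v s * deriv v s = 2 * deriv v s * (v s / s * s) := by rw [← h1]; ring
      _ ≤ _ := by nlinarith

/-- Integration by parts: the weak form of `-(w'' + w'/r - w/r²) = F`. -/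
theorem innerH_eq_inner0_of_lipschitz {w p F v : ℝ → ℝ} {K : NNReal} (hw : Lip0 w) (hF : IsBdd F)
    (hp : LipschitzOnWith K p I) (hpw : ∀ᵐ r ∂volI, p r = r * D w r)
    (hpF : ∀ᵐ r ∂volI, D p r = w r / r - r * F r) (hv : Lip0 v) :
    innerH w v = inner0 F v := by
  have hpac : AbsolutelyContinuousOnInterval p 0 1 :=
    LipschitzOnWith.absolutelyContinuousOnInterval (K := K) (by rwa [uIcc_of_le zero_le_one])
  -- The flux p = r w' is paired with v; both boundary terms vanish because v does at 0 and 1.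
  have h := hpac.integral_deriv_mul_eq_sub hv.ac
  rw [hv.zero, hv.one, mul_zero, mul_zero, sub_zero, integral_eq_volI] at h
  have hi : Integrable (fun r => D w r * D v r * r + w r / r * (v r / r) * r) volI :=
    (hw.bddD.integrable_mul hv.bddD).add (hw.bdd_div.integrable_mul hv.bdd_div)
  have e : innerH w v - inner0 F v = ∫ r, deriv p r * v r + p r * deriv v r ∂volI := by
    rw [innerH, inner0_eq, inner0_eq, inner0_eq,
      ← integral_add (hw.bddD.integrable_mul hv.bddD) (hw.bdd_div.integrable_mul hv.bdd_div),
      ← integral_sub hi (hF.integrable_mul hv.bdd)]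
    refine integral_congr_ae ?_
    filter_upwards [hpw, hpF, ae_Ioo] with r h1 h2 hr
    rw [← D_eq_deriv _ hr, ← D_eq_deriv _ hr, h1, h2]
    have := hr.1.ne'
    field_simp
    ring
  linarith

/-! ### The finite element space -/

theorem node_mem_I {N i : ℕ} (hN : 1 ≤ N) (hi : i ≤ N) : (i : ℝ) / N ∈ I := by
  have hN' : (0 : ℝ) < N := by exact_mod_cast hN
  have hi' : (i : ℝ) ≤ N := by exact_mod_cast hi
  exact ⟨by positivity, (div_le_one hN').2 hi'⟩

theorem node_le_succ (N i : ℕ) : (i : ℝ) / N ≤ ((i : ℝ) + 1) / N := by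
  gcongr
  linarith

theorem element_subset_I {N i : ℕ} (hN : 1 ≤ N) (hi : i < N) :
    Icc ((i : ℝ) / N) (((i : ℝ) + 1) / N) ⊆ I := by
  have h1 := node_mem_I hN hi.le
  have h2 := node_mem_I hN (Nat.succ_le_of_lt hi)
  push_cast at h2
  exact Icc_subset_Icc h1.1 h2.2

theorem exists_lipschitz_polynomial (p : Polynomial ℝ) (a b : ℝ) :
    ∃ K : NNReal, LipschitzOnWith K (fun r => p.eval r) (Icc a b) :=
  (p.contDiff_aeval (R := ℝ) (𝕜 := ℝ) 1).contDiffOn.exists_lipschitzOnWith (n := 1) (by decide) (convex_Icc a b) isCompact_Icc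

theorem lipschitzOnWith_Icc_union {v : ℝ → ℝ} {K : NNReal} {a b c : ℝ}
    (h1 : LipschitzOnWith K v (Icc a b)) (h2 : LipschitzOnWith K v (Icc b c)) :
    LipschitzOnWith K v (Icc a c) := by
  refine LipschitzOnWith.of_dist_le_mul ?_
  have key : ∀ x ∈ Icc a c, ∀ y ∈ Icc a c, x ≤ y → dist (v x) (v y) ≤ K * dist x y := by
    intro x hx y hy hxy
    rcases le_total y b with hyb | hyb
    · exact h1.dist_le_mul x ⟨hx.1, hxy.trans hyb⟩ y ⟨hy.1, hyb⟩
    rcases le_total b x with hbx | hbx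
    · exact h2.dist_le_mul x ⟨hbx, hx.2⟩ y ⟨hyb, hy.2⟩
    have e1 := h1.dist_le_mul x ⟨hx.1, hbx⟩ b ⟨hx.1.trans hbx, le_rfl⟩
    have e2 := h2.dist_le_mul b ⟨le_rfl, hyb.trans hy.2⟩ y ⟨hyb, hy.2⟩
    have e3 := dist_triangle (v x) (v b) (v y)
    rw [Real.dist_eq x, abs_of_nonpos (by linarith)] at e1 ⊢
    rw [Real.dist_eq b, abs_of_nonpos (by linarith)] at e2
    nlinarith
  intro x hx y hy
  rcases le_total x y with h | h
  · exact key x hx y hy h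
  · rw [dist_comm, dist_comm x]
    exact key y hy x hx h

/-- Each polynomial piece is Lipschitz on its compact element, and a common constant survives gluing
at the nodes. Discrete and exact solutions thus share one class on which all integrals converge. -/
theorem FESpace.lip0 {k N : ℕ} (hN : 1 ≤ N) {v : ℝ → ℝ} (hv : v ∈ FESpace k N) : Lip0 v := by
  obtain ⟨-, h0, h1, hp⟩ := hv
  have hK : ∀ i : ℕ, ∃ K : NNReal, i < N →
      LipschitzOnWith K v (Icc ((i : ℝ) / N) (((i : ℝ) + 1) / N)) := by
    intro i
    by_cases hi : i < N
    · obtain ⟨p, -, hp⟩ := hp i hi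
      obtain ⟨K, hK⟩ := exists_lipschitz_polynomial p ((i : ℝ) / N) (((i : ℝ) + 1) / N)
      refine ⟨K, fun _ x hx y hy => ?_⟩
      rw [hp x hx, hp y hy]
      exact hK hx hy
    · exact ⟨0, fun h => absurd h hi⟩
  choose K hK using hK
  have hN' : (0 : ℝ) < N := by exact_mod_cast hN
  have key : ∀ n ≤ N, LipschitzOnWith (∑ i ∈ Finset.range N, K i) v (Icc 0 ((n : ℝ) / N)) := by
    intro n
    induction n with
    | zero =>
      intro _
      refine LipschitzOnWith.of_dist_le_mul fun x hx y hy => ?_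
      simp only [CharP.cast_eq_zero, zero_div, Icc_self, mem_singleton_iff] at hx hy
      simp [hx, hy]
    | succ n ih =>
      intro hn
      refine lipschitzOnWith_Icc_union (ih (by omega)) ?_
      have := hK n (by omega)
      push_cast
      exact this.weaken (Finset.single_le_sum (f := K) (fun _ _ => zero_le)
        (Finset.mem_range.2 (by omega)))
  have h := key N le_rfl
  rw [div_self hN'.ne'] at h
  exact ⟨⟨_, h⟩, h0, h1⟩

theorem FESpace.add {k N : ℕ} {v w : ℝ → ℝ} (hv : v ∈ FESpace k N) (hw : w ∈ FESpace k N) :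
    (fun r => v r + w r) ∈ FESpace k N := by
  refine ⟨hv.1.add hw.1, by simp [hv.2.1, hw.2.1], by simp [hv.2.2.1, hw.2.2.1], fun i hi => ?_⟩
  obtain ⟨p, hp, hpv⟩ := hv.2.2.2 i hi
  obtain ⟨q, hq, hqw⟩ := hw.2.2.2 i hi
  refine ⟨p + q, Polynomial.natDegree_add_le_of_degree_le hp hq, fun r hr => ?_⟩
  simp only [hpv r hr, hqw r hr, Polynomial.eval_add]

theorem FESpace.const_mul {k N : ℕ} {v : ℝ → ℝ} (hv : v ∈ FESpace k N) (c : ℝ) :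
    (fun r => c * v r) ∈ FESpace k N := by
  refine ⟨hv.1.const_mul c, by simp [hv.2.1], by simp [hv.2.2.1], fun i hi => ?_⟩
  obtain ⟨p, hp, hpv⟩ := hv.2.2.2 i hi
  refine ⟨Polynomial.C c * p, (Polynomial.natDegree_C_mul_le c p).trans hp, fun r hr => ?_⟩
  simp only [hpv r hr, Polynomial.eval_mul, Polynomial.eval_C]

theorem FESpace.zero_mem (k N : ℕ) : (fun _ => (0 : ℝ)) ∈ FESpace k N :=
  ⟨continuousOn_const, rfl, rfl, fun _ _ => ⟨0, by simp, by simp⟩⟩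

theorem FESpace.sub {k N : ℕ} {v w : ℝ → ℝ} (hv : v ∈ FESpace k N) (hw : w ∈ FESpace k N) :
    (fun r => v r - w r) ∈ FESpace k N := by
  convert FESpace.add hv (FESpace.const_mul hw (-1)) using 2
  ring

theorem FESpace.sum {k N : ℕ} {ι : Type*} {s : Finset ι} {v : ι → ℝ → ℝ}
    (hv : ∀ i, v i ∈ FESpace k N) : (fun r => ∑ i ∈ s, v i r) ∈ FESpace k N := by
  classical
  induction s using Finset.induction_on with
  | empty => simpa using FESpace.zero_mem k N
  | insert a s ha ih => simpa [Finset.sum_insert ha] using FESpace.add (hv a) ih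

/-- Matching polynomial pieces define a finite element function. -/
theorem FESpace.exists_glue {k N : ℕ} (hN : 1 ≤ N) (p : ℕ → Polynomial ℝ)
    (hdeg : ∀ i, (p i).natDegree ≤ k)
    (hmatch : ∀ i : ℕ, i + 1 < N →
      (p i).eval (((i : ℝ) + 1) / N) = (p (i + 1)).eval (((i : ℝ) + 1) / N))
    (h0 : (p 0).eval 0 = 0) (h1 : (p (N - 1)).eval 1 = 0) :
    ∃ χ ∈ FESpace k N, ∀ i < N, ∀ r ∈ Icc ((i : ℝ) / N) (((i : ℝ) + 1) / N),
      χ r = (p i).eval r := by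
  have hN' : (0 : ℝ) < N := by exact_mod_cast hN
  -- The ceiling selects the left piece at an interior node; at r = 0 truncated subtraction gives
  -- piece 0.
  set χ : ℝ → ℝ := fun r => (p (⌈r * N⌉₊ - 1)).eval r with hχ
  have hpiece : ∀ i < N, ∀ r ∈ Icc ((i : ℝ) / N) (((i : ℝ) + 1) / N), χ r = (p i).eval r := by
    intro i hi r hr
    have hr1 : (i : ℝ) ≤ r * N := (div_le_iff₀ hN').1 hr.1
    have hr2 : r * N ≤ (i : ℝ) + 1 := (le_div_iff₀ hN').1 hr.2
    rcases hr1.eq_or_lt with h | h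
    · rcases Nat.eq_zero_or_pos i with rfl | hpos
      · simp only [hχ]
        rw [← h]
        simp
      · obtain ⟨j, rfl⟩ : ∃ j, i = j + 1 := ⟨i - 1, by omega⟩
        have hrr : r = ((j : ℝ) + 1) / N := by
          rw [eq_div_iff hN'.ne', ← h]; push_cast; ring
        simp only [hχ]
        rw [← h, Nat.ceil_natCast, Nat.add_sub_cancel, hrr]
        exact hmatch j hi
    · have hc : ⌈r * N⌉₊ = i + 1 := by
        rw [Nat.ceil_eq_iff (by omega)]
        exact ⟨by simpa using h, by push_cast; exact hr2⟩
      simp only [hχ]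
      rw [hc, Nat.add_sub_cancel]
  have hcont : ∀ n ≤ N, ContinuousOn χ (Icc 0 ((n : ℝ) / N)) := by
    intro n
    induction n with
    | zero =>
      intro _
      simp only [CharP.cast_eq_zero, zero_div, Icc_self]
      exact continuousOn_singleton _ _
    | succ n ih =>
      intro hn
      have hu : Icc (0 : ℝ) (((n + 1 : ℕ) : ℝ) / N)
          = Icc 0 ((n : ℝ) / N) ∪ Icc ((n : ℝ) / N) (((n : ℝ) + 1) / N) := by
        push_cast
        rw [Icc_union_Icc_eq_Icc (by positivity) (node_le_succ N n)]
      rw [hu]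
      refine (ih (by omega)).union_of_isClosed ?_ isClosed_Icc isClosed_Icc
      exact (p n).continuous.continuousOn.congr (hpiece n (by omega))
  refine ⟨χ, ⟨?_, ?_, ?_, fun i hi => ⟨p i, hdeg i, hpiece i hi⟩⟩, hpiece⟩
  · have := hcont N le_rfl
    rwa [div_self hN'.ne'] at this
  · rw [hpiece 0 (by omega) 0 ⟨by simp, by positivity⟩, h0]
  · have hc : (((N - 1 : ℕ) : ℝ) + 1) / N = 1 := by
      rw [Nat.cast_sub hN]; push_cast; field_simp; ring
    rw [hpiece (N - 1) (by omega) 1 ⟨by rw [← hc]; exact node_le_succ _ _, hc.ge⟩, h1]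

/-- The finite element functions that vanish outside `I`, as a vector space. -/
def feSubmodule (k N : ℕ) : Submodule ℝ (ℝ → ℝ) where
  carrier := {v | v ∈ FESpace k N ∧ ∀ r ∉ I, v r = 0}
  add_mem' := fun {v w} hv hw => ⟨FESpace.add hv.1 hw.1, fun r hr => by
    simp [hv.2 r hr, hw.2 r hr]⟩
  zero_mem' := ⟨FESpace.zero_mem k N, fun _ _ => rfl⟩
  smul_mem' := fun c {v} hv => ⟨FESpace.const_mul hv.1 c, fun r hr => by simp [hv.2 r hr]⟩

theorem exists_element {N : ℕ} (hN : 1 ≤ N) {r : ℝ} (hr : r ∈ I) :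
    ∃ i < N, r ∈ Icc ((i : ℝ) / N) (((i : ℝ) + 1) / N) := by
  have hN' : (0 : ℝ) < N := by exact_mod_cast hN
  rcases hr.2.eq_or_lt with h | h
  · refine ⟨N - 1, by omega, ?_⟩
    have hc : (((N - 1 : ℕ) : ℝ) + 1) / N = 1 := by
      rw [Nat.cast_sub hN]; push_cast; field_simp; ring
    rw [hc, h, ← hc]
    exact ⟨node_le_succ _ _, le_rfl⟩
  · have h0 : 0 ≤ r * N := mul_nonneg hr.1 hN'.le
    refine ⟨⌊r * N⌋₊, ?_, ?_, ?_⟩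
    · rw [Nat.floor_lt h0]; nlinarith
    · rw [div_le_iff₀ hN']; exact Nat.floor_le h0
    · rw [le_div_iff₀ hN']; exact (Nat.lt_floor_add_one _).le

/-- Evaluation at k + 1 equispaced points of every element is injective, since a polynomial of
degree at most k with k + 1 zeros vanishes. -/
theorem finiteDimensional_feSubmodule {k N : ℕ} (hk : 1 ≤ k) (hN : 1 ≤ N) :
    FiniteDimensional ℝ (feSubmodule k N) := by
  have hN' : (0 : ℝ) < N := by exact_mod_cast hN
  have hk' : (0 : ℝ) < k := by exact_mod_cast hk
  let E : feSubmodule k N →ₗ[ℝ] (Fin N × Fin (k + 1) → ℝ) :=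
    { toFun := fun v x => (v : ℝ → ℝ) ((x.1 : ℝ) / N + (x.2 : ℝ) / k / N)
      map_add' := fun v w => rfl
      map_smul' := fun c v => rfl }
  refine FiniteDimensional.of_injective E ?_
  rw [← LinearMap.ker_eq_bot, LinearMap.ker_eq_bot']
  intro v hv
  ext r
  by_cases hr : r ∈ I
  · obtain ⟨i, hi, hir⟩ := exists_element hN hr
    obtain ⟨p, hp, hpv⟩ := v.2.1.2.2.2 i hi
    have hp0 : p = 0 := by
      refine Polynomial.eq_zero_of_natDegree_lt_card_of_eval_eq_zero p
        (f := fun l : Fin (k + 1) => (i : ℝ) / N + (l : ℝ) / k / N) ?_ ?_ ?_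
      · intro l l' h
        have h' : (l : ℝ) / k / N = (l' : ℝ) / k / N := add_left_cancel h
        rw [div_left_inj' hN'.ne', div_left_inj' hk'.ne'] at h'
        exact Fin.ext (by exact_mod_cast h')
      · intro l
        have h := congrFun hv (⟨i, hi⟩, l)
        have hl : (l : ℝ) / k ≤ 1 := by
          rw [div_le_one hk']
          exact_mod_cast Nat.lt_succ_iff.1 l.2
        rw [← hpv]
        · exact h
        · refine ⟨le_add_of_nonneg_right (by positivity), ?_⟩
          rw [← add_div]
          gcongr
      · simpa using Nat.lt_succ_of_le hp
    rw [hpv r hir, hp0]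
    simp
  · simpa using v.2.2 r hr

/-- Simultaneous diagonalization of two symmetric bilinear forms, one of them positive definite. -/
theorem exists_simultaneous_eigenbasis {V : Type*} [AddCommGroup V] [Module ℝ V]
    [FiniteDimensional ℝ V] (m a : V →ₗ[ℝ] V →ₗ[ℝ] ℝ) (hm : ∀ v w, m v w = m w v)
    (hm0 : ∀ v, 0 ≤ m v v) (hmd : ∀ v, m v v = 0 → v = 0) (ha : ∀ v w, a v w = a w v) :
    ∃ (n : ℕ) (b : Fin n → V) (l : Fin n → ℝ),
      (∀ i j, m (b i) (b j) = if i = j then 1 else 0) ∧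
      (∀ i j, a (b i) (b j) = if i = j then l i else 0) ∧
      ∀ v, v = ∑ i, m v (b i) • b i := by
  let c : InnerProductSpace.Core ℝ V :=
    { inner := fun v w => m v w
      conj_inner_symm := fun v w => hm w v
      re_inner_nonneg := fun v => hm0 v
      add_left := fun u v w => by simp
      smul_left := fun u v r => by simp
      definite := fun v => hmd v }
  let : NormedAddCommGroup V := c.toNormedAddCommGroup
  let : InnerProductSpace ℝ V := InnerProductSpace.ofCore c.toCore
  have hinner : ∀ v w : V, inner ℝ v w = m v w := fun _ _ => rfl
  have : CompleteSpace V := FiniteDimensional.complete ℝ V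
  -- The Riesz representative of `a` in the inner product `m`; its orthonormal eigenvectors
  -- diagonalize both forms.
  let A : V →ₗ[ℝ] V :=
    { toFun := fun v => (InnerProductSpace.toDual ℝ V).symm (LinearMap.toContinuousLinearMap (a v))
      map_add' := fun v w => by simp
      map_smul' := fun r v => by simp }
  have hA : ∀ v w, inner ℝ (A v) w = a v w := fun v w => by
    simp [A, InnerProductSpace.toDual_symm_apply]
  have hsym : A.IsSymmetric := fun v w => by
    rw [hA, real_inner_comm, hA, ha]
  let b := hsym.eigenvectorBasis rfl
  refine ⟨Module.finrank ℝ V, b, hsym.eigenvalues rfl, fun i j => ?_, fun i j => ?_, fun v => ?_⟩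
  · rw [← hinner]
    exact orthonormal_iff_ite.1 b.orthonormal i j
  · rw [← hA, hsym.apply_eigenvectorBasis, real_inner_smul_left,
      orthonormal_iff_ite.1 b.orthonormal i j]
    simp
  · conv_lhs => rw [← b.sum_repr' v]
    refine Finset.sum_congr rfl fun i _ => ?_
    rw [real_inner_comm]
    rfl

theorem eqOn_zero_of_inner0_self_eq_zero {v : ℝ → ℝ} (hv : ContinuousOn v I)
    (h : inner0 v v = 0) : ∀ r ∈ I, v r = 0 := by
  have hb := isBdd_of_continuousOn hv
  rw [inner0_eq, integral_eq_zero_iff_of_nonneg_ae ?_ (hb.integrable_mul hb)] at h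
  · have hz : v =ᵐ[volume.restrict (Icc (0 : ℝ) 1)] fun _ => 0 := by
      filter_upwards [h, ae_Ioo] with r hr hr'
      have := hr'.1.ne'
      simpa [this] using hr
    intro r hr
    exact Measure.eqOn_Icc_of_ae_eq (μ := volume) zero_ne_one hz hv continuousOn_const hr
  · filter_upwards [ae_Ioo] with r hr
    exact mul_nonneg (mul_self_nonneg _) hr.1.le

/-- A basis of the finite element space that is orthonormal for `inner0` and orthogonal
for `innerH`. -/
theorem FESpace.exists_eigenbasis {k N : ℕ} (hk : 1 ≤ k) (hN : 1 ≤ N) :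
    ∃ (n : ℕ) (b : Fin n → ℝ → ℝ) (l : Fin n → ℝ), (∀ i, b i ∈ FESpace k N) ∧
      (∀ i j, inner0 (b i) (b j) = if i = j then 1 else 0) ∧
      (∀ i j, innerH (b i) (b j) = if i = j then l i else 0) ∧
      ∀ v ∈ FESpace k N, ∀ r ∈ I, v r = ∑ i, inner0 v (b i) * b i r := by
  classical
  have := finiteDimensional_feSubmodule hk hN
  have hL : ∀ v : feSubmodule k N, Lip0 (v : ℝ → ℝ) := fun v => FESpace.lip0 hN v.2.1
  let m : feSubmodule k N →ₗ[ℝ] feSubmodule k N →ₗ[ℝ] ℝ := LinearMap.mk₂ ℝ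
    (fun v w => inner0 (v : ℝ → ℝ) w)
    (fun v v' w => inner0_add_left (hL v).bdd (hL v').bdd (hL w).bdd)
    (fun c v w => inner0_smul_left c _ _)
    (fun v w w' => by
      rw [inner0_comm, inner0_comm (v : ℝ → ℝ) w, inner0_comm (v : ℝ → ℝ) w']
      exact inner0_add_left (hL w).bdd (hL w').bdd (hL v).bdd)
    (fun c v w => by
      rw [inner0_comm, inner0_comm (v : ℝ → ℝ) w]
      exact inner0_smul_left c _ _)
  let a : feSubmodule k N →ₗ[ℝ] feSubmodule k N →ₗ[ℝ] ℝ := LinearMap.mk₂ ℝ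
    (fun v w => innerH (v : ℝ → ℝ) w)
    (fun v v' w => innerH_add_left (hL v) (hL v') (hL w))
    (fun c v w => innerH_smul_left c _ _)
    (fun v w w' => by
      rw [innerH_comm, innerH_comm (v : ℝ → ℝ) w, innerH_comm (v : ℝ → ℝ) w']
      exact innerH_add_left (hL w) (hL w') (hL v))
    (fun c v w => by
      rw [innerH_comm, innerH_comm (v : ℝ → ℝ) w]
      exact innerH_smul_left c _ _)
  obtain ⟨n, b, l, h1, h2, h3⟩ := exists_simultaneous_eigenbasis m a
    (fun v w => inner0_comm _ _) (fun v => inner0_self_nonneg _)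
    (fun v hv => by
      ext r
      by_cases hr : r ∈ I
      · exact eqOn_zero_of_inner0_self_eq_zero (hL v).continuousOn hv r hr
      · exact v.2.2 r hr)
    (fun v w => innerH_comm _ _)
  refine ⟨n, fun i => b i, l, fun i => (b i).2.1, h1, h2, fun v hv r hr => ?_⟩
  have hind : ∀ r ∈ I, I.indicator v r = v r := fun r hr => indicator_of_mem hr v
  -- Cutting off outside the interval changes neither the values on it nor any of the integrals.
  let v' : feSubmodule k N := ⟨I.indicator v, ⟨hv.1.congr hind, by
    rw [hind 0 (by simp), hv.2.1], by rw [hind 1 (by simp), hv.2.2.1], fun i hi => by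
      obtain ⟨p, hp, hpv⟩ := hv.2.2.2 i hi
      exact ⟨p, hp, fun r hr => by rw [hind r (element_subset_I hN hi hr), hpv r hr]⟩⟩,
    fun r hr => indicator_of_notMem hr v⟩
  have h4 := congrArg (fun z : feSubmodule k N => (z : ℝ → ℝ) r) (h3 v')
  have h5 : ∀ i, inner0 (I.indicator v) (b i) = inner0 v (b i) := fun i =>
    inner0_congr (by
      filter_upwards [ae_restrict_mem measurableSet_Icc] with r hr using hind r hr) (by rfl)
  simp only [v', m, LinearMap.mk₂_apply, h5] at h4
  rw [hind r hr] at h4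
  rw [h4]
  simp [Finset.sum_apply]

/-! ### Inverse estimates -/

theorem integral_sq_mul_id_pos {p : Polynomial ℝ} (hp : p ≠ 0) :
    0 < ∫ s in (0 : ℝ)..1, p.eval s ^ 2 * s := by
  refine intervalIntegral.integral_pos zero_lt_one ?_ ?_ ?_
  · exact ((p.continuous.pow 2).mul continuous_id).continuousOn
  · intro s hs
    have := hs.1.le
    positivity
  · by_contra! hcon
    refine hp (Polynomial.eq_zero_of_infinite_isRoot p
      (Set.Infinite.mono (s := Ioc (0 : ℝ) 1) (fun s hs => ?_) (Ioc_infinite zero_lt_one)))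
    have h1 := hcon s ⟨hs.1.le, hs.2⟩
    have h2 : 0 ≤ p.eval s ^ 2 := sq_nonneg _
    have h3 : p.eval s ^ 2 = 0 := le_antisymm (nonpos_of_mul_nonpos_left h1 hs.1) h2
    exact pow_eq_zero_iff (two_ne_zero) |>.1 h3

/-- The integral is a positive definite quadratic form in the coefficients, so it has a positive
minimum on the unit sphere, and homogeneity does the rest. -/
theorem exists_coeff_sq_le (k : ℕ) : ∃ C : ℝ, 0 < C ∧ ∀ p : Polynomial ℝ, p.natDegree ≤ k →
    ∀ l, p.coeff l ^ 2 ≤ C * ∫ s in (0 : ℝ)..1, p.eval s ^ 2 * s := by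
  let P : (Fin (k + 1) → ℝ) → Polynomial ℝ := fun c => ∑ i, Polynomial.C (c i) * Polynomial.X ^ (i : ℕ)
  have hPe : ∀ c s, (P c).eval s = ∑ i, c i * s ^ (i : ℕ) := fun c s => by
    simp [P, Polynomial.eval_finsetSum]
  have hPc : ∀ c (i : Fin (k + 1)), (P c).coeff i = c i := fun c i => by
    simp only [P, Polynomial.finsetSum_coeff, Polynomial.coeff_C_mul, Polynomial.coeff_X_pow]
    rw [Finset.sum_eq_single i]
    · simp
    · intro j _ hj
      have : (i : ℕ) ≠ j := fun h => hj (Fin.ext h.symm)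
      simp [this]
    · simp
  let Q : (Fin (k + 1) → ℝ) → ℝ := fun c => ∫ s in (0 : ℝ)..1, (P c).eval s ^ 2 * s
  have hQc : Continuous Q := by
    refine intervalIntegral.continuous_parametric_intervalIntegral_of_continuous' ?_ 0 1
    simp only [Function.uncurry_def, hPe]
    fun_prop
  obtain ⟨c₀, hc₀, hmin⟩ := (isCompact_sphere (0 : Fin (k + 1) → ℝ) 1).exists_isMinOn
    (NormedSpace.sphere_nonempty.2 zero_le_one) hQc.continuousOn
  have hc₀1 : ‖c₀‖ = 1 := by simpa using hc₀
  have hpos : 0 < Q c₀ := by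
    refine integral_sq_mul_id_pos fun h => ?_
    have : c₀ = 0 := by
      ext i
      rw [← hPc c₀ i, h]
      simp
    rw [this, norm_zero] at hc₀1
    exact zero_ne_one hc₀1
  have hhom : ∀ (t : ℝ) c, Q (t • c) = t ^ 2 * Q c := fun t c => by
    simp only [Q, hPe]
    rw [← intervalIntegral.integral_const_mul]
    congr 1
    ext s
    simp only [Pi.smul_apply, smul_eq_mul, mul_assoc, ← Finset.mul_sum]
    ring
  have hQ : ∀ c, Q c₀ * ‖c‖ ^ 2 ≤ Q c := by
    intro c
    rcases eq_or_ne c 0 with rfl | hc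
    · have := hhom 0 0
      simp only [smul_zero] at this
      rw [this]
      simp
    · have hn : 0 < ‖c‖ := norm_pos_iff.2 hc
      have h1 : Q c₀ ≤ Q (‖c‖⁻¹ • c) := hmin (by simp [norm_smul, hn.ne'])
      rw [hhom, inv_pow, inv_mul_eq_div, le_div_iff₀ (by positivity)] at h1
      exact h1
  refine ⟨(Q c₀)⁻¹, inv_pos.2 hpos, fun p hp l => ?_⟩
  have hpP : P (fun i => p.coeff i) = p := by
    conv_rhs => rw [p.as_sum_range_C_mul_X_pow' (Nat.lt_succ_of_le hp)]
    exact Fin.sum_univ_eq_sum_range (fun i => Polynomial.C (p.coeff i) * Polynomial.X ^ i) (k + 1)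
  have h1 := hQ fun i => p.coeff i
  simp only [Q, hpP] at h1
  rw [inv_mul_eq_div, le_div_iff₀ hpos]
  refine le_trans ?_ h1
  rw [mul_comm]
  refine mul_le_mul_of_nonneg_left ?_ hpos.le
  by_cases hl : l < k + 1
  · rw [← sq_abs (p.coeff l)]
    exact pow_le_pow_left₀ (abs_nonneg _)
      (norm_le_pi_norm (fun i : Fin (k + 1) => p.coeff i) ⟨l, hl⟩) 2
  · rw [Polynomial.coeff_eq_zero_of_natDegree_lt (by omega), zero_pow two_ne_zero]
    exact sq_nonneg _

/-- On [0,1] the derivative is controlled by the coefficients, and these by the weighted integral.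
The weight s, degenerate at 0, is the one present on the first element. The `+ 1` in the constant
keeps it positive for k = 0. -/
theorem exists_derivative_sq_le (k : ℕ) : ∃ C : ℝ, 0 < C ∧ ∀ p : Polynomial ℝ, p.natDegree ≤ k →
    ∀ s ∈ I, p.derivative.eval s ^ 2 ≤ C * ∫ s in (0 : ℝ)..1, p.eval s ^ 2 * s := by
  obtain ⟨C, hC, h⟩ := exists_coeff_sq_le k
  set S : ℝ := ∑ l ∈ Finset.range (k + 1), (l : ℝ) with hS
  have hS0 : 0 ≤ S := Finset.sum_nonneg fun _ _ => Nat.cast_nonneg _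
  refine ⟨S ^ 2 * C + 1, by positivity, fun p hp s hs => ?_⟩
  set q := ∫ s in (0 : ℝ)..1, p.eval s ^ 2 * s with hq
  have hq0 : 0 ≤ q := intervalIntegral.integral_nonneg zero_le_one fun s hs => by
    have := hs.1
    positivity
  have h1 : |p.derivative.eval s| ≤ S * √(C * q) := by
    rw [Polynomial.derivative_eval, Polynomial.sum_over_range' _ (by simp) (k + 1)
      (Nat.lt_succ_of_le hp)]
    refine (Finset.abs_sum_le_sum_abs _ _).trans ?_
    rw [hS, Finset.sum_mul]
    refine Finset.sum_le_sum fun l _ => ?_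
    rw [abs_mul, abs_mul, Nat.abs_cast, abs_of_nonneg (pow_nonneg hs.1 _), mul_comm |p.coeff l|]
    have h2 : |p.coeff l| ≤ √(C * q) := Real.abs_le_sqrt (h p hp l)
    have h3 : s ^ (l - 1) ≤ 1 := pow_le_one₀ hs.1 hs.2
    exact (mul_le_of_le_one_right (by positivity) h3).trans
      (mul_le_mul_of_nonneg_left h2 (Nat.cast_nonneg _))
  rw [← sq_abs]
  calc |p.derivative.eval s| ^ 2 ≤ (S * √(C * q)) ^ 2 := pow_le_pow_left₀ (abs_nonneg _) h1 2
    _ = S ^ 2 * C * q := by rw [mul_pow, Real.sq_sqrt (by positivity)]; ring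
    _ ≤ (S ^ 2 * C + 1) * q := by nlinarith

theorem intervalIntegrable_of_integrable_volI {g : ℝ → ℝ} (hg : Integrable g volI) {a b : ℝ}
    (ha : a ∈ I) (hb : b ∈ I) : IntervalIntegrable g volume a b :=
  IntegrableOn.intervalIntegrable (IntegrableOn.mono_set (t := I) hg (uIcc_subset_Icc ha hb))

/-- The integral over `I` is the sum of the integrals over the elements. -/
theorem integral_eq_sum_elements {N : ℕ} (hN : 1 ≤ N) {g : ℝ → ℝ} (hg : Integrable g volI) :
    ∫ r, g r ∂volI = ∑ i ∈ Finset.range N, ∫ r in ((i : ℝ) / N)..(((i : ℝ) + 1) / N), g r := by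
  have hN' : (N : ℝ) ≠ 0 := by
    have : 0 < N := hN
    positivity
  have h := intervalIntegral.sum_integral_adjacent_intervals (f := g) (μ := volume)
    (a := fun i : ℕ => (i : ℝ) / N) (n := N) fun i hi =>
      intervalIntegrable_of_integrable_volI hg (node_mem_I hN hi.le)
        (node_mem_I hN (Nat.succ_le_of_lt hi))
  simp only [Nat.cast_add, Nat.cast_one, CharP.cast_eq_zero, zero_div, div_self hN'] at h
  rw [h, integral_eq_volI]

theorem FESpace.deriv_eq {N i : ℕ} {v : ℝ → ℝ} {p : Polynomial ℝ}
    (hp : ∀ r ∈ Icc ((i : ℝ) / N) (((i : ℝ) + 1) / N), v r = p.eval r) {r : ℝ}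
    (hr : r ∈ Ioo ((i : ℝ) / N) (((i : ℝ) + 1) / N)) : deriv v r = p.derivative.eval r := by
  have : v =ᶠ[nhds r] fun r => p.eval r := by
    filter_upwards [Icc_mem_nhds hr.1 hr.2] with s hs using hp s hs
  rw [this.deriv_eq, Polynomial.deriv]

/-- Rescaled derivative estimate on one element. -/
theorem derivative_sq_le_of_element {k : ℕ} {C : ℝ} (hC : ∀ p : Polynomial ℝ, p.natDegree ≤ k →
    ∀ s ∈ I, p.derivative.eval s ^ 2 ≤ C * ∫ s in (0 : ℝ)..1, p.eval s ^ 2 * s)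
    {h : ℝ} (hh : 0 < h) (a : ℝ) {p : Polynomial ℝ} (hp : p.natDegree ≤ k) {r : ℝ}
    (hr : r ∈ Icc a (a + h)) :
    h ^ 2 * p.derivative.eval r ^ 2 ≤ C * ∫ s in (0 : ℝ)..1, p.eval (a + h * s) ^ 2 * s := by
  set q : Polynomial ℝ := p.comp (Polynomial.C a + Polynomial.C h * Polynomial.X) with hq
  have hdeg : q.natDegree ≤ k := by
    rw [hq, Polynomial.natDegree_comp]
    have : (Polynomial.C a + Polynomial.C h * Polynomial.X).natDegree ≤ 1 := by compute_degree
    calc _ ≤ k * 1 := Nat.mul_le_mul hp this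
      _ = k := mul_one k
  have hqe : ∀ s, q.eval s = p.eval (a + h * s) := fun s => by simp [hq, Polynomial.eval_comp]
  have hqd : q.derivative.eval ((r - a) / h) = h * p.derivative.eval r := by
    rw [hq, Polynomial.derivative_comp]
    simp only [Polynomial.derivative_add, Polynomial.derivative_C, Polynomial.derivative_mul,
      Polynomial.derivative_X, Polynomial.eval_mul, Polynomial.eval_comp, Polynomial.eval_add,
      Polynomial.eval_C, Polynomial.eval_X, zero_mul, zero_add, mul_one]
    rw [mul_div_cancel₀ _ hh.ne', add_sub_cancel]
  have h1 := hC q hdeg ((r - a) / h) ⟨div_nonneg (by linarith [hr.1]) hh.le,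
    (div_le_one hh).2 (by linarith [hr.2])⟩
  rw [hqd, mul_pow] at h1
  simpa only [hqe] using h1

/-- On element i the weight r lies between (i+1)hs and (i+1)h, with s the reference coordinate, so
the reference estimate with weight s scales uniformly, the element at the origin included. For v/r,
the mean value theorem and v(0) = 0 serve on the first element, and r ≥ h on the others. -/
theorem exists_inverse_estimate (k : ℕ) : ∃ C : ℝ, 0 < C ∧ ∀ N : ℕ, 1 ≤ N → ∀ v ∈ FESpace k N,
    innerH v v ≤ C * (N : ℝ) ^ 2 * inner0 v v := by
  obtain ⟨C, hC0, hC⟩ := exists_derivative_sq_le k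
  refine ⟨2 * C + 1, by positivity, fun N hN v hv => ?_⟩
  have hN' : (0 : ℝ) < N := by exact_mod_cast hN
  have hL := FESpace.lip0 hN hv
  have hiH : Integrable (fun r => D v r * D v r * r + v r / r * (v r / r) * r) volI :=
    (hL.bddD.integrable_mul hL.bddD).add (hL.bdd_div.integrable_mul hL.bdd_div)
  have hi0 := hL.bdd.integrable_mul hL.bdd
  rw [innerH_self_eq hL, inner0_eq, integral_eq_sum_elements hN hiH,
    integral_eq_sum_elements hN hi0, Finset.mul_sum]
  refine Finset.sum_le_sum fun i hi => ?_
  have hiN := Finset.mem_range.1 hi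
  obtain ⟨p, hp, hpv⟩ := hv.2.2.2 i hiN
  set a : ℝ := (i : ℝ) / N with ha
  set h : ℝ := 1 / N with hh
  have hhpos : 0 < h := by positivity
  have hb : ((i : ℝ) + 1) / N = a + h := by rw [ha, hh, add_div]
  have hia : a = i * h := by rw [ha, hh]; ring
  have hsub := element_subset_I hN hiN
  rw [hb] at hpv hsub ⊢
  have ha0 : 0 ≤ a := (hsub ⟨le_rfl, by linarith⟩).1
  set E := ∫ r in a..(a + h), v r * v r * r with hE
  set q := ∫ s in (0 : ℝ)..1, p.eval (a + h * s) ^ 2 * s with hq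
  have hE0 : 0 ≤ E := intervalIntegral.integral_nonneg (by linarith) fun r hr =>
    mul_nonneg (mul_self_nonneg _) (ha0.trans hr.1)
  have hqE : (i + 1) * h ^ 2 * q ≤ E := by
    have e1 : E = h * ∫ s in (0 : ℝ)..1, p.eval (a + h * s) ^ 2 * (a + h * s) := by
      have e := intervalIntegral.smul_integral_comp_add_mul (a := 0) (b := 1)
        (fun r => p.eval r ^ 2 * r) h a
      rw [smul_eq_mul] at e
      rw [e, mul_zero, add_zero, mul_one, hE]
      refine intervalIntegral.integral_congr fun r hr => ?_
      rw [uIcc_of_le (by linarith)] at hr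
      simp only [hpv r hr]
      ring
    have e2 : (i + 1) * h ^ 2 * q
        = h * ∫ s in (0 : ℝ)..1, ((i : ℝ) + 1) * h * (p.eval (a + h * s) ^ 2 * s) := by
      rw [intervalIntegral.integral_const_mul]; ring
    rw [e1, e2]
    refine mul_le_mul_of_nonneg_left (intervalIntegral.integral_mono_on zero_le_one ?_ ?_ ?_)
      hhpos.le
    · exact Continuous.intervalIntegrable (by have := p.continuous; fun_prop) _ _
    · exact Continuous.intervalIntegrable (by have := p.continuous; fun_prop) _ _
    · intro s hs
      -- Since a = ih and s ≤ 1, the true weight dominates the reference weight.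
      have h1 : ((i : ℝ) + 1) * h * s ≤ a + h * s := by
        rw [hia]
        nlinarith [hs.2, mul_nonneg (Nat.cast_nonneg (α := ℝ) i) hhpos.le]
      calc _ = p.eval (a + h * s) ^ 2 * (((i : ℝ) + 1) * h * s) := by ring
        _ ≤ _ := mul_le_mul_of_nonneg_left h1 (sq_nonneg _)
  -- the derivative on the element
  have hder : ∀ r ∈ Icc a (a + h), (i + 1) * h ^ 4 * p.derivative.eval r ^ 2 ≤ C * E := by
    intro r hr
    have h1 := derivative_sq_le_of_element hC hhpos a hp hr
    have h2 : 0 ≤ ((i : ℝ) + 1) * h ^ 2 := by positivity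
    calc _ = ((i : ℝ) + 1) * h ^ 2 * (h ^ 2 * p.derivative.eval r ^ 2) := by ring
      _ ≤ ((i : ℝ) + 1) * h ^ 2 * (C * q) := mul_le_mul_of_nonneg_left h1 h2
      _ = C * ((i + 1) * h ^ 2 * q) := by ring
      _ ≤ C * E := mul_le_mul_of_nonneg_left hqE hC0.le
  have hpt : ∀ r ∈ Ioo a (a + h),
      D v r * D v r * r + v r / r * (v r / r) * r
        ≤ 2 * C * E / h ^ 3 + 1 / h ^ 2 * (v r * v r * r) := by
    intro r hr
    have hr' : r ∈ Icc a (a + h) := ⟨hr.1.le, hr.2.le⟩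
    have hr0 : 0 < r := ha0.trans_lt hr.1
    have hrI := hsub hr'
    have hr1 : r < 1 := hr.2.trans_le (hsub ⟨by linarith, le_rfl⟩).2
    have hD : D v r = p.derivative.eval r := by
      rw [D_eq_deriv v ⟨hr0, hr1⟩]
      exact FESpace.deriv_eq (N := N) (i := i) (by rwa [hb]) (by rwa [hb])
    have hri : r ≤ (i + 1) * h := by rw [add_mul, ← hia, one_mul]; exact hr.2.le
    have key : ∀ s ∈ Icc a (a + h), p.derivative.eval s ^ 2 * r ≤ C * E / h ^ 3 := by
      intro s hs
      rw [le_div_iff₀ (by positivity)]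
      calc _ ≤ p.derivative.eval s ^ 2 * ((i + 1) * h) * h ^ 3 := by gcongr
        _ = (i + 1) * h ^ 4 * p.derivative.eval s ^ 2 := by ring
        _ ≤ _ := hder s hs
    have k1 : D v r * D v r * r ≤ C * E / h ^ 3 := by
      rw [hD, ← sq]; exact key r hr'
    have k2 : v r / r * (v r / r) * r ≤ C * E / h ^ 3 + 1 / h ^ 2 * (v r * v r * r) := by
      have hn1 : 0 ≤ C * E / h ^ 3 := by positivity
      have hn2 : 0 ≤ 1 / h ^ 2 * (v r * v r * r) :=
        mul_nonneg (by positivity) (mul_nonneg (mul_self_nonneg _) hr0.le)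
      rcases Nat.eq_zero_or_pos i with hi0 | hipos
      · have ha00 : a = 0 := by rw [hia, hi0]; simp
        have hv0 : p.eval 0 = 0 := by
          rw [← hpv 0 (by rw [ha00]; exact ⟨le_rfl, by linarith⟩), hv.2.1]
        obtain ⟨s, hs, hs'⟩ := exists_hasDerivAt_eq_slope (fun r => p.eval r)
          (fun r => p.derivative.eval r) hr0 p.continuous.continuousOn
          (fun x _ => p.hasDerivAt x)
        have hvr : v r / r = p.derivative.eval s := by
          rw [hs', hv0, sub_zero, sub_zero, hpv r hr']
        rw [hvr, ← sq]
        have := key s ⟨by rw [ha00]; exact hs.1.le, hs.2.le.trans hr'.2⟩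
        linarith
      · have hhr : h ≤ r := by
          have : (1 : ℝ) ≤ i := by exact_mod_cast hipos
          have : 1 * h ≤ i * h := by gcongr
          rw [← hia] at this
          linarith [hr.1]
        have : v r / r * (v r / r) * r ≤ 1 / h ^ 2 * (v r * v r * r) := by
          rw [show v r / r * (v r / r) * r = 1 / r ^ 2 * (v r * v r * r) by
            field_simp]
          have := mul_nonneg (mul_self_nonneg (v r)) hr0.le
          gcongr
        linarith
    have k3 : 2 * C * E / h ^ 3 = C * E / h ^ 3 + C * E / h ^ 3 := by ring
    linarith
  have haI : a ∈ I := hsub ⟨le_rfl, by linarith⟩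
  have hbI : a + h ∈ I := hsub ⟨by linarith, le_rfl⟩
  have hiE : IntervalIntegrable (fun r => v r * v r * r) volume a (a + h) :=
    intervalIntegrable_of_integrable_volI hi0 haI hbI
  have := intervalIntegral.integral_mono_on_of_le_Ioo (a := a) (b := a + h) (by linarith)
    (intervalIntegrable_of_integrable_volI hiH haI hbI)
    (intervalIntegrable_const.add (hiE.const_mul (1 / h ^ 2))) hpt
  refine this.trans (le_of_eq ?_)
  rw [intervalIntegral.integral_add intervalIntegrable_const (hiE.const_mul _),
    intervalIntegral.integral_const, intervalIntegral.integral_const_mul, ← hE, smul_eq_mul,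
    show (N : ℝ) = 1 / h by rw [hh, one_div_one_div]]
  field_simp
  ring

/-! ### Approximation of smooth functions -/

theorem ae_exists_element {N : ℕ} (hN : 1 ≤ N) :
    ∀ᵐ r ∂volI, ∃ i < N, r ∈ Ioo ((i : ℝ) / N) (((i : ℝ) + 1) / N) := by
  have hc : ({r : ℝ | ∃ i : ℕ, r = (i : ℝ) / N}).Countable := by
    have : {r : ℝ | ∃ i : ℕ, r = (i : ℝ) / N} = range fun i : ℕ => (i : ℝ) / N := by
      ext r; simp [eq_comm]
    rw [this]
    exact countable_range _
  have hn : ∀ᵐ r ∂volI, r ∉ {r : ℝ | ∃ i : ℕ, r = (i : ℝ) / N} :=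
    ae_restrict_of_ae (hc.ae_notMem _)
  filter_upwards [hn, ae_restrict_mem measurableSet_Icc] with r hr hrI
  obtain ⟨i, hi, h1, h2⟩ := exists_element hN hrI
  refine ⟨i, hi, h1.lt_of_ne fun h => hr ⟨i, h.symm⟩, h2.lt_of_ne fun h => hr ⟨i + 1, ?_⟩⟩
  push_cast
  exact h

/-- Finite element functions interpolating at the nodes, from prescribed pieces. -/
theorem FESpace.exists_interpolant {k N : ℕ} (hN : 1 ≤ N) {v : ℝ → ℝ} (h0 : v 0 = 0) (h1 : v 1 = 0)
    {P : ℕ → Polynomial ℝ → Prop}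
    (h : ∀ i < N, ∃ p : Polynomial ℝ, p.natDegree ≤ k ∧ p.eval ((i : ℝ) / N) = v ((i : ℝ) / N) ∧
      p.eval (((i : ℝ) + 1) / N) = v (((i : ℝ) + 1) / N) ∧ P i p) :
    ∃ χ ∈ FESpace k N, ∀ i < N, ∃ p : Polynomial ℝ, P i p ∧
      ∀ r ∈ Icc ((i : ℝ) / N) (((i : ℝ) + 1) / N), χ r = p.eval r := by
  have hN' : (0 : ℝ) < N := by exact_mod_cast hN
  have hp : ∀ i : ℕ, ∃ p : Polynomial ℝ, p.natDegree ≤ k ∧ (i < N →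
      p.eval ((i : ℝ) / N) = v ((i : ℝ) / N) ∧
      p.eval (((i : ℝ) + 1) / N) = v (((i : ℝ) + 1) / N) ∧ P i p) := by
    intro i
    by_cases hi : i < N
    · obtain ⟨p, hp, hp'⟩ := h i hi
      exact ⟨p, hp, fun _ => hp'⟩
    · exact ⟨0, by simp, fun h => absurd h hi⟩
  choose p hdeg hp using hp
  obtain ⟨χ, hχ, hχp⟩ := FESpace.exists_glue (k := k) hN p hdeg (fun i hi => by
    have e1 := (hp i (by omega)).2.1
    have e2 := (hp (i + 1) hi).1
    push_cast at e2
    rw [e1, e2]) (by simpa [h0] using (hp 0 (by omega)).1) (by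
    have e := (hp (N - 1) (by omega)).2.1
    have hc : (((N - 1 : ℕ) : ℝ) + 1) / N = 1 := by
      rw [Nat.cast_sub hN]; push_cast; field_simp; ring
    rwa [hc, h1] at e)
  exact ⟨χ, hχ, fun i hi => ⟨p i, (hp i hi).2.2, hχp i hi⟩⟩

/-- Turns an approximation of the derivative into one of the function that matches it at the left
end of an element. -/
theorem exists_antiderivative (q : Polynomial ℝ) (a c : ℝ) : ∃ Q : Polynomial ℝ,
    Q.derivative = q ∧ Q.natDegree ≤ q.natDegree + 1 ∧ Q.eval a = c := by
  set Q₀ : Polynomial ℝ := ∑ i ∈ Finset.range (q.natDegree + 1),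
    Polynomial.C (q.coeff i / (i + 1)) * Polynomial.X ^ (i + 1) with hQ
  refine ⟨Q₀ + Polynomial.C (c - Q₀.eval a), ?_, ?_, by simp⟩
  · rw [Polynomial.derivative_add, Polynomial.derivative_C, add_zero, hQ,
      Polynomial.derivative_sum]
    conv_rhs => rw [q.as_sum_range_C_mul_X_pow]
    refine Finset.sum_congr rfl fun i _ => ?_
    rw [Polynomial.derivative_C_mul_X_pow]
    have : ((i : ℝ) + 1) ≠ 0 := by positivity
    push_cast
    rw [div_mul_cancel₀ _ this]
  · refine Polynomial.natDegree_add_le_of_degree_le ?_ (by simp)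
    refine Polynomial.natDegree_sum_le_of_forall_le _ _ fun i hi => ?_
    refine (Polynomial.natDegree_C_mul_X_pow_le _ _).trans ?_
    have := Finset.mem_range.1 hi
    omega

theorem absolutelyContinuousOnInterval_mono_I {g : ℝ → ℝ} (hg : AbsolutelyContinuousOnInterval g 0 1)
    {x y : ℝ} (hx : x ∈ I) (hy : y ∈ I) : AbsolutelyContinuousOnInterval g x y :=
  AbsolutelyContinuousOnInterval.mono hg (by
    rw [uIcc_of_le (zero_le_one' ℝ)]; exact uIcc_subset_Icc hx hy)

theorem abs_sub_le_of_ae_abs_D_le {g : ℝ → ℝ} {B : ℝ} {x y : ℝ}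
    (hg : AbsolutelyContinuousOnInterval g 0 1) (hx : x ∈ I) (hy : y ∈ I) (hxy : x ≤ y)
    (h : ∀ᵐ r ∂volI, r ∈ Icc x y → |D g r| ≤ B) : |g y - g x| ≤ B * (y - x) := by
  rw [← (absolutelyContinuousOnInterval_mono_I hg hx hy).integral_deriv_eq_sub]
  have := intervalIntegral.norm_integral_le_of_norm_le_const_ae (a := x) (b := y) (C := B)
    (f := deriv g) (by
      have h' := (h.and ae_Ioo)
      rw [ae_restrict_iff' measurableSet_Icc] at h'
      filter_upwards [h'] with r hr hr'
      rw [uIoc_of_le hxy] at hr'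
      have hrI : r ∈ I := ⟨hx.1.trans hr'.1.le, hr'.2.trans hy.2⟩
      have h1 := (hr hrI).1 ⟨hr'.1.le, hr'.2⟩
      rwa [D_eq_deriv g (hr hrI).2] at h1)
  rwa [abs_of_nonneg (sub_nonneg.2 hxy)] at this

theorem lipschitzOnWith_of_ae_abs_D_le {g : ℝ → ℝ} {B : NNReal}
    (hg : AbsolutelyContinuousOnInterval g 0 1) (h : ∀ᵐ r ∂volI, |D g r| ≤ B) :
    LipschitzOnWith B g I := by
  refine LipschitzOnWith.of_dist_le_mul ?_
  have key : ∀ x ∈ I, ∀ y ∈ I, x ≤ y → dist (g x) (g y) ≤ B * dist x y := fun x hx y hy hxy => by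
    rw [dist_comm, dist_comm x, Real.dist_eq, Real.dist_eq, abs_of_nonneg (sub_nonneg.2 hxy)]
    exact abs_sub_le_of_ae_abs_D_le hg hx hy hxy (h.mono fun _ h _ => h)
  intro x hx y hy
  rcases le_total x y with h | h
  · exact key x hx y hy h
  · rw [dist_comm, dist_comm x]
    exact key y hy x hx h

theorem Dn_zero (v : ℝ → ℝ) : Dn 0 v = v := iteratedDerivWithin_zero

theorem Dn_succ (i : ℕ) (v : ℝ → ℝ) : Dn (i + 1) v = D (Dn i v) :=
  iteratedDerivWithin_succ

theorem Dn_one (v : ℝ → ℝ) : Dn 1 v = D v := by rw [Dn_succ, Dn_zero]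

theorem Dn_D (i : ℕ) (v : ℝ → ℝ) : Dn i (D v) = Dn (i + 1) v := by
  induction i with
  | zero => rw [Dn_zero, Dn_one]
  | succ i ih => rw [Dn_succ, ih, ← Dn_succ]

/-- Local polynomial approximation of functions with an essentially bounded top derivative. -/
theorem exists_polynomial_approx (m : ℕ) {M : ℝ} (hM : 0 ≤ M) : ∀ (v : ℝ → ℝ),
    (∀ i < m + 1, AbsolutelyContinuousOnInterval (Dn i v) 0 1) →
    (∀ᵐ r ∂volI, |Dn (m + 1) v r| ≤ M) → ∀ a ∈ I, ∃ q : Polynomial ℝ, q.natDegree ≤ m ∧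
      ∀ r ∈ I, a ≤ r → |v r - q.eval r| ≤ M * (r - a) ^ (m + 1) := by
  induction m with
  | zero =>
    intro v hac hb a ha
    refine ⟨Polynomial.C (v a), by simp, fun r hr har => ?_⟩
    have h0 := hac 0 (by omega)
    rw [Dn_zero] at h0
    simp only [zero_add, Dn_one] at hb
    simpa using abs_sub_le_of_ae_abs_D_le h0 ha hr har (hb.mono fun _ h _ => h)
  | succ m ih =>
    intro v hac hb a ha
    obtain ⟨q, hq, hqv⟩ := ih (D v) (fun i hi => by rw [Dn_D]; exact hac (i + 1) (by omega))
      (by rwa [Dn_D]) a ha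
    -- Integrating the approximation of v' gains one factor r - a. The factorial of Taylor's formula
    -- is not tracked.
    obtain ⟨Q, hQd, hQn, hQa⟩ := exists_antiderivative q a (v a)
    refine ⟨Q, by omega, fun r hr har => ?_⟩
    have h0 := hac 0 (by omega)
    rw [Dn_zero] at h0
    obtain ⟨K, hK⟩ := exists_lipschitz_polynomial Q 0 1
    have hQac : AbsolutelyContinuousOnInterval (fun r => Q.eval r) 0 1 :=
      LipschitzOnWith.absolutelyContinuousOnInterval (K := K) (by rwa [uIcc_of_le zero_le_one])
    have hdiff := h0.ae_differentiableAt
    rw [uIcc_of_le zero_le_one] at hdiff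
    have := abs_sub_le_of_ae_abs_D_le (h0.sub hQac) ha hr har (B := M * (r - a) ^ (m + 1)) (by
      filter_upwards [ae_restrict_of_ae hdiff, ae_Ioo] with s hs hs' hsr
      have hsI : s ∈ I := ⟨hs'.1.le, hs'.2.le⟩
      have e : D (v - fun r => Q.eval r) s = D v s - q.eval s := by
        rw [D_eq_deriv _ hs', D_eq_deriv _ hs', deriv_sub (hs hsI) Q.differentiableAt,
          Polynomial.deriv, hQd]
      rw [e]
      refine (hqv s hsI hsr.1).trans ?_
      have h1 : 0 ≤ s - a := by linarith [hsr.1]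
      have h2 : s - a ≤ r - a := by linarith [hsr.2]
      gcongr)
    simp only [Pi.sub_apply, hQa, sub_self, sub_zero] at this
    calc _ ≤ _ := this
      _ = M * (r - a) ^ (m + 1 + 1) := by ring

/-- Because e(0) = 0, a bound on the slope is also a bound on e/r, and the weight has integral below
1. -/
theorem normHr_le_of_abs_D_le {e : ℝ → ℝ} (he : Lip0 e) {B : ℝ} (hB : 0 ≤ B)
    (h : ∀ᵐ r ∂volI, |D e r| ≤ B) : normHr e ≤ 2 * B := by
  have h1 : norm0 (D e) ≤ B := norm0_le_of_bound hB h
  have h2 : norm0 (fun r => e r / r) ≤ B := by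
    refine norm0_le_of_bound hB ?_
    filter_upwards [ae_Ioo] with r hr
    have := abs_sub_le_of_ae_abs_D_le he.ac (x := 0) (y := r) ⟨le_rfl, zero_le_one⟩
      ⟨hr.1.le, hr.2.le⟩ hr.1.le (h.mono fun _ h _ => h)
    rw [he.zero, sub_zero, sub_zero] at this
    rwa [abs_div, abs_of_pos hr.1, div_le_iff₀ hr.1]
  refine Real.sqrt_le_iff.2 ⟨by positivity, ?_⟩
  rw [innerH, ← norm0_sq, ← norm0_sq]
  nlinarith [norm0_nonneg (D e), norm0_nonneg (fun r => e r / r)]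

/-- Approximation in the finite element space of order `h^k`. -/
theorem FESpace.exists_approx {k N : ℕ} (hk : 1 ≤ k) (hN : 1 ≤ N) {M : ℝ} (hM : 0 ≤ M) {v : ℝ → ℝ}
    (hv : Lip0 v) (hac : ∀ i < k + 1, AbsolutelyContinuousOnInterval (Dn i v) 0 1)
    (hb : ∀ᵐ r ∂volI, |Dn (k + 1) v r| ≤ M) :
    ∃ χ ∈ FESpace k N, normHr (fun r => v r - χ r) ≤ 4 * M * (1 / N) ^ k := by
  have hN' : (0 : ℝ) < N := by exact_mod_cast hN
  obtain ⟨m, rfl⟩ : ∃ m, k = m + 1 := ⟨k - 1, by omega⟩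
  set h : ℝ := 1 / N with hh
  have hpos : 0 < h := by positivity
  have hsucc : ∀ i : ℕ, ((i : ℝ) + 1) / N = (i : ℝ) / N + h := fun i => by rw [hh, add_div]
  obtain ⟨χ, hχ, hχp⟩ := FESpace.exists_interpolant (k := m + 1) hN hv.zero hv.one
    (P := fun i p => ∀ r ∈ Icc ((i : ℝ) / N) (((i : ℝ) + 1) / N),
      |D v r - p.derivative.eval r| ≤ 2 * M * h ^ (m + 1)) (fun i hi => by
    have hsub := element_subset_I hN hi
    set a : ℝ := (i : ℝ) / N with ha
    rw [hsucc, ← ha] at hsub ⊢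
    have haI : a ∈ I := hsub ⟨le_rfl, by linarith⟩
    have hbI : a + h ∈ I := hsub ⟨by linarith, le_rfl⟩
    obtain ⟨q, hq, hqv⟩ := exists_polynomial_approx m hM (D v)
      (fun i hi => by rw [Dn_D]; exact hac (i + 1) (by omega)) (by rwa [Dn_D]) a haI
    have hqv' : ∀ r ∈ Icc a (a + h), |D v r - q.eval r| ≤ M * h ^ (m + 1) := fun r hr => by
      refine (hqv r (hsub hr) hr.1).trans ?_
      have h1 : 0 ≤ r - a := by linarith [hr.1]
      have h2 : r - a ≤ h := by linarith [hr.2]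
      gcongr
    obtain ⟨Q, hQd, hQn, hQa⟩ := exists_antiderivative q a (v a)
    have hac0 := hv.ac
    obtain ⟨K, hK⟩ := exists_lipschitz_polynomial Q 0 1
    have hQac : AbsolutelyContinuousOnInterval (fun r => Q.eval r) 0 1 :=
      LipschitzOnWith.absolutelyContinuousOnInterval (K := K) (by rwa [uIcc_of_le zero_le_one])
    have hc := abs_sub_le_of_ae_abs_D_le (hac0.sub hQac) haI hbI (by linarith)
      (B := M * h ^ (m + 1)) (by
      filter_upwards [hv.ae_differentiableAt, ae_Ioo] with s hs hs' hsr
      have e : D (v - fun r => Q.eval r) s = D v s - q.eval s := by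
        rw [D_eq_deriv _ hs', D_eq_deriv _ hs', deriv_sub hs Q.differentiableAt,
          Polynomial.deriv, hQd]
      rw [e]
      exact hqv' s hsr)
    simp only [Pi.sub_apply, hQa, sub_self, sub_zero, add_sub_cancel_left] at hc
    -- A linear correction restores the value at the right node, so that the pieces match. Its slope
    -- is of the order of the derivative error, whence the factor 2.
    set c : ℝ := (v (a + h) - Q.eval (a + h)) / h with hcdef
    have hcb : |c| ≤ M * h ^ (m + 1) := by
      rw [hcdef, abs_div, abs_of_pos hpos, div_le_iff₀ hpos]
      exact hc
    refine ⟨Q + Polynomial.C c * (Polynomial.X - Polynomial.C a), ?_, ?_, ?_, fun r hr => ?_⟩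
    · refine Polynomial.natDegree_add_le_of_degree_le (by omega) ?_
      refine (Polynomial.natDegree_C_mul_le _ _).trans ?_
      rw [Polynomial.natDegree_X_sub_C]
      omega
    · simp [hQa]
    · simp [hcdef, hpos.ne']
    · have e : (Q + Polynomial.C c * (Polynomial.X - Polynomial.C a)).derivative.eval r
          = q.eval r + c := by
        simp [hQd]
      rw [e, ← sub_sub]
      refine (abs_sub _ _).trans ?_
      linarith [hqv' r hr])
  refine ⟨χ, hχ, ?_⟩
  have hχL := FESpace.lip0 hN hχ
  have := normHr_le_of_abs_D_le (hv.sub hχL) (B := 2 * M * h ^ (m + 1)) (by positivity) (by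
    filter_upwards [hv.D_sub hχL, ae_exists_element hN, ae_Ioo] with r h1 h2 h3
    obtain ⟨i, hi, hr⟩ := h2
    obtain ⟨p, hp, hpχ⟩ := hχp i hi
    rw [h1, D_eq_deriv χ h3, FESpace.deriv_eq hpχ hr]
    exact hp r ⟨hr.1.le, hr.2.le⟩)
  linarith

/-! ### The dual problem -/

theorem lipschitzOnWith_of_hasDerivAt {g g' : ℝ → ℝ} {B : NNReal} (hc : ContinuousOn g I)
    (hd : ∀ r ∈ Ioo (0 : ℝ) 1, HasDerivAt g (g' r) r) (hb : ∀ r ∈ Ioo (0 : ℝ) 1, |g' r| ≤ B) :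
    LipschitzOnWith B g I := by
  refine LipschitzOnWith.of_dist_le_mul ?_
  have key : ∀ x ∈ I, ∀ y ∈ I, x ≤ y → dist (g x) (g y) ≤ B * dist x y := fun x hx y hy hxy => by
    rcases hxy.eq_or_lt with rfl | hlt
    · simp
    obtain ⟨c, hc, hc'⟩ := exists_hasDerivAt_eq_slope g g' hlt
      (hc.mono (Icc_subset_Icc hx.1 hy.2))
      (fun z hz => hd z ⟨hx.1.trans_lt hz.1, hz.2.trans_le hy.2⟩)
    have h1 := hb c ⟨hx.1.trans_lt hc.1, hc.2.trans_le hy.2⟩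
    have h2 : 0 < y - x := sub_pos.2 hlt
    rw [hc', abs_div, abs_of_pos h2, div_le_iff₀ h2] at h1
    rw [dist_comm, dist_comm x, Real.dist_eq, Real.dist_eq, abs_of_pos h2]
    exact h1
  intro x hx y hy
  rcases le_total x y with h | h
  · exact key x hx y hy h
  · rw [dist_comm, dist_comm x]
    exact key y hy x hx h

/-- Nonnegativity of the variance of g about its mean. -/
theorem sq_integral_le {g : ℝ → ℝ} {c d : ℝ} (hcd : c ≤ d) (h1 : IntervalIntegrable g volume c d)
    (h2 : IntervalIntegrable (fun r => g r ^ 2) volume c d) :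
    (∫ r in c..d, g r) ^ 2 ≤ (d - c) * ∫ r in c..d, g r ^ 2 := by
  rcases hcd.eq_or_lt with rfl | hlt
  · simp
  set m := (∫ r in c..d, g r) / (d - c) with hm
  have hpos : 0 < d - c := sub_pos.2 hlt
  have h : 0 ≤ ∫ r in c..d, (g r - m) ^ 2 :=
    intervalIntegral.integral_nonneg hcd fun _ _ => sq_nonneg _
  have e : ∫ r in c..d, (g r - m) ^ 2
      = (∫ r in c..d, g r ^ 2) - 2 * m * (∫ r in c..d, g r) + m ^ 2 * (d - c) := by
    rw [← intervalIntegral.integral_const_mul, ← intervalIntegral.integral_sub h2 (h1.const_mul _),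
      show m ^ 2 * (d - c) = ∫ _ in c..d, m ^ 2 by simp; ring,
      ← intervalIntegral.integral_add (h2.sub (h1.const_mul _)) intervalIntegrable_const]
    congr 1; ext r; ring
  have hm' : ∫ r in c..d, g r = m * (d - c) := by rw [hm, div_mul_cancel₀ _ hpos.ne']
  rw [e, hm'] at h
  rw [hm']
  nlinarith

theorem isBdd_div_of_bound {z : ℝ → ℝ} {B : ℝ} (hz : ContinuousOn z I)
    (hB : ∀ r ∈ I, |z r| ≤ B * r) : IsBdd fun r => z r / r := by
  have hm := aestronglyMeasurable_div (isBdd_of_continuousOn hz).meas 1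
  simp only [pow_one] at hm
  refine IsBdd.of_bound hm B ?_
  filter_upwards [ae_Ioo] with r hr
  rw [abs_div, abs_of_pos hr.1, div_le_iff₀ hr.1]
  exact hB r ⟨hr.1.le, hr.2.le⟩

/-- The data of the solution `w = r φ` of `-(w'' + w'/r - w/r²) = F` with `w(0) = w(1) = 0`:
`z = r φ'` up to sign. -/
structure IsDualSolution (F φ z : ℝ → ℝ) : Prop where
  contφ : ContinuousOn φ I
  contz : ContinuousOn z I
  one : φ 1 = 0
  derivφ : ∀ r ∈ Ioo (0 : ℝ) 1, HasDerivAt φ (-(z r / r)) r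
  derivz : ∀ r ∈ Ioo (0 : ℝ) 1, HasDerivAt z (F r - 2 * (z r / r)) r
  bound : ∃ B : ℝ, 0 ≤ B ∧ ∀ r ∈ I, |z r| ≤ B * r
  le_norm : ∀ r ∈ I, |z r| ≤ norm0 F / 2

/-- With w = rφ the equation reads (r³φ')' = -r²F. Hence z = -rφ' is r⁻² times the integral of s²F
over [0,r], and φ is the integral of z/s over [r,1]. The bound of z by ‖F‖/2 is Cauchy-Schwarz
against s restricted to [0,r], whose weighted norm is r²/2. -/
theorem exists_isDualSolution {F : ℝ → ℝ} (hF : ContinuousOn F I) : ∃ φ z, IsDualSolution F φ z := by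
  -- A globally continuous extension, so that the primitive is differentiable at every real point.
  set G : ℝ → ℝ := IccExtend (zero_le_one' ℝ) (I.domRestrict F) with hG
  have hGc : Continuous G := (continuousOn_iff_continuous_domRestrict.1 hF).Icc_extend'
  have hGF : ∀ r ∈ I, G r = F r := fun r hr => by rw [hG, IccExtend_of_mem _ _ hr]; rfl
  obtain ⟨B, hB⟩ := isCompact_Icc.exists_bound_of_continuousOn hF
  have hB0 : 0 ≤ B := (norm_nonneg _).trans (hB 0 ⟨le_rfl, zero_le_one⟩)
  set Y : ℝ → ℝ := fun r => ∫ s in (0 : ℝ)..r, s ^ 2 * G s with hY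
  have hint : Continuous fun s : ℝ => s ^ 2 * G s := by fun_prop
  have hYd : ∀ r, HasDerivAt Y (r ^ 2 * G r) r := fun r =>
    intervalIntegral.integral_hasDerivAt_right (hint.intervalIntegrable _ _)
      (hint.stronglyMeasurableAtFilter _ _) hint.continuousAt
  have hYc : Continuous Y := continuous_iff_continuousAt.2 fun r => (hYd r).continuousAt
  have hYB : ∀ r ∈ I, |Y r| ≤ B * r ^ 3 := by
    intro r hr
    have h := intervalIntegral.norm_integral_le_of_norm_le_const (a := 0) (b := r) (C := r ^ 2 * B)
      (f := fun s : ℝ => s ^ 2 * G s) (fun s hs => by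
        rw [uIoc_of_le hr.1] at hs
        rw [hGF s ⟨hs.1.le, hs.2.trans hr.2⟩, norm_mul, norm_pow, Real.norm_of_nonneg hs.1.le]
        have h1 := hB s ⟨hs.1.le, hs.2.trans hr.2⟩
        have h2 : s ^ 2 ≤ r ^ 2 := pow_le_pow_left₀ hs.1.le hs.2 2
        gcongr)
    rw [sub_zero, abs_of_nonneg hr.1] at h
    calc _ ≤ _ := h
      _ = _ := by ring
  have hYn : ∀ r ∈ I, |Y r| ≤ r ^ 2 * (norm0 F / 2) := by
    intro r hr
    set g : ℝ → ℝ := (Icc 0 r).indicator id with hg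
    have hgb : IsBdd g := isBdd_id.indicator measurableSet_Icc
    have hFb := isBdd_of_continuousOn hF
    have e : ∀ f : ℝ → ℝ, ∫ s, (Icc 0 r).indicator f s ∂volI = ∫ s in (0 : ℝ)..r, f s := by
      intro f
      rw [integral_indicator measurableSet_Icc, Measure.restrict_restrict measurableSet_Icc,
        inter_eq_left.2 (Icc_subset_Icc_right hr.2), intervalIntegral.integral_of_le hr.1,
        integral_Icc_eq_integral_Ioc]
    have e1 : Y r = inner0 F g := by
      rw [inner0_eq, hY]
      simp only
      rw [← e]
      refine integral_congr_ae ?_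
      filter_upwards [ae_restrict_mem measurableSet_Icc] with s hs
      by_cases h : s ∈ Icc 0 r
      · simp only [hg, indicator_of_mem h, id, hGF s hs]; ring
      · simp [hg, indicator_of_notMem h]
    have e2 : norm0 g = r ^ 2 / 2 := by
      have : inner0 g g = (r ^ 2 / 2) ^ 2 := by
        have : inner0 g g = ∫ s in (0 : ℝ)..r, s ^ 3 := by
          rw [inner0_eq, ← e]
          congr 1
          ext s
          by_cases h : s ∈ Icc 0 r
          · simp only [hg, indicator_of_mem h, id]; ring
          · simp [hg, indicator_of_notMem h]
        rw [this, integral_pow]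
        norm_num
        ring
      rw [norm0, this, Real.sqrt_sq (by positivity)]
    rw [e1]
    refine (abs_inner0_le hFb hgb).trans (le_of_eq ?_)
    rw [e2]
    ring
  set z : ℝ → ℝ := fun r => Y r / r ^ 2 with hz
  have hzB : ∀ r ∈ I, |z r| ≤ B * r := by
    intro r hr
    rcases hr.1.eq_or_lt with h | h
    · simp [hz, ← h]
    · rw [hz, abs_div, abs_of_pos (by positivity : 0 < r ^ 2), div_le_iff₀ (by positivity)]
      calc _ ≤ _ := hYB r hr
        _ = _ := by ring
  have hzc : ContinuousOn z I := by
    intro r hr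
    rcases hr.1.eq_or_lt with h | h
    · subst h
      have hz0 : z 0 = 0 := by simp [hz]
      rw [ContinuousWithinAt, hz0]
      refine squeeze_zero_norm' (a := fun r => B * r) ?_ ?_
      · filter_upwards [self_mem_nhdsWithin] with r hr using hzB r hr
      · have : ContinuousWithinAt (fun r : ℝ => B * r) I 0 :=
          (continuous_const.mul continuous_id).continuousWithinAt
        simpa [ContinuousWithinAt] using this
    · exact (hYc.continuousAt.div (continuous_pow 2).continuousAt
        (by positivity)).continuousWithinAt
  have hψb : IsBdd fun r => z r / r := isBdd_div_of_bound hzc hzB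
  have hψi := hψb.integrable
  set φ : ℝ → ℝ := fun r => ∫ s in r..1, z s / s with hφ
  have h1I : (1 : ℝ) ∈ I := ⟨zero_le_one, le_rfl⟩
  refine ⟨φ, z, ?_, hzc, by simp [hφ], ?_, ?_, ⟨B, hB0, hzB⟩, ?_⟩
  · have h := intervalIntegral.continuousOn_primitive_interval_left (f := fun s => z s / s)
      (a := 0) (b := 1) (μ := volume) (by rw [uIcc_of_le zero_le_one]; exact hψi)
    rwa [uIcc_of_le zero_le_one] at h
  · intro r hr
    have hcont : ContinuousAt (fun s => z s / s) r :=
      ((hzc.continuousAt (Icc_mem_nhds hr.1 hr.2)).div continuousAt_id hr.1.ne')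
    refine intervalIntegral.integral_hasDerivAt_left
      (intervalIntegrable_of_integrable_volI hψi ⟨hr.1.le, hr.2.le⟩ h1I) ?_ hcont
    exact ⟨I, Icc_mem_nhds hr.1 hr.2, hψb.meas⟩
  · intro r hr
    have hr0 := hr.1.ne'
    have h := (hYd r).div (hasDerivAt_pow 2 r) (pow_ne_zero 2 hr0)
    have h' := h.congr_deriv (g' := F r - 2 * (z r / r)) (by
      rw [hGF r ⟨hr.1.le, hr.2.le⟩, hz]
      field_simp
      ring)
    exact h'
  · intro r hr
    rcases hr.1.eq_or_lt with h | h
    · simp only [hz, ← h]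
      have := norm0_nonneg F
      simp only [ne_eq, OfNat.ofNat_ne_zero, not_false_eq_true, zero_pow, div_zero, abs_zero]
      positivity
    · rw [hz, abs_div, abs_of_pos (by positivity : 0 < r ^ 2), div_le_iff₀ (by positivity)]
      calc _ ≤ _ := hYn r hr
        _ = _ := by ring

namespace IsDualSolution

theorem bdd_div {F φ z : ℝ → ℝ} (h : IsDualSolution F φ z) : IsBdd fun r => z r / r := by
  obtain ⟨B, -, hB⟩ := h.bound
  exact isBdd_div_of_bound h.contz hB

theorem hasDerivAt_mul {F φ z : ℝ → ℝ} (h : IsDualSolution F φ z) {r : ℝ}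
    (hr : r ∈ Ioo (0 : ℝ) 1) : HasDerivAt (fun r => r * φ r) (φ r - z r) r := by
  refine ((hasDerivAt_id r).mul (h.derivφ r hr)).congr_deriv ?_
  have := hr.1.ne'
  simp only [id]
  field_simp
  ring

end IsDualSolution
namespace IsDualSolution

theorem z_zero {F φ z : ℝ → ℝ} (h : IsDualSolution F φ z) : z 0 = 0 := by
  obtain ⟨B, -, hB⟩ := h.bound
  simpa using hB 0 ⟨le_rfl, zero_le_one⟩

/-- A Hardy inequality for the dual solution. -/
theorem norm0_div_le {F φ z : ℝ → ℝ} (h : IsDualSolution F φ z) (hF : ContinuousOn F I) :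
    norm0 (fun r => z r / r) ≤ norm0 F / 2 := by
  have hFb := isBdd_of_continuousOn hF
  have hzb := isBdd_of_continuousOn h.contz
  have hψ := h.bdd_div
  have hb : IsBdd fun r => 2 * (z r * (F r - 2 * (z r / r))) :=
    (hzb.mul (hFb.sub (hψ.const_mul 2))).const_mul 2
  -- Integrating (z²)' = 2zF - 4z²/r gives 0 ≤ z(1)² = 2(F, z/r) - 4‖z/r‖² in the weighted product;
  -- Cauchy-Schwarz finishes.
  have hftc := intervalIntegral.integral_eq_sub_of_hasDerivAt_of_le (zero_le_one' ℝ)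
    (f := fun r => z r * z r) (f' := fun r => 2 * (z r * (F r - 2 * (z r / r))))
    (h.contz.mul h.contz)
    (fun r hr => ((h.derivz r hr).mul (h.derivz r hr)).congr_deriv (by ring))
    (intervalIntegrable_of_integrable_volI hb.integrable ⟨le_rfl, zero_le_one⟩
      ⟨zero_le_one, le_rfl⟩)
  rw [h.z_zero, mul_zero, sub_zero, integral_eq_volI] at hftc
  have e : ∫ r, 2 * (z r * (F r - 2 * (z r / r))) ∂volI
      = 2 * inner0 F (fun r => z r / r) - 4 * inner0 (fun r => z r / r) (fun r => z r / r) := by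
    rw [inner0_eq, inner0_eq, ← integral_const_mul, ← integral_const_mul,
      ← integral_sub ((hFb.integrable_mul hψ).const_mul 2) ((hψ.integrable_mul hψ).const_mul 4)]
    refine integral_congr_ae ?_
    filter_upwards [ae_Ioo] with r hr
    have := hr.1.ne'
    field_simp
    ring
  rw [e, ← norm0_sq] at hftc
  have h1 := le_of_abs_le (abs_inner0_le hFb hψ)
  have h2 : 0 ≤ z 1 * z 1 := mul_self_nonneg _
  have h3 := norm0_nonneg (fun r => z r / r)
  have h4 := norm0_nonneg F
  by_contra! hcon
  nlinarith

theorem lip0 {F φ z : ℝ → ℝ} (h : IsDualSolution F φ z) : Lip0 fun r => r * φ r := by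
  obtain ⟨B, hB⟩ := isCompact_Icc.exists_bound_of_continuousOn (h.contφ.sub h.contz)
  have hB0 : 0 ≤ B := (norm_nonneg _).trans (hB 0 ⟨le_rfl, zero_le_one⟩)
  exact ⟨⟨⟨B, hB0⟩, lipschitzOnWith_of_hasDerivAt (continuousOn_id.mul h.contφ)
    (fun r hr => h.hasDerivAt_mul hr) fun r hr => hB r ⟨hr.1.le, hr.2.le⟩⟩, by simp, by simp [h.one]⟩

theorem D_eq {F φ z : ℝ → ℝ} (h : IsDualSolution F φ z) {r : ℝ} (hr : r ∈ Ioo (0 : ℝ) 1) :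
    D (fun r => r * φ r) r = φ r - z r := by
  rw [D_eq_deriv _ hr, (h.hasDerivAt_mul hr).deriv]

/-- The flux rw' = rφ - rz has the bounded derivative φ - rF, so integration by parts applies up to
the origin. -/
theorem innerH_eq {F φ z : ℝ → ℝ} (h : IsDualSolution F φ z) (hF : ContinuousOn F I) {v : ℝ → ℝ}
    (hv : Lip0 v) : innerH (fun r => r * φ r) v = inner0 F v := by
  have hc : ContinuousOn (fun r => φ r - r * F r) I := h.contφ.sub (continuousOn_id.mul hF)
  obtain ⟨B, hB⟩ := isCompact_Icc.exists_bound_of_continuousOn hc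
  have hB0 : 0 ≤ B := (norm_nonneg _).trans (hB 0 ⟨le_rfl, zero_le_one⟩)
  have hd : ∀ r ∈ Ioo (0 : ℝ) 1, HasDerivAt (fun r => r * φ r - r * z r) (φ r - r * F r) r := by
    intro r hr
    refine ((h.hasDerivAt_mul hr).sub ((hasDerivAt_id r).mul (h.derivz r hr))).congr_deriv ?_
    have := hr.1.ne'
    simp only [id]
    field_simp
    ring
  refine innerH_eq_inner0_of_lipschitz (p := fun r => r * φ r - r * z r) (K := ⟨B, hB0⟩) h.lip0
    (isBdd_of_continuousOn hF) (lipschitzOnWith_of_hasDerivAt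
      ((continuousOn_id.mul h.contφ).sub (continuousOn_id.mul h.contz)) hd
      fun r hr => hB r ⟨hr.1.le, hr.2.le⟩) ?_ ?_ hv
  · filter_upwards [ae_Ioo] with r hr
    rw [h.D_eq hr]; ring
  · filter_upwards [ae_Ioo] with r hr
    rw [D_eq_deriv _ hr, (hd r hr).deriv, mul_div_cancel_left₀ _ hr.1.ne']

/-- Cauchy's mean value theorem against the logarithm gives φ(x) - φ(y) = z(c) log(y/x). The
logarithm is traded for 2√(y/x), whose square times the weight stays bounded on the first element.
-/
theorem abs_sub_le {F φ z : ℝ → ℝ} (h : IsDualSolution F φ z) {x y : ℝ} (hx : 0 < x)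
    (hxy : x ≤ y) (hy : y ≤ 1) : |φ x - φ y| ≤ norm0 F * √(y / x) := by
  have hF0 := norm0_nonneg F
  rcases hxy.eq_or_lt with rfl | hlt
  · rw [sub_self, abs_zero]; positivity
  have hy0 : 0 < y := hx.trans hlt
  obtain ⟨c, hc, hc'⟩ := exists_ratio_hasDerivAt_eq_ratio_slope φ (fun r => -(z r / r)) hlt
    (h.contφ.mono (Icc_subset_Icc hx.le hy))
    (fun r hr => h.derivφ r ⟨hx.trans hr.1, hr.2.trans_le hy⟩) Real.log (fun r => r⁻¹)
    (fun r hr => (Real.continuousAt_log (hx.trans_le hr.1).ne').continuousWithinAt)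
    (fun r hr => Real.hasDerivAt_log (hx.trans hr.1).ne')
  have hc0 : 0 < c := hx.trans hc.1
  have h1 : φ x - φ y = (Real.log y - Real.log x) * z c := by
    field_simp at hc'
    linarith
  have h2 : Real.log y - Real.log x = 2 * Real.log (√(y / x)) := by
    rw [Real.log_sqrt (by positivity), Real.log_div (by positivity) hx.ne']; ring
  have hq : 1 ≤ √(y / x) := Real.one_le_sqrt.2 ((one_le_div hx).2 hxy)
  have h3 : Real.log (√(y / x)) ≤ √(y / x) := by
    linarith [Real.log_le_sub_one_of_pos (lt_of_lt_of_le zero_lt_one hq)]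
  have h4 : 0 ≤ Real.log (√(y / x)) := Real.log_nonneg hq
  have h5 := h.le_norm c ⟨hc0.le, hc.2.le.trans hy⟩
  rw [h1, h2, abs_mul, abs_of_nonneg (by positivity)]
  calc 2 * Real.log √(y / x) * |z c| ≤ 2 * √(y / x) * (norm0 F / 2) := by gcongr
    _ = _ := by ring

/-- The case y = 1, where φ vanishes. This is the origin of the √r bound for discrete solutions. -/
theorem abs_le_sqrt {F φ z : ℝ → ℝ} (h : IsDualSolution F φ z) {r : ℝ} (hr : r ∈ I) :
    |r * φ r| ≤ norm0 F * √r := by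
  rcases hr.1.eq_or_lt with h0 | h0
  · simp [← h0]
  have h1 := h.abs_sub_le h0 hr.2 le_rfl
  rw [h.one, sub_zero] at h1
  rw [abs_mul, abs_of_pos h0]
  calc r * |φ r| ≤ r * (norm0 F * √(1 / r)) := by gcongr
    _ = norm0 F * (r * √(1 / r)) := by ring
    _ = _ := by
      rw [one_div, Real.sqrt_inv]
      congr 1
      have : 0 < √r := Real.sqrt_pos.2 h0
      field_simp
      exact (Real.sq_sqrt h0.le).symm

/-- Interpolation error of the dual solution on the elements away from the origin. -/
theorem element_bound {F φ z : ℝ → ℝ} (h : IsDualSolution F φ z) (hF : ContinuousOn F I)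
    {a d : ℝ} (hd : 0 < d) (had : d ≤ a) (hb : a + d ≤ 1) {m : ℝ} {e : ℝ → ℝ}
    (he : ∀ r ∈ Icc a (a + d), e r = r * φ r - (a * φ a + m * (r - a)))
    (hm : a * φ a + m * d = (a + d) * φ (a + d)) :
    ∀ r ∈ Ioo a (a + d), deriv e r * deriv e r * r + e r / r * (e r / r) * r
      ≤ 4 * d * ∫ s in a..(a + d), (z s / s - F s) ^ 2 * s := by
  have ha : 0 < a := hd.trans_le had
  have hlt : a < a + d := by linarith
  have hsub : ∀ r ∈ Icc a (a + d), r ∈ I := fun r hr => ⟨ha.le.trans hr.1, hr.2.trans hb⟩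
  have hsub' : ∀ r ∈ Ioo a (a + d), r ∈ Ioo (0 : ℝ) 1 := fun r hr =>
    ⟨ha.trans hr.1, hr.2.trans_le hb⟩
  have haI : a ∈ I := hsub a ⟨le_rfl, hlt.le⟩
  have hbI : a + d ∈ I := hsub _ ⟨hlt.le, le_rfl⟩
  set g : ℝ → ℝ := fun s => z s / s - F s with hg
  have hgb : IsBdd g := h.bdd_div.sub (isBdd_of_continuousOn hF)
  have hgb2 : IsBdd fun s => g s ^ 2 := by simpa only [sq] using hgb.mul hgb
  have hwc : ContinuousOn (fun r => r * φ r) (Icc a (a + d)) :=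
    (continuousOn_id.mul h.contφ).mono hsub
  -- The slope m of the chord is a value of w', so w' - m is an integral of w'' = z/s - F over part
  -- of the element. Cauchy-Schwarz applies, and the weight is harmless since a ≤ r ≤ 2a there.
  obtain ⟨ξ, hξ, hξ'⟩ := exists_hasDerivAt_eq_slope (fun r => r * φ r) (fun r => φ r - z r) hlt hwc
    fun r hr => h.hasDerivAt_mul (hsub' r hr)
  have hξm : φ ξ - z ξ = m := by
    rw [hξ', ← hm, add_sub_cancel_left, add_sub_cancel_left, mul_div_cancel_right₀ _ hd.ne']
  set J := ∫ s in a..(a + d), g s ^ 2 * s with hJ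
  have hJi : IntervalIntegrable (fun s => g s ^ 2 * s) volume a (a + d) :=
    intervalIntegrable_of_integrable_volI (hgb2.mul isBdd_id).integrable haI hbI
  have hi2 : ∀ {x y}, x ∈ I → y ∈ I → IntervalIntegrable (fun s => g s ^ 2) volume x y :=
    fun hx hy => intervalIntegrable_of_integrable_volI hgb2.integrable hx hy
  have hdiff : ∀ x ∈ Icc a (a + d), ∀ y ∈ Icc a (a + d), x ≤ y →
      a * ((φ y - z y) - (φ x - z x)) ^ 2 ≤ d * J := by
    intro x hx y hy hxy
    have hxI := hsub x hx
    have hyI := hsub y hy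
    have hgi : IntervalIntegrable g volume x y :=
      intervalIntegrable_of_integrable_volI hgb.integrable hxI hyI
    have hftc := intervalIntegral.integral_eq_sub_of_hasDerivAt_of_le hxy
      (f := fun r => φ r - z r) (f' := g)
      ((h.contφ.sub h.contz).mono (Icc_subset_Icc hxI.1 hyI.2))
      (fun r hr => by
        have hr' : r ∈ Ioo (0 : ℝ) 1 := ⟨hxI.1.trans_lt hr.1, hr.2.trans_le hyI.2⟩
        refine ((h.derivφ r hr').sub (h.derivz r hr')).congr_deriv ?_
        simp only [hg]; ring) hgi
    rw [← hftc]
    have h1 := sq_integral_le hxy hgi (hi2 hxI hyI)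
    have h2 : ∫ s in x..y, g s ^ 2 ≤ ∫ s in a..(a + d), g s ^ 2 :=
      intervalIntegral.integral_mono_interval hx.1 hxy hy.2
        (Filter.Eventually.of_forall fun _ => sq_nonneg _) (hi2 haI hbI)
    have h3 : 0 ≤ ∫ s in x..y, g s ^ 2 := intervalIntegral.integral_nonneg hxy fun _ _ => sq_nonneg _
    have h4 : a * ∫ s in a..(a + d), g s ^ 2 ≤ J := by
      rw [hJ, ← intervalIntegral.integral_const_mul]
      refine intervalIntegral.integral_mono_on hlt.le ((hi2 haI hbI).const_mul a) hJi fun s hs => ?_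
      rw [mul_comm]
      exact mul_le_mul_of_nonneg_left hs.1 (sq_nonneg _)
    have h5 : y - x ≤ d := by linarith [hx.1, hy.2]
    calc a * (∫ s in x..y, g s) ^ 2 ≤ a * ((y - x) * ∫ s in x..y, g s ^ 2) := by gcongr
      _ ≤ a * (d * ∫ s in a..(a + d), g s ^ 2) := by gcongr
      _ = d * (a * ∫ s in a..(a + d), g s ^ 2) := by ring
      _ ≤ d * J := by gcongr
  have hdiff' : ∀ x ∈ Icc a (a + d), a * ((φ x - z x) - m) ^ 2 ≤ d * J := by
    intro x hx
    rw [← hξm]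
    rcases le_total x ξ with hle | hle
    · have := hdiff x hx ξ ⟨hξ.1.le, hξ.2.le⟩ hle
      rwa [← neg_sub, neg_sq] at this
    · exact hdiff ξ ⟨hξ.1.le, hξ.2.le⟩ x hx hle
  have hed : ∀ r ∈ Ioo a (a + d), HasDerivAt (fun r => r * φ r - (a * φ a + m * (r - a)))
      (φ r - z r - m) r := fun r hr => by
    refine ((h.hasDerivAt_mul (hsub' r hr)).sub
      ((((hasDerivAt_id r).sub_const a).const_mul m).const_add (a * φ a))).congr_deriv ?_
    simp
  intro r hr
  have hr' : r ∈ Icc a (a + d) := ⟨hr.1.le, hr.2.le⟩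
  have hr0 : 0 < r := ha.trans hr.1
  have hder : deriv e r = φ r - z r - m := by
    have : e =ᶠ[nhds r] fun r => r * φ r - (a * φ a + m * (r - a)) := by
      filter_upwards [Icc_mem_nhds hr.1 hr.2] with s hs using he s hs
    rw [this.deriv_eq, (hed r hr).deriv]
  have k1 : deriv e r * deriv e r * r ≤ 2 * d * J := by
    rw [hder]
    have := hdiff' r hr'
    have h2a : r ≤ 2 * a := by linarith [hr.2]
    nlinarith [sq_nonneg (φ r - z r - m)]
  have k2 : e r / r * (e r / r) * r ≤ 2 * d * J := by
    obtain ⟨s, hs, hs'⟩ := exists_hasDerivAt_eq_slope (fun r => r * φ r - (a * φ a + m * (r - a)))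
      (fun r => φ r - z r - m) hr.1
      ((hwc.mono (Icc_subset_Icc_right hr.2.le)).sub (by fun_prop))
      fun x hx => hed x ⟨hx.1, hx.2.trans hr.2⟩
    rw [← he r hr'] at hs'
    have hra : 0 < r - a := sub_pos.2 hr.1
    have her : e r = (φ s - z s - m) * (r - a) := by
      rw [hs']
      field_simp
      ring
    have hds := hdiff' s ⟨hs.1.le, hs.2.le.trans hr.2.le⟩
    have h1 : e r / r * (e r / r) * r = (φ s - z s - m) ^ 2 * ((r - a) ^ 2 / r) := by
      rw [her]
      field_simp
    rw [h1]
    have h2 : (r - a) ^ 2 / r ≤ 2 * a := by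
      rw [div_le_iff₀ hr0]
      have : r - a ≤ a := by linarith [hr.2]
      nlinarith
    nlinarith [sq_nonneg (φ s - z s - m)]
  linarith

end IsDualSolution

/-- Piecewise linear interpolation of w = rφ. Away from the origin it is governed by w'' = z/r - F,
of weighted norm at most 3‖F‖/2 by the Hardy inequality. On the first element the weight is not
comparable to a constant; there the interpolant is rφ(d), the error is r(φ(r) - φ(d)), and the
pointwise bounds on φ and z are used instead. -/
theorem IsDualSolution.exists_interpolant {F φ z : ℝ → ℝ} (h : IsDualSolution F φ z)
    (hF : ContinuousOn F I) {k N : ℕ} (hk : 1 ≤ k) (hN : 1 ≤ N) :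
    ∃ χ ∈ FESpace k N, normHr (fun r => r * φ r - χ r) ≤ 4 / N * norm0 F := by
  have hN' : (0 : ℝ) < N := by exact_mod_cast hN
  set d : ℝ := 1 / N with hd
  have hpos : 0 < d := by positivity
  have hsucc : ∀ i : ℕ, ((i : ℝ) + 1) / N = (i : ℝ) / N + d := fun i => by rw [hd, add_div]
  have hF0 := norm0_nonneg F
  have hw := h.lip0
  obtain ⟨χ, hχ, hχp⟩ := FESpace.exists_interpolant (k := k) hN (v := fun r => r * φ r)
    hw.zero hw.one
    (P := fun i p => (i = 0 → ∀ r, p.eval r = r * φ d) ∧ (0 < i → ∃ m : ℝ,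
      ((i : ℝ) / N) * φ ((i : ℝ) / N) + m * d = ((i : ℝ) / N + d) * φ ((i : ℝ) / N + d) ∧
      ∀ r, p.eval r = (i : ℝ) / N * φ ((i : ℝ) / N) + m * (r - (i : ℝ) / N))) (fun i hi => by
    rw [hsucc]
    rcases Nat.eq_zero_or_pos i with rfl | hipos
    · refine ⟨Polynomial.C (φ d) * Polynomial.X, ?_, by simp, ?_, fun _ r => ?_,
        fun h => absurd h (lt_irrefl _)⟩
      · exact (Polynomial.natDegree_C_mul_le _ _).trans (Polynomial.natDegree_X_le.trans hk)
      · rw [Polynomial.eval_mul, Polynomial.eval_C, Polynomial.eval_X, Nat.cast_zero, zero_div,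
          zero_add, mul_comm]
      · rw [Polynomial.eval_mul, Polynomial.eval_C, Polynomial.eval_X, mul_comm]
    · set a : ℝ := (i : ℝ) / N with ha
      set m : ℝ := ((a + d) * φ (a + d) - a * φ a) / d with hm
      have hmd : m * d = (a + d) * φ (a + d) - a * φ a := div_mul_cancel₀ _ hpos.ne'
      refine ⟨Polynomial.C (a * φ a) + Polynomial.C m * (Polynomial.X - Polynomial.C a), ?_,
        by simp, ?_, fun h => absurd h hipos.ne', fun _ => ⟨m, ?_, by simp⟩⟩
      · refine Polynomial.natDegree_add_le_of_degree_le
          ((Polynomial.natDegree_C _).le.trans (Nat.zero_le k)) ?_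
        refine (Polynomial.natDegree_C_mul_le _ _).trans ?_
        rw [Polynomial.natDegree_X_sub_C]
        exact hk
      · simp [hmd]
      · rw [hmd]; ring)
  refine ⟨χ, hχ, ?_⟩
  set e : ℝ → ℝ := fun r => r * φ r - χ r with he
  have heL : Lip0 e := hw.sub (FESpace.lip0 hN hχ)
  have hgb : IsBdd fun s => z s / s - F s := h.bdd_div.sub (isBdd_of_continuousOn hF)
  have hgi : Integrable (fun s => (z s / s - F s) ^ 2 * s) volI := by
    simpa only [sq] using hgb.integrable_mul hgb
  have hei : Integrable (fun r => deriv e r * deriv e r * r + e r / r * (e r / r) * r) volI := by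
    have hd := heL.bddD.congr (D_ae_eq e)
    exact (hd.integrable_mul hd).add (heL.bdd_div.integrable_mul heL.bdd_div)
  have hH : innerH e e = ∫ r, deriv e r * deriv e r * r + e r / r * (e r / r) * r ∂volI := by
    rw [innerH_self_eq heL]
    refine integral_congr_ae ?_
    filter_upwards [D_ae_eq e] with r hr
    rw [hr]
  set J : ℕ → ℝ := fun i => ∫ s in ((i : ℝ) / N)..((i : ℝ) / N + d), (z s / s - F s) ^ 2 * s with hJ
  have hJsum : ∑ i ∈ Finset.range N, J i ≤ (3 / 2 * norm0 F) ^ 2 := by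
    have e1 : ∑ i ∈ Finset.range N, J i = inner0 (fun s => z s / s - F s) fun s => z s / s - F s := by
      have := integral_eq_sum_elements hN hgi
      simp only [hsucc] at this
      rw [hJ, ← this, inner0_eq]
      simp only [sq]
    rw [e1, ← norm0_sq]
    refine pow_le_pow_left₀ (norm0_nonneg _) ?_ 2
    have h1 := norm0_add_le h.bdd_div ((isBdd_of_continuousOn hF).const_mul (-1))
    rw [norm0_smul] at h1
    have h2 := h.norm0_div_le hF
    simp only [neg_mul, one_mul, abs_neg, abs_one, ← sub_eq_add_neg] at h1
    linarith
  have hbound : ∀ i ∈ Finset.range N,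
      ∫ r in ((i : ℝ) / N)..(((i : ℝ) + 1) / N), (deriv e r * deriv e r * r + e r / r * (e r / r) * r)
        ≤ 4 * d ^ 2 * J i + if i = 0 then 4 * d ^ 2 * norm0 F ^ 2 else 0 := by
    intro i hi
    have hiN := Finset.mem_range.1 hi
    obtain ⟨p, ⟨hp0, hp1⟩, hpχ⟩ := hχp i hiN
    have hsub := element_subset_I hN hiN
    rw [hsucc] at hpχ hsub ⊢
    set a : ℝ := (i : ℝ) / N with ha
    have haI : a ∈ I := hsub ⟨le_rfl, by linarith⟩
    have hbI : a + d ∈ I := hsub ⟨by linarith, le_rfl⟩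
    have hconst : ∀ B : ℝ, (∀ r ∈ Ioo a (a + d),
        deriv e r * deriv e r * r + e r / r * (e r / r) * r ≤ B) →
        ∫ r in a..(a + d), (deriv e r * deriv e r * r + e r / r * (e r / r) * r) ≤ d * B := by
      intro B hB
      have := intervalIntegral.integral_mono_on_of_le_Ioo (a := a) (b := a + d) (by linarith)
        (intervalIntegrable_of_integrable_volI hei haI hbI)
        (intervalIntegrable_const (c := B)) hB
      rwa [intervalIntegral.integral_const, add_sub_cancel_left, smul_eq_mul] at this
    have hJ0 : 0 ≤ J i := intervalIntegral.integral_nonneg (by linarith) fun s hs =>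
      mul_nonneg (sq_nonneg _) (haI.1.trans hs.1)
    rcases Nat.eq_zero_or_pos i with h0 | hipos
    · have ha0 : a = 0 := by rw [ha, h0]; simp
      rw [if_pos h0]
      have hp0 := hp0 h0
      have : ∫ r in a..(a + d), (deriv e r * deriv e r * r + e r / r * (e r / r) * r)
          ≤ d * (4 * d * norm0 F ^ 2) := by
        refine hconst _ fun r hr => ?_
        rw [ha0, zero_add] at hr hpχ
        have hd1 : d ≤ 1 := by rw [ha0, zero_add] at hbI; exact hbI.2
        have hr1 : r ∈ Ioo (0 : ℝ) 1 := ⟨hr.1, hr.2.trans_le hd1⟩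
        have her : e =ᶠ[nhds r] fun r => r * φ r - r * φ d := by
          filter_upwards [Icc_mem_nhds hr.1 hr.2] with s hs
          simp only [he]
          rw [hpχ s hs, hp0]
        have hde : deriv e r = φ r - z r - φ d := by
          rw [her.deriv_eq]
          exact ((h.hasDerivAt_mul hr1).sub
            ((hasDerivAt_id r).mul_const (φ d))).deriv.trans (by simp)
        have hee : e r / r = φ r - φ d := by
          rw [her.eq_of_nhds]
          have := hr.1.ne'
          field_simp
        have hφ := h.abs_sub_le hr.1 hr.2.le hd1
        have hz := h.le_norm r ⟨hr1.1.le, hr1.2.le⟩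
        have hφ2 : (φ r - φ d) ^ 2 * r ≤ norm0 F ^ 2 * d := by
          have := pow_le_pow_left₀ (abs_nonneg _) hφ 2
          rw [sq_abs, mul_pow, Real.sq_sqrt (div_nonneg hpos.le hr.1.le)] at this
          calc _ ≤ norm0 F ^ 2 * (d / r) * r := mul_le_mul_of_nonneg_right this hr.1.le
            _ = _ := by have := hr.1.ne'; field_simp
        have hz2 : z r ^ 2 * r ≤ norm0 F ^ 2 / 4 * d := by
          have := pow_le_pow_left₀ (abs_nonneg _) hz 2
          rw [sq_abs] at this
          calc _ ≤ (norm0 F / 2) ^ 2 * d := mul_le_mul this hr.2.le hr.1.le (by positivity)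
            _ = _ := by ring
        rw [hde, hee]
        have : 0 ≤ (φ r - φ d + z r) ^ 2 * r := mul_nonneg (sq_nonneg _) hr.1.le
        have : 0 ≤ norm0 F ^ 2 * d := by positivity
        nlinarith
      have : 0 ≤ 4 * d ^ 2 * J i := by positivity
      linarith
    · rw [if_neg hipos.ne', add_zero]
      obtain ⟨m, hm, hpm⟩ := hp1 hipos
      have hda : d ≤ a := by
        rw [hd, ha]
        gcongr
        exact_mod_cast hipos
      have := hconst _ (h.element_bound hF hpos hda hbI.2 (m := m) (e := e) (fun r hr => by
        simp only [he]
        rw [hpχ r hr, hpm]) hm)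
      calc _ ≤ _ := this
        _ = _ := by rw [hJ]; ring
  have hfin : innerH e e ≤ (4 / N * norm0 F) ^ 2 := by
    rw [hH, integral_eq_sum_elements hN hei]
    refine (Finset.sum_le_sum hbound).trans ?_
    rw [Finset.sum_add_distrib, ← Finset.mul_sum, Finset.sum_ite_eq' (Finset.range N) 0,
      if_pos (Finset.mem_range.2 (by omega)), show (4 / N * norm0 F) ^ 2 = 16 * d ^ 2 * norm0 F ^ 2 by
        rw [hd]; ring]
    have hd2 : 0 ≤ d ^ 2 := sq_nonneg d
    have hnn : 0 ≤ d ^ 2 * norm0 F ^ 2 := by positivity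
    nlinarith [mul_le_mul_of_nonneg_left hJsum hd2]
  exact Real.sqrt_le_iff.2 ⟨by positivity, hfin⟩

/-! ### The Galerkin projection -/

/-- `R` is the projection of `w` to the finite element space with respect to `innerH`. -/
structure IsRitz (k N : ℕ) (w R : ℝ → ℝ) : Prop where
  mem : R ∈ FESpace k N
  eq : ∀ v ∈ FESpace k N, innerH R v = innerH w v

/-- Galerkin orthogonality turns ‖w - R‖² into the product of w - R with w - χ; then Cauchy-Schwarz.
-/
theorem IsRitz.normHr_le {k N : ℕ} (hN : 1 ≤ N) {w R : ℝ → ℝ} (h : IsRitz k N w R) (hw : Lip0 w)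
    {χ : ℝ → ℝ} (hχ : χ ∈ FESpace k N) :
    normHr (fun r => w r - R r) ≤ normHr (fun r => w r - χ r) := by
  have hR := FESpace.lip0 hN h.mem
  have hχL := FESpace.lip0 hN hχ
  have hd := FESpace.sub h.mem hχ
  have hdL := FESpace.lip0 hN hd
  have e1 : innerH (fun r => w r - R r) (fun r => R r - χ r) = 0 := by
    rw [innerH_sub_left hw hR hdL, h.eq _ hd, sub_self]
  have e2 : innerH (fun r => w r - R r) (fun r => w r - χ r)
      = innerH (fun r => w r - R r) (fun r => w r - R r) := by
    have : innerH (fun r => w r - R r) (fun r => w r - χ r)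
        = innerH (fun r => w r - R r) (fun r => (w r - R r) + (R r - χ r)) :=
      innerH_congr (fun _ _ => rfl) fun _ _ => by ring
    rw [this, innerH_comm, innerH_add_left (hw.sub hR) hdL (hw.sub hR),
      innerH_comm (fun r => R r - χ r), e1, add_zero]
  have h1 := le_of_abs_le (abs_innerH_le (hw.sub hR) (hw.sub hχL))
  rw [e2, ← normHr_sq] at h1
  have h2 := normHr_nonneg fun r => w r - R r
  have h3 := normHr_nonneg fun r => w r - χ r
  by_contra! hcon
  nlinarith

/-- The duality argument of Aubin and Nitsche. -/
theorem IsRitz.norm0_le {k N : ℕ} (hk : 1 ≤ k) (hN : 1 ≤ N) {w R : ℝ → ℝ} (h : IsRitz k N w R)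
    (hw : Lip0 w) : norm0 (fun r => w r - R r) ≤ 4 / N * normHr (fun r => w r - R r) := by
  have hR := FESpace.lip0 hN h.mem
  set ρ : ℝ → ℝ := fun r => w r - R r with hρ
  have hρL : Lip0 ρ := hw.sub hR
  -- The dual datum is the error ρ itself; orthogonality to χ then leaves only the interpolation
  -- error of the dual solution, which supplies the factor 4/N.
  obtain ⟨φ, z, hd⟩ := exists_isDualSolution hρL.continuousOn
  obtain ⟨χ, hχ, hχn⟩ := hd.exists_interpolant hρL.continuousOn hk hN
  have hχL := FESpace.lip0 hN hχ
  have e0 : innerH χ ρ = 0 := by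
    rw [innerH_comm, hρ, innerH_sub_left hw hR hχL, h.eq _ hχ, sub_self]
  have e1 : inner0 ρ ρ = innerH (fun r => r * φ r - χ r) ρ := by
    rw [innerH_sub_left hd.lip0 hχL hρL, e0, sub_zero, hd.innerH_eq hρL.continuousOn hρL]
  have h1 := le_of_abs_le (abs_innerH_le (hd.lip0.sub hχL) hρL)
  rw [← e1, ← norm0_sq] at h1
  have h2 := norm0_nonneg ρ
  have h3 := normHr_nonneg ρ
  have h4 : norm0 ρ ^ 2 ≤ 4 / N * norm0 ρ * normHr ρ := h1.trans (by gcongr)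
  rcases h2.eq_or_lt with h5 | h5
  · rw [← h5]; positivity
  · refine le_of_mul_le_mul_left ?_ h5
    calc norm0 ρ * norm0 ρ = norm0 ρ ^ 2 := by ring
      _ ≤ _ := h4
      _ = _ := by ring

/-- Discrete solutions with a right-hand side in `L²` grow at most like `√r` at the origin. -/
theorem exists_abs_le_sqrt (k : ℕ) (hk : 1 ≤ k) : ∃ C : ℝ, 0 < C ∧ ∀ N : ℕ, 1 ≤ N →
    ∀ U ∈ FESpace k N, ∀ g ∈ FESpace k N, (∀ v ∈ FESpace k N, innerH U v = inner0 g v) →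
      ∀ r ∈ I, |U r| ≤ C * norm0 g * √r := by
  obtain ⟨C, hC0, hC⟩ := exists_derivative_sq_le k
  refine ⟨5 * (1 + √C), by positivity, fun N hN U hU g hg hUg r hr => ?_⟩
  have hN' : (0 : ℝ) < N := by exact_mod_cast hN
  have hgL := FESpace.lip0 hN hg
  have hUL := FESpace.lip0 hN hU
  set d : ℝ := 1 / N with hd
  have hpos : 0 < d := by positivity
  have hd1 : d ≤ 1 := by
    rw [hd, div_le_one hN']
    exact_mod_cast hN
  have hdsq : d ≤ √d := Real.le_sqrt_of_sq_le (by nlinarith)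
  obtain ⟨φ, z, hds⟩ := exists_isDualSolution hgL.continuousOn
  -- U is the Ritz projection of the continuous solution with the same datum, so the √r bound
  -- carries over up to 4d‖g‖. For r ≥ d this is harmless because d ≤ √r.
  have hR : IsRitz k N (fun r => r * φ r) U := ⟨hU, fun v hv => by
    rw [hUg v hv, hds.innerH_eq hgL.continuousOn (FESpace.lip0 hN hv)]⟩
  obtain ⟨χ, hχ, hχn⟩ := hds.exists_interpolant hgL.continuousOn hk hN
  have hn := (hR.normHr_le hN hds.lip0 hχ).trans hχn
  have hg0 := norm0_nonneg g
  have hC' := Real.sqrt_nonneg C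
  have hb : ∀ s ∈ I, |U s| ≤ norm0 g * √s + 4 * d * norm0 g := fun s hs => by
    have h1 := hds.abs_le_sqrt hs
    have h2 := ((hds.lip0.sub hUL).abs_le_normHr hs).trans hn
    have h3 := abs_sub_abs_le_abs_sub (U s) (s * φ s)
    rw [abs_sub_comm] at h3
    have h4 : 4 / (N : ℝ) * norm0 g = 4 * d * norm0 g := by rw [hd]; ring
    linarith
  rcases le_total d r with hdr | hdr
  · have h1 := hb r hr
    have h2 : d ≤ √r := hdsq.trans (Real.sqrt_le_sqrt hdr)
    calc |U r| ≤ norm0 g * √r + 4 * √r * norm0 g := h1.trans (by gcongr)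
      _ = 5 * 1 * norm0 g * √r := by ring
      _ ≤ _ := by gcongr; linarith
  -- On the first element U is a polynomial of size √d vanishing at 0. Its slope is O(d^{-1/2}), and
  -- r d^{-1/2} ≤ √r for r ≤ d.
  · obtain ⟨p, hp, hpU⟩ := hU.2.2.2 0 (by omega)
    simp only [CharP.cast_eq_zero, zero_div, zero_add, ← hd] at hpU
    have hsup : ∀ s ∈ I, p.eval (0 + d * s) ^ 2 * s ≤ (5 * norm0 g * √d) ^ 2 := fun s hs => by
      have hds' : d * s ≤ d := mul_le_of_le_one_right hpos.le hs.2
      have hds0 : 0 ≤ d * s := mul_nonneg hpos.le hs.1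
      rw [zero_add, ← hpU (d * s) ⟨hds0, hds'⟩]
      have h1 := hb (d * s) ⟨hds0, hds'.trans hd1⟩
      have h2 : |U (d * s)| ≤ 5 * norm0 g * √d := by
        calc _ ≤ norm0 g * √d + 4 * √d * norm0 g := h1.trans (by gcongr)
          _ = _ := by ring
      have h3 := pow_le_pow_left₀ (abs_nonneg _) h2 2
      rw [sq_abs] at h3
      exact (mul_le_of_le_one_right (sq_nonneg _) hs.2).trans h3
    have hint : ∫ s in (0 : ℝ)..1, p.eval (0 + d * s) ^ 2 * s ≤ (5 * norm0 g * √d) ^ 2 := by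
      have := intervalIntegral.integral_mono_on (zero_le_one' ℝ)
        (Continuous.intervalIntegrable (by have := p.continuous; fun_prop) _ _)
        (intervalIntegrable_const (μ := volume)) hsup
      simpa using this
    have hder : ∀ s ∈ Icc 0 d, |p.derivative.eval s| ≤ √C * (5 * norm0 g * √d) / d := fun s hs => by
      have h1 := derivative_sq_le_of_element hC hpos 0 hp (r := s) (by rwa [zero_add])
      rw [le_div_iff₀ hpos]
      rw [← abs_of_pos hpos, ← abs_mul, abs_of_pos hpos]
      refine abs_le_of_sq_le_sq ?_ (by positivity)
      calc (p.derivative.eval s * d) ^ 2 = d ^ 2 * p.derivative.eval s ^ 2 := by ring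
        _ ≤ C * (5 * norm0 g * √d) ^ 2 := h1.trans (by gcongr)
        _ = _ := by rw [mul_pow √C, Real.sq_sqrt hC0.le]
    have hp0 : p.eval 0 = 0 := by rw [← hpU 0 ⟨le_rfl, hpos.le⟩, hU.2.1]
    have hm := Convex.norm_image_sub_le_of_norm_hasDerivWithin_le (𝕜 := ℝ) (s := Icc 0 d)
      (fun s _ => (p.hasDerivAt s).hasDerivWithinAt) hder (convex_Icc 0 d)
      (x := 0) (y := r) ⟨le_rfl, hpos.le⟩ ⟨hr.1, hdr⟩
    rw [hp0, sub_zero, sub_zero, ← hpU r ⟨hr.1, hdr⟩, Real.norm_of_nonneg hr.1, Real.norm_eq_abs]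
      at hm
    have hrd : √d / d * r ≤ √r := by
      have h1 : √r ≤ √d := Real.sqrt_le_sqrt hdr
      have h2 : √d * √d = d := Real.mul_self_sqrt hpos.le
      have h3 : √r * √r = r := Real.mul_self_sqrt hr.1
      rw [div_mul_eq_mul_div, div_le_iff₀ hpos]
      nlinarith [Real.sqrt_nonneg r, Real.sqrt_nonneg d,
        mul_nonneg (mul_nonneg (Real.sqrt_nonneg r) (Real.sqrt_nonneg d)) (sub_nonneg.2 h1)]
    calc |U r| ≤ _ := hm
      _ = 5 * √C * norm0 g * (√d / d * r) := by ring
      _ ≤ 5 * √C * norm0 g * √r := by gcongr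
      _ ≤ _ := by gcongr; linarith

/-! ### Discrete evolution equations in diagonal form -/

/-- The Euclidean norm of a finite family of reals. -/
noncomputable def vnorm {ι : Type*} [Fintype ι] (c : ι → ℝ) : ℝ := √(∑ i, c i ^ 2)

section vnorm

theorem vnorm_eq {ι : Type*} [Fintype ι] (c : ι → ℝ) : vnorm c = ‖(WithLp.toLp 2 c : EuclideanSpace ℝ ι)‖ := by
  simp [vnorm, EuclideanSpace.norm_eq]

theorem vnorm_nonneg {ι : Type*} [Fintype ι] (c : ι → ℝ) : 0 ≤ vnorm c := Real.sqrt_nonneg _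

theorem vnorm_sq {ι : Type*} [Fintype ι] (c : ι → ℝ) : vnorm c ^ 2 = ∑ i, c i ^ 2 :=
  Real.sq_sqrt (Finset.sum_nonneg fun _ _ => sq_nonneg _)

theorem vnorm_add_le {ι : Type*} [Fintype ι] (c d : ι → ℝ) : vnorm (fun i => c i + d i) ≤ vnorm c + vnorm d := by
  simp only [vnorm_eq]
  exact norm_add_le (WithLp.toLp 2 c : EuclideanSpace ℝ ι) (WithLp.toLp 2 d)

theorem vnorm_mul_le {ι : Type*} [Fintype ι] (c : ι → ℝ) {a : ι → ℝ} {A : ℝ} (hA : 0 ≤ A) (ha : ∀ i, |a i| ≤ A) :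
    vnorm (fun i => a i * c i) ≤ A * vnorm c := by
  refine Real.sqrt_le_iff.2 ⟨mul_nonneg hA (vnorm_nonneg c), ?_⟩
  rw [mul_pow, vnorm_sq, Finset.mul_sum]
  refine Finset.sum_le_sum fun i _ => ?_
  rw [mul_pow]
  exact mul_le_mul_of_nonneg_right (sq_le_sq' (by linarith [neg_abs_le (a i), ha i])
    (le_of_abs_le (ha i))) (sq_nonneg _)

theorem vnorm_zero {ι : Type*} [Fintype ι] : vnorm (fun _ : ι => (0 : ℝ)) = 0 := by
  simp [vnorm]

theorem vnorm_sum_le {ι κ : Type*} [Fintype ι] (s : Finset κ) (f : κ → ι → ℝ) :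
    vnorm (fun i => ∑ j ∈ s, f j i) ≤ ∑ j ∈ s, vnorm (f j) := by
  classical
  induction s using Finset.induction_on with
  | empty => simp [vnorm_zero]
  | insert a s ha ih =>
    simp only [Finset.sum_insert ha]
    exact (vnorm_add_le _ _).trans (by linarith)

end vnorm

/-- Energy estimate: `L²` forcing controls the energy norm. -/
theorem energy_estimate {ι : Type*} [Fintype ι] {l : ι → ℝ} (hl : ∀ i, 0 ≤ l i) {τ Q : ℝ}
    (hτ : 0 < τ) {θ d : ℕ → ι → ℝ} (h0 : ∀ i, θ 0 i = 0) (n : ℕ)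
    (h : ∀ j < n, ∀ i, θ (j + 1) i - θ j i + τ * l i * θ (j + 1) i = τ * d j i)
    (hd : ∀ j < n, vnorm (d j) ≤ Q) :
    ∑ i, l i * θ n i ^ 2 ≤ n * τ * Q ^ 2 := by
  induction n with
  | zero => simp [h0]
  | succ n ih =>
    have h1 := ih (fun j hj => h j (by omega)) fun j hj => hd j (by omega)
    have h2 : ∀ i, l i * θ (n + 1) i ^ 2 ≤ l i * θ n i ^ 2 + τ * d n i ^ 2 := by
      intro i
      have e := h n (by omega) i
      set x := θ (n + 1) i
      set y := θ n i
      set w := d n i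
      -- The equation multiplied by the increment; the quadratic term in the increment absorbs the
      -- forcing.
      have e1 : l i * x * (x - y) = (x - y) * w - (x - y) ^ 2 / τ := by
        field_simp
        linear_combination (x - y) * e
      have e2 : (x - y) * w - (x - y) ^ 2 / τ ≤ τ * w ^ 2 / 4 := by
        have : 0 ≤ ((x - y) / τ - w / 2) ^ 2 * τ := by positivity
        have e3 : ((x - y) / τ - w / 2) ^ 2 * τ = (x - y) ^ 2 / τ - (x - y) * w + τ * w ^ 2 / 4 := by
          field_simp
          ring
        linarith
      have e4 : l i * x ^ 2 - l i * y ^ 2 ≤ 2 * (l i * x * (x - y)) := by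
        nlinarith [mul_nonneg (hl i) (sq_nonneg (x - y))]
      have : 0 ≤ τ * w ^ 2 := by positivity
      linarith
    have h3 := Finset.sum_le_sum fun i (_ : i ∈ Finset.univ) => h2 i
    rw [Finset.sum_add_distrib, ← Finset.mul_sum, ← vnorm_sq] at h3
    have h4 := pow_le_pow_left₀ (vnorm_nonneg _) (hd n (by omega)) 2
    push_cast
    nlinarith

/-- Contraction and dissipation estimate. -/
theorem dissipation_estimate {ι : Type*} [Fintype ι] {l : ι → ℝ} (hl : ∀ i, 0 ≤ l i)
    {τ Y G : ℝ} (hτ : 0 < τ) (hG : 0 ≤ G) {y δ : ℕ → ι → ℝ} (h0 : vnorm (y 0) ≤ Y) (n : ℕ)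
    (h : ∀ j < n, ∀ i, y (j + 1) i - y j i + τ * l i * y (j + 1) i = δ j i)
    (hδ : ∀ j < n, vnorm (δ j) ≤ τ * G) :
    vnorm (y n) ≤ Y + n * τ * G ∧
      ∑ j ∈ Finset.range n, τ * ∑ i, l i * y (j + 1) i ^ 2
        ≤ ((Y + n * τ * G) ^ 2 - vnorm (y n) ^ 2) / 2 := by
  induction n with
  | zero =>
    have := pow_le_pow_left₀ (vnorm_nonneg _) h0 2
    refine ⟨by simpa using h0, ?_⟩
    simp only [Finset.range_zero, Finset.sum_empty, CharP.cast_eq_zero, zero_mul, add_zero]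
    linarith
  | succ n ih =>
    obtain ⟨h1, h2⟩ := ih (fun j hj => h j (by omega)) fun j hj => hδ j (by omega)
    have h3 := (vnorm_add_le (y n) (δ n)).trans (add_le_add_right (hδ n (by omega)) _)
    -- The step reads y + δ = (1 + τl)y'; squaring and dropping (τly')² yields contraction and
    -- dissipation together.
    have h4 : ∀ i, τ * (l i * y (n + 1) i ^ 2) ≤ ((y n i + δ n i) ^ 2 - y (n + 1) i ^ 2) / 2 := by
      intro i
      have e := h n (by omega) i
      have : y n i + δ n i = y (n + 1) i + τ * l i * y (n + 1) i := by linarith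
      rw [this]
      have : 0 ≤ (τ * l i * y (n + 1) i) ^ 2 := sq_nonneg _
      nlinarith
    have h5 := Finset.sum_le_sum fun i (_ : i ∈ Finset.univ) => h4 i
    rw [← Finset.mul_sum, ← Finset.sum_div, Finset.sum_sub_distrib, ← vnorm_sq, ← vnorm_sq] at h5
    have h6 : 0 ≤ τ * ∑ i, l i * y (n + 1) i ^ 2 :=
      mul_nonneg hτ.le (Finset.sum_nonneg fun i _ => mul_nonneg (hl i) (sq_nonneg _))
    have h7 := pow_le_pow_left₀ (vnorm_nonneg _) h3 2
    have h8 : vnorm (y (n + 1)) ≤ vnorm (y n) + τ * G :=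
      le_of_sq_le_sq (by linarith) (add_nonneg (vnorm_nonneg _) (mul_nonneg hτ.le hG)) 
    push_cast
    refine ⟨by linarith, ?_⟩
    rw [Finset.sum_range_succ]
    have h9 : 0 ≤ τ * G := mul_nonneg hτ.le hG
    nlinarith

/-- The left side is the kernel produced by summation by parts. From (1 + x)^{m+2} ≥ (1 + (m+1)x/2)²
it is bounded by a quantity increasing in l, so l may be replaced by L, and the result is dominated
by a telescoping difference. The sum over m is therefore at most 4√L, independently of τ and of the
number of steps. -/
theorem smoothing_coefficient {l L τ : ℝ} (hl : 0 ≤ l) (hL : l ≤ L) (hτ : 0 < τ) (m : ℕ) :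
    √l * (τ * l * (1 / (1 + τ * l)) ^ (m + 2))
      ≤ 4 * √L * (1 / √(1 + m * (τ * L) / 2) - 1 / √(1 + (m + 1) * (τ * L) / 2)) := by
  have hL0 : 0 ≤ L := hl.trans hL
  set M : ℝ := (m : ℝ) + 1 with hM
  have hM1 : 1 ≤ M := by rw [hM]; linarith [Nat.cast_nonneg (α := ℝ) m]
  have hx : 0 ≤ τ * l := by positivity
  have step1 : (1 + M * (τ * l) / 2) ^ 2 ≤ (1 + τ * l) ^ (m + 2) := by
    rw [hM]
    generalize τ * l = x at hx
    clear hM hM1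
    induction m with
    | zero => simp only [CharP.cast_eq_zero, zero_add]; nlinarith
    | succ m ih =>
      rw [show m + 1 + 2 = (m + 2) + 1 by ring, pow_succ]
      refine le_trans ?_ (mul_le_mul_of_nonneg_right (ih) (by linarith))
      push_cast
      have hm : (0 : ℝ) ≤ m := Nat.cast_nonneg m
      have : 0 ≤ x * (m * x) := by positivity
      have : 0 ≤ x * ((m * x) * (m * x)) := by positivity
      have : 0 ≤ x * (x * (m * x)) := by positivity
      nlinarith [sq_nonneg x, mul_nonneg hx (sq_nonneg x)]
  set q : ℝ := √(1 + M * (τ * L) / 2) with hq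
  set p : ℝ := √(1 + m * (τ * L) / 2) with hp
  have hX : 0 ≤ τ * L := by positivity
  have hq2 : q ^ 2 = 1 + M * (τ * L) / 2 := Real.sq_sqrt (by positivity)
  have hp2 : p ^ 2 = 1 + m * (τ * L) / 2 := Real.sq_sqrt (by positivity)
  have hq0 : 0 < q := Real.sqrt_pos.2 (by positivity)
  have hp0 : 0 < p := Real.sqrt_pos.2 (by positivity)
  have hpq : p ≤ q := Real.sqrt_le_sqrt (by rw [hM]; nlinarith)
  have step2 : τ * L / q ^ 3 ≤ 4 * (1 / p - 1 / q) := by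
    have e : 1 / p - 1 / q = (τ * L / 2) / (p * q * (p + q)) := by
      have : q ^ 2 - p ^ 2 = τ * L / 2 := by rw [hq2, hp2, hM]; ring
      rw [← this]
      field_simp
      ring
    rw [e, ← mul_div_assoc, div_le_div_iff₀ (by positivity) (by positivity)]
    have h1 : p * q * (p + q) ≤ 2 * q ^ 3 := by
      calc _ ≤ q * q * (q + q) := by gcongr
        _ = _ := by ring
    nlinarith
  have step3 : √l * (τ * l / (1 + M * (τ * l) / 2) ^ 2) ≤ √L * (τ * L / q ^ 3) := by
    refine le_of_sq_le_sq ?_ (by positivity)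
    rw [mul_pow, mul_pow, Real.sq_sqrt hl, Real.sq_sqrt hL0, div_pow, div_pow,
      show (q ^ 3) ^ 2 = (q ^ 2) ^ 3 by ring, hq2]
    have h1 : l / (1 + M * (τ * l) / 2) ≤ L / (1 + M * (τ * L) / 2) := by
      rw [div_le_div_iff₀ (by positivity) (by positivity)]
      nlinarith
    have h2 := pow_le_pow_left₀ (by positivity) h1 3
    rw [div_pow, div_pow] at h2
    have h3 : (1 + M * (τ * l) / 2) ^ 3 ≤ ((1 + M * (τ * l) / 2) ^ 2) ^ 2 := by
      rw [← pow_mul]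
      exact pow_le_pow_right₀ (by linarith [show 0 ≤ M * (τ * l) / 2 by positivity]) (by norm_num)
    calc l * ((τ * l) ^ 2 / ((1 + M * (τ * l) / 2) ^ 2) ^ 2)
        ≤ l * ((τ * l) ^ 2 / (1 + M * (τ * l) / 2) ^ 3) := by gcongr
      _ = τ ^ 2 * (l ^ 3 / (1 + M * (τ * l) / 2) ^ 3) := by ring
      _ ≤ τ ^ 2 * (L ^ 3 / (1 + M * (τ * L) / 2) ^ 3) := by gcongr
      _ = _ := by ring
  calc √l * (τ * l * (1 / (1 + τ * l)) ^ (m + 2)) = √l * (τ * l / (1 + τ * l) ^ (m + 2)) := by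
        rw [one_div, inv_pow]; rfl
    _ ≤ √l * (τ * l / (1 + M * (τ * l) / 2) ^ 2) := by gcongr
    _ ≤ √L * (τ * L / q ^ 3) := step3
    _ ≤ √L * (4 * (1 / p - 1 / q)) := by gcongr
    _ = _ := by ring

/-- Summation by parts in θ_{n+1} = Σ s^{n+1-j}(q_{j+1} - q_j) with s = 1/(1 + τx), using s^{m+1} -
s^{m+2} = τx s^{m+2}. -/
theorem duhamel_formula {x τ : ℝ} (hx : 1 + τ * x ≠ 0) {θ q : ℕ → ℝ} (h0 : θ 0 = 0) (n : ℕ)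
    (h : ∀ j ≤ n, θ (j + 1) - θ j + τ * x * θ (j + 1) = q (j + 1) - q j) :
    θ (n + 1) = 1 / (1 + τ * x) * q (n + 1) - (1 / (1 + τ * x)) ^ (n + 1) * q 0
      - ∑ j ∈ Finset.range n, τ * x * (1 / (1 + τ * x)) ^ (n - 1 - j + 2) * q (j + 1) := by
  set s := 1 / (1 + τ * x) with hs
  have hs1 : s * (1 + τ * x) = 1 := by rw [hs]; field_simp
  have hstep : ∀ j ≤ n, θ (j + 1) = s * (θ j + q (j + 1) - q j) := fun j hj => by
    have := h j hj
    linear_combination (-θ (j + 1)) * hs1 + s * this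
  induction n with
  | zero =>
    rw [hstep 0 le_rfl, h0]
    simp
    ring
  | succ n ih =>
    rw [hstep (n + 1) le_rfl, ih (fun j hj => h j (by omega)) fun j hj => hstep j (by omega),
      Finset.sum_range_succ]
    have e : ∑ j ∈ Finset.range n, τ * x * s ^ (n + 1 - 1 - j + 2) * q (j + 1)
        = s * ∑ j ∈ Finset.range n, τ * x * s ^ (n - 1 - j + 2) * q (j + 1) := by
      rw [Finset.mul_sum]
      refine Finset.sum_congr rfl fun j hj => ?_
      have hj := Finset.mem_range.1 hj
      rw [show n + 1 - 1 - j + 2 = (n - 1 - j + 2) + 1 by omega]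
      ring
    rw [e, show n + 1 - 1 - n + 2 = 2 by omega]
    linear_combination (s * q (n + 1)) * hs1

/-- Smoothing estimate for the implicit Euler scheme: a forcing that is a time difference of an
`L²` bounded quantity, when the operator is bounded by `L`. -/
theorem smoothing_estimate {ι : Type*} [Fintype ι] {l : ι → ℝ} (hl : ∀ i, 0 ≤ l i) {L τ Q : ℝ}
    (hL : ∀ i, l i ≤ L) (hL0 : 0 ≤ L) (hτ : 0 < τ) (hQ0 : 0 ≤ Q) {θ q : ℕ → ι → ℝ} (h0 : ∀ i, θ 0 i = 0) (n : ℕ)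
    (h : ∀ j < n, ∀ i, θ (j + 1) i - θ j i + τ * l i * θ (j + 1) i = q (j + 1) i - q j i)
    (hq : ∀ j ≤ n, vnorm (q j) ≤ Q) :
    ∑ i, l i * θ n i ^ 2 ≤ 36 * L * Q ^ 2 := by
  rcases Nat.eq_zero_or_pos n with rfl | hn
  · simp only [h0]
    simp
    positivity
  obtain ⟨n, rfl⟩ : ∃ m, n = m + 1 := ⟨n - 1, by omega⟩
  set s : ι → ℝ := fun i => 1 / (1 + τ * l i) with hs
  have hs0 : ∀ i, 0 ≤ s i := fun i => by
    have := hl i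
    positivity
  have hs1 : ∀ i, s i ≤ 1 := fun i => by
    have := mul_nonneg hτ.le (hl i)
    exact (div_le_one (by linarith)).2 (by linarith)
  have hsl : ∀ i, √(l i) ≤ √L := fun i => Real.sqrt_le_sqrt (hL i)
  have hpow : ∀ i m, |√(l i) * s i ^ m| ≤ √L := fun i m => by
    rw [abs_of_nonneg (mul_nonneg (Real.sqrt_nonneg _) (pow_nonneg (hs0 i) _))]
    exact (mul_le_of_le_one_right (Real.sqrt_nonneg _) (pow_le_one₀ (hs0 i) (hs1 i))).trans (hsl i)
  set a : ℕ → ℝ := fun m => 1 / √(1 + m * (τ * L) / 2) with ha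
  have hθ : ∀ i, √(l i) * θ (n + 1) i = (√(l i) * s i ^ 1 * q (n + 1) i
      + -(√(l i) * s i ^ (n + 1)) * q 0 i)
      + ∑ j ∈ Finset.range n, -(√(l i) * (τ * l i * s i ^ (n - 1 - j + 2))) * q (j + 1) i := by
    intro i
    have h1 : 1 + τ * l i ≠ 0 := by
      have := mul_nonneg hτ.le (hl i)
      linarith
    have := duhamel_formula h1 (θ := fun j => θ j i) (q := fun j => q j i) (h0 i) n
      (fun j hj => h j (by omega) i)
    rw [this]
    simp only [neg_mul, Finset.sum_neg_distrib, mul_assoc, ← Finset.mul_sum]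
    simp only [hs]
    ring
  have hL' := Real.sqrt_nonneg L
  have hterm : ∀ j ∈ Finset.range n,
      vnorm (fun i => -(√(l i) * (τ * l i * s i ^ (n - 1 - j + 2))) * q (j + 1) i)
        ≤ 4 * √L * (a (n - 1 - j) - a (n - 1 - j + 1)) * Q := by
    intro j hj
    have hj := Finset.mem_range.1 hj
    have hc : ∀ i, |-(√(l i) * (τ * l i * s i ^ (n - 1 - j + 2)))|
        ≤ 4 * √L * (a (n - 1 - j) - a (n - 1 - j + 1)) := by
      intro i
      have := mul_nonneg hτ.le (hl i)
      rw [abs_neg, abs_of_nonneg (mul_nonneg (Real.sqrt_nonneg _)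
        (mul_nonneg this (pow_nonneg (hs0 i) _)))]
      have := smoothing_coefficient (hl i) (hL i) hτ (n - 1 - j)
      simpa only [ha, Nat.cast_add, Nat.cast_one] using this
    have hnn : 0 ≤ 4 * √L * (a (n - 1 - j) - a (n - 1 - j + 1)) := by
      have : a (n - 1 - j + 1) ≤ a (n - 1 - j) := by
        simp only [ha]
        have := mul_nonneg hτ.le hL0
        gcongr
        linarith
      exact mul_nonneg (by positivity) (by linarith)
    exact (vnorm_mul_le _ hnn hc).trans (mul_le_mul_of_nonneg_left (hq _ (by omega)) hnn)
  have hsum : ∑ j ∈ Finset.range n, 4 * √L * (a (n - 1 - j) - a (n - 1 - j + 1)) * Q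
      ≤ 4 * √L * Q := by
    rw [← Finset.sum_mul, ← Finset.mul_sum,
      Finset.sum_range_reflect (fun m => a m - a (m + 1)) n, Finset.sum_range_sub' a n]
    have h1 : a 0 = 1 := by simp [ha]
    have h2 : 0 ≤ a n := by simp only [ha]; positivity
    have h3 : 0 ≤ 4 * √L * Q := by positivity
    rw [h1]
    nlinarith
  -- Each boundary term contributes √L Q and the telescoping sum 4√L Q; hence 36 = 6².
  have hv : vnorm (fun i => √(l i) * θ (n + 1) i) ≤ 6 * √L * Q := by
    simp only [hθ]
    refine (vnorm_add_le _ _).trans ?_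
    have e1 := vnorm_add_le (fun i => √(l i) * s i ^ 1 * q (n + 1) i)
      (fun i => -(√(l i) * s i ^ (n + 1)) * q 0 i)
    have e2 := (vnorm_mul_le (q (n + 1)) hL' fun i => hpow i 1).trans
      (mul_le_mul_of_nonneg_left (hq _ le_rfl) hL')
    have e3 := (vnorm_mul_le (q 0) (a := fun i => -(√(l i) * s i ^ (n + 1))) hL'
      fun i => by rw [abs_neg]; exact hpow i (n + 1)).trans
      (mul_le_mul_of_nonneg_left (hq _ (by omega)) hL')
    have e4 := (vnorm_sum_le (Finset.range n)
      fun j i => -(√(l i) * (τ * l i * s i ^ (n - 1 - j + 2))) * q (j + 1) i).trans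
      ((Finset.sum_le_sum hterm).trans hsum)
    linarith
  have := pow_le_pow_left₀ (vnorm_nonneg _) hv 2
  rw [vnorm_sq, mul_pow, mul_pow, Real.sq_sqrt hL0] at this
  simp only [mul_pow, Real.sq_sqrt (hl _)] at this
  linarith

/-! ### Properties of the exact solution -/

theorem normL2_nonneg (v : ℝ → ℝ) : 0 ≤ normL2 v := Real.sqrt_nonneg _

theorem normH_nonneg (m : ℕ) (v : ℝ → ℝ) : 0 ≤ normH m v := Real.sqrt_nonneg _

theorem normWInf_nonneg (m : ℕ) (v : ℝ → ℝ) : 0 ≤ normWInf m v :=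
  Finset.sum_nonneg fun _ _ => ENNReal.toReal_nonneg

theorem normL2_sq (v : ℝ → ℝ) : normL2 v ^ 2 = ∫ r in (0 : ℝ)..1, v r ^ 2 :=
  Real.sq_sqrt (intervalIntegral.integral_nonneg zero_le_one fun _ _ => sq_nonneg _)

theorem normL2_le_normH (m : ℕ) (v : ℝ → ℝ) : normL2 v ≤ normH m v := by
  refine Real.le_sqrt_of_sq_le ?_
  have := Finset.single_le_sum (f := fun i => normL2 (Dn i v) ^ 2) (fun _ _ => sq_nonneg _)
    (Finset.mem_range.2 (Nat.succ_pos m))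
  simpa only [Dn_zero] using this

theorem norm0_le_of_integral_sq_le {v : ℝ → ℝ} {B : ℝ} (hv : IsBdd v) (hB : 0 ≤ B)
    (h : ∫ r, v r ^ 2 ∂volI ≤ B ^ 2) : norm0 v ≤ B := by
  refine Real.sqrt_le_iff.2 ⟨hB, le_trans ?_ h⟩
  rw [inner0_eq]
  refine integral_mono_ae (hv.integrable_mul hv) (by simpa only [sq] using (hv.mul hv).integrable) ?_
  filter_upwards [ae_Ioo] with r hr
  have := mul_le_of_le_one_right (mul_self_nonneg (v r)) hr.2.le
  simpa only [sq] using this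

theorem norm0_le_normL2 {v : ℝ → ℝ} (hv : IsBdd v) : norm0 v ≤ normL2 v :=
  norm0_le_of_integral_sq_le hv (normL2_nonneg v) (by rw [normL2_sq, integral_eq_volI])

theorem ae_abs_Dn_le_of_normWInf {m : ℕ} {v : ℝ → ℝ} (hv : MemSobolev ⊤ m v) {i : ℕ} (hi : i ≤ m) :
    ∀ᵐ r ∂volI, |Dn i v r| ≤ normWInf m v := by
  have h1 : (eLpNorm (Dn i v) ⊤ volI).toReal ≤ normWInf m v :=
    Finset.single_le_sum (f := fun i => (eLpNorm (Dn i v) ⊤ volI).toReal)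
      (fun _ _ => ENNReal.toReal_nonneg) (Finset.mem_range.2 (Nat.lt_succ_of_le hi))
  have h := (hv.2 i hi).2
  rw [eLpNorm_exponent_top] at h h1
  filter_upwards [ae_le_eLpNormEssSup (f := Dn i v) (μ := volI)] with r hr
  have := ENNReal.toReal_mono h.ne hr
  simp only [toReal_enorm, Real.norm_eq_abs] at this
  exact this.trans h1

/-- The elliptic operator `-(v'' + v'/r - v/r²)`. -/
noncomputable def ellOp (v : ℝ → ℝ) (r : ℝ) : ℝ := (v r / r - D v r) / r - D (D v) r

/-- Since v(0) = 0 and v' is Lipschitz, v(r) - rv'(r) is the integral of v'(s) - v'(r) over [0,r],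
hence at most Mr². The two singular terms thus cancel to a bounded function, and the Lipschitz flux
rv' allows integration by parts. -/
theorem ellOp_props {v : ℝ → ℝ} {M : ℝ} (hM : 0 ≤ M) (hv : MemSobolev ⊤ 2 v) (h0 : v 0 = 0)
    (h1 : v 1 = 0) (hb : ∀ i ≤ 2, ∀ᵐ r ∂volI, |Dn i v r| ≤ M) :
    IsBdd (ellOp v) ∧ norm0 (ellOp v) ≤ 2 * M ∧
      ∀ w, Lip0 w → innerH v w = inner0 (ellOp v) w := by
  have hac0 := hv.1 0 (by omega)
  have hac1 := hv.1 1 (by omega)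
  have hb1 := hb 1 (by omega)
  have hb2 := hb 2 le_rfl
  rw [Dn_zero] at hac0
  rw [Dn_one] at hac1 hb1
  rw [Dn_succ, Dn_one] at hb2
  have hvL : Lip0 v := ⟨⟨NNReal.mk M hM, lipschitzOnWith_of_ae_abs_D_le hac0 hb1⟩, h0, h1⟩
  have hDL : LipschitzOnWith (NNReal.mk M hM) (D v) I := lipschitzOnWith_of_ae_abs_D_le hac1 hb2
  have hdiv : ∀ r ∈ Ioo (0 : ℝ) 1, |(v r / r - D v r) / r| ≤ M := by
    intro r hr
    have hrI : r ∈ I := ⟨hr.1.le, hr.2.le⟩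
    have hid : AbsolutelyContinuousOnInterval (fun s : ℝ => s * D v r) 0 1 := by
      refine LipschitzOnWith.absolutelyContinuousOnInterval (K := ‖D v r‖₊) ?_
      refine LipschitzOnWith.of_dist_le_mul fun x _ y _ => ?_
      rw [Real.dist_eq, Real.dist_eq, ← sub_mul, abs_mul, mul_comm]
      rfl
    have h := abs_sub_le_of_ae_abs_D_le (hac0.sub hid) (x := 0) (y := r) ⟨le_rfl, zero_le_one⟩ hrI
      hr.1.le (B := M * r) (by
        filter_upwards [hvL.ae_differentiableAt, ae_Ioo] with s hs hs' hsr
        have e : D (v - fun s => s * D v r) s = D v s - D v r := by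
          rw [D_eq_deriv _ hs', D_eq_deriv v hs']
          exact (hs.hasDerivAt.sub ((hasDerivAt_id s).mul_const (D v r))).deriv.trans (by simp)
        rw [e]
        have := hDL.dist_le_mul s ⟨hs'.1.le, hs'.2.le⟩ r hrI
        rw [Real.dist_eq, Real.dist_eq, NNReal.coe_mk, abs_sub_comm s,
          abs_of_nonneg (sub_nonneg.2 hsr.2)] at this
        refine this.trans (mul_le_mul_of_nonneg_left ?_ hM)
        linarith [hs'.1])
    simp only [Pi.sub_apply, h0, zero_mul, sub_zero] at h
    have hr0 := hr.1
    rw [abs_div, abs_of_pos hr0, div_le_iff₀ hr0, show v r / r - D v r = (v r - r * D v r) / r by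
      field_simp, abs_div, abs_of_pos hr0, div_le_iff₀ hr0]
    exact h
  have hae : ∀ᵐ r ∂volI, |ellOp v r| ≤ 2 * M := by
    filter_upwards [ae_Ioo, hb2] with r hr hr2
    have := abs_sub ((v r / r - D v r) / r) (D (D v) r)
    rw [ellOp]
    linarith [hdiv r hr]
  have hmeas : AEStronglyMeasurable (ellOp v) volI := by
    have h1 := aestronglyMeasurable_div (hvL.bdd_div.sub hvL.bddD).meas 1
    simp only [pow_one] at h1
    exact h1.sub (aestronglyMeasurable_D (D v))
  have hbdd : IsBdd (ellOp v) := IsBdd.of_bound hmeas _ hae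
  refine ⟨hbdd, norm0_le_of_bound (by positivity) hae, fun w hw => ?_⟩
  obtain ⟨B, hB⟩ := isCompact_Icc.exists_bound_of_continuousOn hDL.continuousOn
  have hB0 : 0 ≤ B := (norm_nonneg _).trans (hB 0 ⟨le_rfl, zero_le_one⟩)
  have hp : LipschitzOnWith (NNReal.mk (M + B) (add_nonneg hM hB0)) (fun r => r * D v r) I := by
    refine LipschitzOnWith.of_dist_le_mul fun x hx y hy => ?_
    have h1 := hDL.dist_le_mul x hx y hy
    have h2 := hB y hy
    rw [Real.norm_eq_abs] at h2
    rw [Real.dist_eq, Real.dist_eq, NNReal.coe_mk] at h1 ⊢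
    have e : x * D v x - y * D v y = x * (D v x - D v y) + (x - y) * D v y := by ring
    rw [e]
    refine (abs_add_le _ _).trans ?_
    rw [abs_mul, abs_mul, abs_of_nonneg hx.1, add_mul, mul_comm B]
    refine add_le_add ((mul_le_of_le_one_left (abs_nonneg _) hx.2).trans h1) ?_
    exact mul_le_mul_of_nonneg_left h2 (abs_nonneg _)
  refine innerH_eq_inner0_of_lipschitz hvL hbdd hp (Filter.Eventually.of_forall fun _ => rfl) ?_ hw
  filter_upwards [ae_differentiableAt_of_lipschitzOn hDL, ae_Ioo] with r hd hr
  rw [D_eq_deriv (fun r => r * D v r) hr, ellOp, D_eq_deriv (D v) hr]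
  have := ((hasDerivAt_id r).mul hd.hasDerivAt).deriv
  simp only [id] at this
  have e : deriv (fun r => r * D v r) r = 1 * D v r + r * deriv (D v) r := this
  rw [e]
  have := hr.1.ne'
  field_simp
  ring

/-- Cauchy-Schwarz against the constant 1, in extended form so that time slices of ∂_tt u need not
be known to be square integrable. -/
theorem sq_lintegral_le {α : Type*} [MeasurableSpace α] {μ : Measure α} {f : α → ENNReal}
    (hf : AEMeasurable f μ) : (∫⁻ x, f x ∂μ) ^ 2 ≤ μ univ * ∫⁻ x, f x ^ 2 ∂μ := by
  have h := ENNReal.lintegral_mul_le_Lp_mul_Lq μ Real.HolderConjugate.two_two hf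
    (aemeasurable_const (b := (1 : ENNReal)))
  simp only [Pi.mul_apply, mul_one, ENNReal.rpow_ofNat, one_pow, lintegral_const, one_mul] at h
  have h2 := pow_le_pow_left₀ (zero_le) h 2
  refine h2.trans (le_of_eq ?_)
  rw [mul_pow, ← ENNReal.rpow_natCast, ← ENNReal.rpow_natCast, ← ENNReal.rpow_mul,
    ← ENNReal.rpow_mul]
  norm_num
  rw [mul_comm]

section Regularity

variable {k : ℕ} {T M : ℝ} {u₀ : ℝ → ℝ} {u ut utt : ℝ → ℝ → ℝ}

theorem HasRegularity.normWInf_le (h : HasRegularity k T M u ut utt) {t : ℝ} (ht : t ∈ Icc 0 T) :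
    normWInf (k + 1) (u t) ≤ M := by
  have := h.bound t ht
  have := normH_nonneg 1 (ut t)
  have := normL2_nonneg (utt t)
  linarith

theorem HasRegularity.nonneg (hT : 0 < T) (h : HasRegularity k T M u ut utt) : 0 ≤ M :=
  (normWInf_nonneg _ _).trans (h.normWInf_le (t := 0) ⟨le_rfl, hT.le⟩)

theorem HasRegularity.ae_abs_Dn_le (h : HasRegularity k T M u ut utt) {t : ℝ} (ht : t ∈ Icc 0 T)
    {i : ℕ} (hi : i ≤ k + 1) : ∀ᵐ r ∂volI, |Dn i (u t) r| ≤ M := by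
  filter_upwards [ae_abs_Dn_le_of_normWInf (h.mem_space t ht) hi] with r hr
  exact hr.trans (h.normWInf_le ht)

theorem HasRegularity.lipschitzOnWith (hT : 0 < T) (h : HasRegularity k T M u ut utt) {t : ℝ}
    (ht : t ∈ Icc 0 T) : LipschitzOnWith (NNReal.mk M (h.nonneg hT)) (u t) I := by
  have hac := (h.mem_space t ht).1 0 (by omega)
  have hb := h.ae_abs_Dn_le ht (i := 1) (by omega)
  rw [Dn_zero] at hac
  rw [Dn_one] at hb
  exact lipschitzOnWith_of_ae_abs_D_le hac hb

theorem HasRegularity.lip0 (hT : 0 < T) (hs : IsSolution T u₀ u ut)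
    (h : HasRegularity k T M u ut utt) {t : ℝ} (ht : t ∈ Icc 0 T) : Lip0 (u t) :=
  ⟨⟨_, h.lipschitzOnWith hT ht⟩, (hs.boundary t ht).1, (hs.boundary t ht).2⟩

theorem HasRegularity.abs_le (hT : 0 < T) (hs : IsSolution T u₀ u ut)
    (h : HasRegularity k T M u ut utt) {t : ℝ} (ht : t ∈ Icc 0 T) {r : ℝ} (hr : r ∈ I) :
    |u t r| ≤ M * r :=
  abs_le_mul_of_lipschitzOn (h.lipschitzOnWith hT ht) (hs.boundary t ht).1 hr

theorem HasRegularity.continuousOn_time (h : HasRegularity k T M u ut utt) {t : ℝ}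
    (ht : t ∈ Icc 0 T) : ContinuousOn (ut t) I := by
  have hac := (h.mem_time t ht).1 0 (by omega)
  rw [Dn_zero] at hac
  simpa only [uIcc_of_le (zero_le_one' ℝ)] using hac.continuousOn

theorem HasRegularity.norm0_time_le (h : HasRegularity k T M u ut utt) {t : ℝ}
    (ht : t ∈ Icc 0 T) : norm0 (ut t) ≤ M := by
  have h1 := norm0_le_normL2 (isBdd_of_continuousOn (h.continuousOn_time ht))
  have h2 := normL2_le_normH 1 (ut t)
  have h3 := h.bound t ht
  have h4 := normWInf_nonneg (k + 1) (u t)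
  have h5 := normL2_nonneg (utt t)
  linarith

theorem HasRegularity.ellOp_props (hk : 1 ≤ k) (hT : 0 < T) (hs : IsSolution T u₀ u ut)
    (h : HasRegularity k T M u ut utt) {t : ℝ} (ht : t ∈ Icc 0 T) :
    IsBdd (ellOp (u t)) ∧ norm0 (ellOp (u t)) ≤ 2 * M ∧
      ∀ w, Lip0 w → innerH (u t) w = inner0 (ellOp (u t)) w := by
  have hm := h.mem_space t ht
  exact HeatFlow.ellOp_props (h.nonneg hT) ⟨fun i hi => hm.1 i (by omega),
    fun i hi => hm.2 i (by omega)⟩ (hs.boundary t ht).1 (hs.boundary t ht).2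
    fun i hi => h.ae_abs_Dn_le ht (by omega)

/-- The equation in terms of the elliptic operator. -/
theorem IsSolution.ellOp_eq (hs : IsSolution T u₀ u ut) {t : ℝ} (ht : t ∈ Ioc 0 T) {r : ℝ}
    (hr : r ∈ Ioo (0 : ℝ) 1) : ellOp (u t) r = nonlin (u t r) / r ^ 2 - ut t r := by
  have hD : D (u t) =ᶠ[nhds r] deriv (u t) := by
    filter_upwards [Ioo_mem_nhds hr.1 hr.2] with s hs using D_eq_deriv _ hs
  rw [ellOp, hs.equation t ht r hr, D_eq_deriv _ hr, D_eq_deriv _ hr, hD.deriv_eq, nonlin]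
  have := hr.1.ne'
  field_simp
  ring

/-- The truncation error in time. -/
theorem HasRegularity.norm0_truncation_le (hT : 0 < T) (hs : IsSolution T u₀ u ut)
    (h : HasRegularity k T M u ut utt) {a b : ℝ} (ha : 0 ≤ a) (hab : a < b) (hb : b ≤ T) :
    norm0 (fun r => (u b r - u a r) / (b - a) - ut b r) ≤ (b - a) * M := by
  have hM := h.nonneg hT
  have haT : a ∈ Icc 0 T := ⟨ha, hab.le.trans hb⟩
  have hbT : b ∈ Icc 0 T := ⟨ha.trans hab.le, hb⟩
  have hba : 0 < b - a := sub_pos.2 hab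
  set d : ℝ → ℝ := fun r => (u b r - u a r) / (b - a) - ut b r with hd
  have hdc : ContinuousOn d I := (((h.lip0 hT hs hbT).continuousOn.sub
    (h.lip0 hT hs haT).continuousOn).div_const _).sub (h.continuousOn_time hbT)
  have hdb := isBdd_of_continuousOn hdc
  -- The point ξ depends on r without any measurability; this is harmless, as the difference is then
  -- bounded by an integral of |∂_tt u| over all of [a,b].
  have hmv : ∀ r ∈ I, ∃ ξ ∈ Ioo a b, d r = ut ξ r - ut b r := by
    intro r hr
    have hder : ∀ x ∈ Icc 0 T, HasDerivWithinAt (fun s => u s r) (ut x r) (Icc 0 T) x :=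
      fun x hx => hs.hasDeriv_time x hx r hr
    obtain ⟨ξ, hξ, hξ'⟩ := exists_hasDerivAt_eq_slope (fun s => u s r) (fun s => ut s r) hab
      (fun x hx => ((hder x ⟨ha.trans hx.1, hx.2.trans hb⟩).continuousWithinAt).mono
        (Icc_subset_Icc ha hb))
      (fun x hx => (hder x ⟨ha.trans hx.1.le, hx.2.le.trans hb⟩).hasDerivAt
        (Icc_mem_nhds (ha.trans_lt hx.1) (hx.2.trans_le hb)))
    exact ⟨ξ, hξ, by rw [hd, hξ']⟩
  set ν : Measure ℝ := volume.restrict (Icc a b) with hν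
  obtain ⟨hmeas, hae⟩ := h.isTimeDeriv
  have hsub : Icc a b ⊆ Icc 0 T := Icc_subset_Icc ha hb
  have hprod : AEMeasurable (Function.uncurry fun r x => ‖utt x r‖ₑ ^ 2) (volI.prod ν) := by
    have h1 : AEStronglyMeasurable (Function.uncurry utt) (ν.prod volI) := by
      rw [hν, Measure.prod_restrict]
      exact hmeas.mono_measure (Measure.restrict_mono (Set.prod_mono_left hsub) le_rfl)
    exact (h1.prod_swap.enorm).pow_const 2
  have hptw : ∀ᵐ r ∂volI, ENNReal.ofReal (d r ^ 2)
      ≤ ENNReal.ofReal (b - a) * ∫⁻ x, ‖utt x r‖ₑ ^ 2 ∂ν := by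
    filter_upwards [hae, ae_restrict_mem measurableSet_Icc] with r hr hrI
    obtain ⟨hint, hut⟩ := hr
    obtain ⟨ξ, hξ, hdξ⟩ := hmv r hrI
    have hξT : ξ ∈ Icc 0 T := hsub ⟨hξ.1.le, hξ.2.le⟩
    have hi1 : IntegrableOn (fun s => utt s r) (Icc 0 T) := by
      rw [integrableOn_Icc_iff_integrableOn_Ioc]
      exact (intervalIntegrable_iff_integrableOn_Ioc_of_le hT.le).1 hint
    have hii : ∀ {x y}, x ∈ Icc 0 T → y ∈ Icc 0 T →
        IntervalIntegrable (fun s => utt s r) volume x y := fun hx hy =>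
      (hi1.mono_set (uIcc_subset_Icc hx hy)).intervalIntegrable
    have e1 : d r = -∫ s in ξ..b, utt s r := by
      rw [hdξ, hut ξ hξT, hut b hbT, ← intervalIntegral.integral_interval_sub_left
        (hii ⟨le_rfl, hT.le⟩ hbT) (hii ⟨le_rfl, hT.le⟩ hξT)]
      ring
    have e2 : ENNReal.ofReal (d r ^ 2) = ‖d r‖ₑ ^ 2 := by
      rw [← sq_abs, ENNReal.ofReal_pow (abs_nonneg _), ← Real.norm_eq_abs, ofReal_norm]
    have e3 : ‖d r‖ₑ ≤ ∫⁻ x, ‖utt x r‖ₑ ∂ν := by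
      rw [e1, enorm_neg, intervalIntegral.integral_of_le hξ.2.le]
      refine (enorm_integral_le_lintegral_enorm _).trans ?_
      exact lintegral_mono_set (Ioc_subset_Icc_self.trans (Icc_subset_Icc_left hξ.1.le))
    rw [e2]
    refine (pow_le_pow_left₀ zero_le e3 2).trans ?_
    refine (sq_lintegral_le ((hi1.mono_set hsub).1.enorm)).trans (le_of_eq ?_)
    rw [hν, Measure.restrict_apply_univ, Real.volume_Icc]
  have hslice : ∀ x ∈ Icc a b, ∫⁻ r, ‖utt x r‖ₑ ^ 2 ∂volI ≤ ENNReal.ofReal (M ^ 2) := by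
    intro x hx
    have hxT := hsub hx
    have hL2 := h.mem_time2 x hxT
    have h1 : normL2 (utt x) ≤ M := by
      have h3 := h.bound x hxT
      have h4 := normWInf_nonneg (k + 1) (u x)
      have h5 := normH_nonneg 1 (ut x)
      linarith
    have h2 := pow_le_pow_left₀ (normL2_nonneg _) h1 2
    rw [normL2_sq, integral_eq_volI] at h2
    refine le_trans (le_of_eq ?_) (ENNReal.ofReal_le_ofReal h2)
    rw [ofReal_integral_eq_lintegral_ofReal hL2.integrable_sq
      (Filter.Eventually.of_forall fun _ => sq_nonneg _)]
    refine lintegral_congr fun r => ?_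
    rw [← sq_abs, ENNReal.ofReal_pow (abs_nonneg _), ← Real.norm_eq_abs, ofReal_norm]
  have hfin : ∫⁻ r, ENNReal.ofReal (d r ^ 2) ∂volI ≤ ENNReal.ofReal (((b - a) * M) ^ 2) := by
    -- Tonelli exchanges space and time so that the L² bound at each time applies. One factor b - a
    -- comes from Cauchy-Schwarz, the other from the time integral.
    refine (lintegral_mono_ae hptw).trans ?_
    rw [lintegral_const_mul' _ _ ENNReal.ofReal_ne_top, lintegral_lintegral_swap hprod]
    have h1 : ∫⁻ x, ∫⁻ r, ‖utt x r‖ₑ ^ 2 ∂volI ∂ν ≤ ∫⁻ _, ENNReal.ofReal (M ^ 2) ∂ν := by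
      refine lintegral_mono_ae ?_
      filter_upwards [ae_restrict_mem measurableSet_Icc] with x hx using hslice x hx
    rw [lintegral_const, hν, Measure.restrict_apply_univ, Real.volume_Icc] at h1
    refine (mul_le_mul_right h1 _).trans (le_of_eq ?_)
    rw [← ENNReal.ofReal_mul (sq_nonneg _), ← ENNReal.ofReal_mul hba.le]
    congr 1
    ring
  refine norm0_le_of_integral_sq_le hdb (by positivity) ?_
  rw [← ofReal_integral_eq_lintegral_ofReal (by simpa only [sq] using (hdb.mul hdb).integrable)
      (Filter.Eventually.of_forall fun _ => sq_nonneg _)] at hfin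
  exact (ENNReal.ofReal_le_ofReal_iff (sq_nonneg _)).1 hfin

theorem HasRegularity.norm0_sub_le (hT : 0 < T) (hs : IsSolution T u₀ u ut)
    (h : HasRegularity k T M u ut utt) {a b : ℝ} (ha : 0 ≤ a) (hab : a < b) (hb : b ≤ T) :
    norm0 (fun r => u b r - u a r) ≤ (b - a) * ((1 + T) * M) := by
  have hM := h.nonneg hT
  have haT : a ∈ Icc 0 T := ⟨ha, hab.le.trans hb⟩
  have hbT : b ∈ Icc 0 T := ⟨ha.trans hab.le, hb⟩
  have hba : 0 < b - a := sub_pos.2 hab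
  have h1 := h.norm0_truncation_le hT hs ha hab hb
  have h2 := h.norm0_time_le hbT
  have hb1 : IsBdd fun r => u b r - u a r := (h.lip0 hT hs hbT).bdd.sub (h.lip0 hT hs haT).bdd
  have hut := isBdd_of_continuousOn (h.continuousOn_time hbT)
  have hb2 : IsBdd fun r => (u b r - u a r) / (b - a) - ut b r := by
    have := (hb1.const_mul (1 / (b - a))).sub hut
    simpa only [one_div_mul_eq_div] using this
  have h3 := norm0_add_le hb2 hut
  have e : norm0 (fun r => u b r - u a r)
      = (b - a) * norm0 (fun r => (u b r - u a r) / (b - a) - ut b r + ut b r) := by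
    rw [← abs_of_pos hba, ← norm0_smul, abs_of_pos hba]
    congr 1
    ext r
    field_simp
    ring
  rw [e]
  refine mul_le_mul_of_nonneg_left ?_ hba.le
  have : (b - a) * M ≤ T * M := mul_le_mul_of_nonneg_right (by linarith) hM
  linarith

end Regularity

/-! ### Discrete eigenfunctions -/

/-- The functions `b i` form an `L²_r`-orthonormal basis of the finite element space which is
orthogonal in `H^1_r`. -/
structure IsEigenbasis (k N : ℕ) {n : ℕ} (b : Fin n → ℝ → ℝ) (l : Fin n → ℝ) : Prop where
  mem : ∀ i, b i ∈ FESpace k N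
  inner0_eq : ∀ i j, inner0 (b i) (b j) = if i = j then 1 else 0
  innerH_eq : ∀ i j, innerH (b i) (b j) = if i = j then l i else 0
  expand : ∀ v ∈ FESpace k N, ∀ r ∈ I, v r = ∑ i, inner0 v (b i) * b i r

/-- The linear combination of the functions `b i` with coefficients `c i`. -/
def comb {n : ℕ} (b : Fin n → ℝ → ℝ) (c : Fin n → ℝ) : ℝ → ℝ := fun r => ∑ i, c i * b i r

section Eigenbasis

variable {k N n : ℕ} {b : Fin n → ℝ → ℝ} {l : Fin n → ℝ}

theorem IsEigenbasis.lip0 (hN : 1 ≤ N) (hB : IsEigenbasis k N b l) (i : Fin n) : Lip0 (b i) :=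
  FESpace.lip0 hN (hB.mem i)

theorem IsEigenbasis.comb_mem (hB : IsEigenbasis k N b l) (c : Fin n → ℝ) :
    comb b c ∈ FESpace k N :=
  FESpace.sum fun i => FESpace.const_mul (hB.mem i) (c i)

theorem IsEigenbasis.comb_lip0 (hN : 1 ≤ N) (hB : IsEigenbasis k N b l) (c : Fin n → ℝ) :
    Lip0 (comb b c) := FESpace.lip0 hN (hB.comb_mem c)

theorem IsEigenbasis.inner0_comb_left (hN : 1 ≤ N) (hB : IsEigenbasis k N b l) (c : Fin n → ℝ)
    {g : ℝ → ℝ} (hg : IsBdd g) : inner0 (comb b c) g = ∑ i, c i * inner0 (b i) g := by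
  unfold comb
  rw [inner0_sum_left Finset.univ (fun i => (hB.lip0 hN i).bdd.const_mul (c i)) hg]
  simp only [inner0_smul_left]

theorem IsEigenbasis.innerH_comb_left (hN : 1 ≤ N) (hB : IsEigenbasis k N b l) (c : Fin n → ℝ)
    {g : ℝ → ℝ} (hg : Lip0 g) : innerH (comb b c) g = ∑ i, c i * innerH (b i) g := by
  unfold comb
  rw [innerH_sum_left Finset.univ (fun i => (hB.lip0 hN i).const_mul (c i)) hg]
  simp only [innerH_smul_left]

theorem IsEigenbasis.inner0_comb_basis (hN : 1 ≤ N) (hB : IsEigenbasis k N b l) (c : Fin n → ℝ)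
    (i : Fin n) : inner0 (comb b c) (b i) = c i := by
  rw [hB.inner0_comb_left hN c (hB.lip0 hN i).bdd]
  simp [hB.inner0_eq]

theorem IsEigenbasis.innerH_comb_basis (hN : 1 ≤ N) (hB : IsEigenbasis k N b l) (c : Fin n → ℝ)
    (i : Fin n) : innerH (comb b c) (b i) = l i * c i := by
  rw [hB.innerH_comb_left hN c (hB.lip0 hN i)]
  simp [hB.innerH_eq, mul_comm]

theorem IsEigenbasis.norm0_comb (hN : 1 ≤ N) (hB : IsEigenbasis k N b l) (c : Fin n → ℝ) :
    norm0 (comb b c) = vnorm c := by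
  rw [norm0, hB.inner0_comb_left hN c (hB.comb_lip0 hN c).bdd, vnorm]
  simp only [inner0_comm (b _), hB.inner0_comb_basis hN, sq]

theorem IsEigenbasis.normHr_comb_sq (hN : 1 ≤ N) (hB : IsEigenbasis k N b l) (c : Fin n → ℝ) :
    normHr (comb b c) ^ 2 = ∑ i, l i * c i ^ 2 := by
  rw [normHr_sq, hB.innerH_comb_left hN c (hB.comb_lip0 hN c)]
  refine Finset.sum_congr rfl fun i _ => ?_
  rw [innerH_comm, hB.innerH_comb_basis hN]
  ring

theorem IsEigenbasis.eq_comb (hB : IsEigenbasis k N b l) {v : ℝ → ℝ} (hv : v ∈ FESpace k N) :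
    ∀ r ∈ I, v r = comb b (fun i => inner0 v (b i)) r := hB.expand v hv

/-- Two functionals which agree on the basis agree on the finite element space. -/
theorem IsEigenbasis.weak_ext (hN : 1 ≤ N) (hB : IsEigenbasis k N b l) {X Y Z : ℝ → ℝ}
    (hX : IsBdd X) (hY : Lip0 Y) (hZ : IsBdd Z)
    (h : ∀ i, inner0 X (b i) + innerH Y (b i) = inner0 Z (b i)) :
    ∀ v ∈ FESpace k N, inner0 X v + innerH Y v = inner0 Z v := by
  intro v hv
  have he := hB.eq_comb hv
  have hae : v =ᵐ[volI] comb b (fun i => inner0 v (b i)) := by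
    filter_upwards [ae_restrict_mem measurableSet_Icc] with r hr using he r hr
  rw [inner0_congr (Filter.EventuallyEq.refl _ X) hae, inner0_congr (Filter.EventuallyEq.refl _ Z) hae,
    innerH_congr (fun _ _ => rfl) he, inner0_comm X, innerH_comm Y, inner0_comm Z,
    hB.inner0_comb_left hN _ hX, hB.innerH_comb_left hN _ hY, hB.inner0_comb_left hN _ hZ,
    ← Finset.sum_add_distrib]
  refine Finset.sum_congr rfl fun i _ => ?_
  rw [inner0_comm _ X, innerH_comm _ Y, inner0_comm _ Z, ← h i]
  ring

/-- Bessel's inequality. -/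
theorem IsEigenbasis.vnorm_inner0_le (hN : 1 ≤ N) (hB : IsEigenbasis k N b l) {g : ℝ → ℝ}
    (hg : IsBdd g) : vnorm (fun i => inner0 g (b i)) ≤ norm0 g := by
  set c : Fin n → ℝ := fun i => inner0 g (b i) with hc
  have hcb := (hB.comb_lip0 hN c).bdd
  have h1 : inner0 (comb b c) g = vnorm c ^ 2 := by
    rw [hB.inner0_comb_left hN c hg, vnorm_sq]
    refine Finset.sum_congr rfl fun i _ => ?_
    rw [inner0_comm, sq]
  have h2 := le_of_abs_le (abs_inner0_le hcb hg)
  rw [h1, hB.norm0_comb hN] at h2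
  rcases (vnorm_nonneg c).eq_or_lt with h | h
  · rw [← h]; exact norm0_nonneg g
  · rw [sq] at h2
    exact le_of_mul_le_mul_left h2 h

theorem IsEigenbasis.one_le (hN : 1 ≤ N) (hB : IsEigenbasis k N b l) (i : Fin n) : 1 ≤ l i := by
  have h := pow_le_pow_left₀ (norm0_nonneg _) (hB.lip0 hN i).norm0_le_normHr 2
  rw [norm0_sq, normHr_sq, hB.inner0_eq, hB.innerH_eq] at h
  simpa using h

theorem IsEigenbasis.isRitz (hN : 1 ≤ N) (hB : IsEigenbasis k N b l) {w : ℝ → ℝ} (hw : Lip0 w) :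
    IsRitz k N w (comb b fun i => innerH w (b i) / l i) := by
  refine ⟨hB.comb_mem _, fun v hv => ?_⟩
  have he := hB.eq_comb hv
  rw [innerH_congr (fun _ _ => rfl) he, innerH_congr (fun _ _ => rfl) he, innerH_comm,
    innerH_comm w, hB.innerH_comb_left hN _ (hB.comb_lip0 hN _), hB.innerH_comb_left hN _ hw]
  refine Finset.sum_congr rfl fun i _ => ?_
  have := (zero_lt_one.trans_le (hB.one_le hN i)).ne'
  rw [innerH_comm, hB.innerH_comb_basis hN, mul_div_cancel₀ _ this, innerH_comm w]

end Eigenbasis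

theorem exists_isEigenbasis {k N : ℕ} (hk : 1 ≤ k) (hN : 1 ≤ N) :
    ∃ (n : ℕ) (b : Fin n → ℝ → ℝ) (l : Fin n → ℝ), IsEigenbasis k N b l := by
  obtain ⟨n, b, l, h1, h2, h3, h4⟩ := FESpace.exists_eigenbasis hk hN
  exact ⟨n, b, l, h1, h2, h3, h4⟩

theorem exists_eigenvalue_bound (k : ℕ) : ∃ C > 0, ∀ (N n : ℕ) (b : Fin n → ℝ → ℝ)
    (l : Fin n → ℝ), 1 ≤ N → IsEigenbasis k N b l → ∀ i, l i ≤ C * N ^ 2 := by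
  obtain ⟨C, hC, h⟩ := exists_inverse_estimate k
  refine ⟨C, hC, fun N n b l hN hB i => ?_⟩
  have := h N hN (b i) (hB.mem i)
  rw [hB.inner0_eq, hB.innerH_eq] at this
  simpa using this

/-! ### A linear comparison scheme -/

theorem exists_implicit_euler {ι : Type*} {l : ι → ℝ} (hl : ∀ i, 0 ≤ l i) {τ : ℝ} (hτ : 0 < τ)
    (c₀ : ι → ℝ) (p : ℕ → ι → ℝ) :
    ∃ c : ℕ → ι → ℝ, c 0 = c₀ ∧
      ∀ j i, c (j + 1) i - c j i + τ * l i * c (j + 1) i = τ * p j i := by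
  refine ⟨fun j => Nat.rec c₀ (fun m c i => (c i + τ * p m i) / (1 + τ * l i)) j, rfl,
    fun j i => ?_⟩
  have : (1 + τ * l i) ≠ 0 := by have := hl i; positivity
  simp only
  field_simp
  ring

section Comparison

variable {k N n : ℕ} {b : Fin n → ℝ → ℝ} {l : Fin n → ℝ} {τ T K L : ℝ} {J : ℕ}
  {c : ℕ → Fin n → ℝ} {w E g : ℕ → ℝ → ℝ}

/-- With R the Ritz projection of w, the coefficients of U - R solve implicit Euler with two
forcings: the time defect, of size Kτ in L²_r, and the time difference of the L²_r projection ρ of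
the Ritz error. The first is handled by the energy estimate, the second by the smoothing estimate,
so no order for the Ritz error of the time derivative is needed. -/
theorem normHr_comparison_sub_le (hk : 1 ≤ k) (hN : 1 ≤ N) (hB : IsEigenbasis k N b l)
    (hL0 : 0 < L) (hL : ∀ i, l i ≤ L * N ^ 2) (hτ : 0 < τ) (hT : 0 < T) (hJ : J * τ ≤ T)
    (hK : 0 ≤ K) (hw : ∀ j ≤ J, Lip0 (w j)) (hE : ∀ j ≤ J, IsBdd (E j)) (hg : ∀ j ≤ J, IsBdd (g j))
    (hEw : ∀ j ≤ J, ∀ v, Lip0 v → innerH (w j) v = inner0 (E j) v)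
    (hd : ∀ j < J, norm0 (fun r => (w (j + 1) r - w j r) / τ + E (j + 1) r - g j r) ≤ K * τ)
    (hap : ∀ j ≤ J, ∃ χ ∈ FESpace k N, normHr (fun r => w j r - χ r) ≤ K * (1 / N) ^ k)
    (hc0 : ∀ i, c 0 i = innerH (w 0) (b i) / l i)
    (hc : ∀ j i, c (j + 1) i - c j i + τ * l i * c (j + 1) i = τ * inner0 (g j) (b i)) :
    ∀ j ≤ J, normHr (fun r => comb b (c j) r - w j r)
      ≤ (2 * T + 1152 * L + 3) * K * (τ + (1 / N) ^ k) := by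
  have hN' : (0 : ℝ) < N := by exact_mod_cast hN
  have hl1 := hB.one_le hN
  have hl : ∀ i, 0 ≤ l i := fun i => zero_le_one.trans (hl1 i)
  have hbb : ∀ i, IsBdd (b i) := fun i => (hB.lip0 hN i).bdd
  set h : ℝ := 1 / N with hh
  have hh0 : 0 < h := by positivity
  set R : ℕ → Fin n → ℝ := fun j i => innerH (w j) (b i) / l i with hR
  have hRitz : ∀ j ≤ J, IsRitz k N (w j) (comb b (R j)) := fun j hj => hB.isRitz hN (hw j hj)
  have hρH : ∀ j ≤ J, normHr (fun r => w j r - comb b (R j) r) ≤ K * h ^ k := by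
    intro j hj
    obtain ⟨χ, hχ, hχ'⟩ := hap j hj
    exact ((hRitz j hj).normHr_le hN (hw j hj) hχ).trans hχ'
  set ρ : ℕ → Fin n → ℝ := fun j i => inner0 (w j) (b i) - R j i with hρ
  have hρv : ∀ j ≤ J, vnorm (ρ j) ≤ 4 * h * (K * h ^ k) := by
    intro j hj
    have hLc := hB.comb_lip0 hN (R j)
    have e : ρ j = fun i => inner0 (fun r => w j r - comb b (R j) r) (b i) := by
      ext i
      rw [inner0_sub_left (hw j hj).bdd hLc.bdd (hbb i), hB.inner0_comb_basis hN]
    rw [e]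
    refine (hB.vnorm_inner0_le hN ((hw j hj).sub hLc).bdd).trans ?_
    refine ((hRitz j hj).norm0_le hk hN (hw j hj)).trans ?_
    rw [show (4 : ℝ) / N = 4 * h by rw [hh]; ring]
    exact mul_le_mul_of_nonneg_left (hρH j hj) (by positivity)
  set d : ℕ → ℝ → ℝ := fun j r => (w (j + 1) r - w j r) / τ + E (j + 1) r - g j r with hdd
  have hquot : ∀ j < J, IsBdd fun r => τ⁻¹ * (w (j + 1) r - w j r) := fun j hj =>
    (((hw _ hj).sub (hw _ hj.le)).bdd).const_mul _
  have hd_eq : ∀ j, d j = fun r => (τ⁻¹ * (w (j + 1) r - w j r) + E (j + 1) r) - g j r := by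
    intro j; ext r; rw [hdd]; ring
  have hdb : ∀ j < J, IsBdd (d j) := fun j hj => by
    rw [hd_eq]
    exact ((hquot j hj).add (hE _ hj)).sub (hg j hj.le)
  have hdi : ∀ j < J, ∀ i, τ * inner0 (d j) (b i) = inner0 (w (j + 1)) (b i) - inner0 (w j) (b i)
      + τ * inner0 (E (j + 1)) (b i) - τ * inner0 (g j) (b i) := by
    intro j hj i
    rw [hd_eq, inner0_sub_left ((hquot j hj).add (hE _ hj)) (hg j hj.le) (hbb i),
      inner0_add_left (hquot j hj) (hE _ hj) (hbb i), inner0_smul_left,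
      inner0_sub_left (hw _ hj).bdd (hw _ hj.le).bdd (hbb i)]
    field_simp
  obtain ⟨θ₁, h10, h1⟩ := exists_implicit_euler hl hτ (fun _ => 0)
    (fun j i => -1 * inner0 (d j) (b i))
  -- By linearity θ₁ takes the time defect with zero initial value; what remains is driven only by
  -- increments of ρ. It starts at 0 because U does at the Ritz projection.
  set θ₂ : ℕ → Fin n → ℝ := fun j i => c j i - R j i - θ₁ j i with hθ₂
  have hθ₂0 : ∀ i, θ₂ 0 i = 0 := fun i => by simp [hθ₂, h10, hc0, hR]
  have hθ₂s : ∀ j < J, ∀ i, θ₂ (j + 1) i - θ₂ j i + τ * l i * θ₂ (j + 1) i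
      = ρ (j + 1) i - ρ j i := by
    intro j hj i
    have e1 := hc j i
    have e2 := h1 j i
    have e3 := hdi j hj i
    have e4 : l i * R (j + 1) i = inner0 (E (j + 1)) (b i) := by
      rw [← hEw _ hj _ (hB.lip0 hN i)]
      have := (zero_lt_one.trans_le (hl1 i)).ne'
      simp only [hR]
      field_simp
    simp only [hθ₂, hρ]
    linear_combination e1 - e2 + e3 - τ * e4
  intro j hj
  have s1 := energy_estimate hl hτ (θ := θ₁) (d := fun j i => -1 * inner0 (d j) (b i)) (Q := K * τ)
    (fun i => by rw [h10]) j (fun m _ i => h1 m i) (fun m hm => by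
      have hmJ := hm.trans_le hj
      refine (vnorm_mul_le (a := fun _ => -1) _ zero_le_one (fun _ => by simp)).trans ?_
      rw [one_mul]
      exact (hB.vnorm_inner0_le hN (hdb m hmJ)).trans (hd m hmJ))
  have s2 := smoothing_estimate hl hL (by positivity) hτ (Q := 4 * h * (K * h ^ k)) (by positivity)
    hθ₂0 j (fun m hm i => hθ₂s m (hm.trans_le hj) i) (fun m hm => hρv m (hm.trans hj))
  rw [← hB.normHr_comb_sq hN] at s1 s2
  have hjT : (j : ℝ) * τ ≤ T :=
    (mul_le_mul_of_nonneg_right (by exact_mod_cast hj) hτ.le).trans hJ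
  have t1 : normHr (comb b (θ₁ j)) ≤ (T + 1) * K * τ := by
    refine abs_le_of_sq_le_sq' ?_ (by positivity) |>.2
    refine s1.trans ((mul_le_mul_of_nonneg_right hjT (sq_nonneg _)).trans ?_)
    rw [show ((T + 1) * K * τ) ^ 2 = (T + 1) ^ 2 * (K * τ) ^ 2 by ring]
    exact mul_le_mul_of_nonneg_right (by nlinarith) (sq_nonneg _)
  have t2 : normHr (comb b (θ₂ j)) ≤ (576 * L + 1) * K * h ^ k := by
    refine abs_le_of_sq_le_sq' ?_ (by positivity) |>.2
    refine s2.trans ?_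
    -- The N² of the inverse estimate cancels the additional h² gained by duality in ‖ρ‖².
    have e : (N : ℝ) * h = 1 := by rw [hh]; field_simp
    rw [show 36 * (L * (N : ℝ) ^ 2) * (4 * h * (K * h ^ k)) ^ 2
      = 576 * L * (N * h) ^ 2 * (K * h ^ k) ^ 2 by ring, e,
      show ((576 * L + 1) * K * h ^ k) ^ 2 = (576 * L + 1) ^ 2 * (K * h ^ k) ^ 2 by ring]
    exact mul_le_mul_of_nonneg_right (by nlinarith) (sq_nonneg _)
  have hL1 := hB.comb_lip0 hN (θ₁ j)
  have hL2 := hB.comb_lip0 hN (θ₂ j)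
  have hLR := hB.comb_lip0 hN (R j)
  have e : normHr (fun r => comb b (c j) r - w j r) = normHr fun r =>
      (comb b (θ₁ j) r + comb b (θ₂ j) r) + -1 * (w j r - comb b (R j) r) := by
    refine normHr_congr fun r _ => ?_
    have : comb b (c j) r = comb b (θ₁ j) r + comb b (θ₂ j) r + comb b (R j) r := by
      simp only [comb, ← Finset.sum_add_distrib]
      refine Finset.sum_congr rfl fun i _ => ?_
      simp only [hθ₂]
      ring
    rw [this]
    ring
  have hwR := (hw j hj).sub hLR
  rw [e]
  refine (normHr_add_le (hL1.add hL2) (hwR.const_mul (-1))).trans ?_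
  rw [normHr_smul, abs_neg, abs_one, one_mul]
  refine (add_le_add ((normHr_add_le hL1 hL2).trans (add_le_add t1 t2)) (hρH j hj)).trans ?_
  have p1 : 0 ≤ K * τ := by positivity
  have p2 : 0 ≤ K * h ^ k := by positivity
  have p3 : 0 ≤ T * (K * τ) := by positivity
  have p4 : 0 ≤ T * (K * h ^ k) := by positivity
  have p5 : 0 ≤ L * (K * τ) := by positivity
  have p6 : 0 ≤ L * (K * h ^ k) := by positivity
  nlinarith

/-- The discrete time derivative y of U solves the same scheme, forced by increments of the load,
hence stays bounded in L²_r and dissipates. Boundedness of y bounds the discrete operator applied to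
U; its dissipation bounds the total variation of U in time. -/
theorem comparison_dissipation (hN : 1 ≤ N) (hB : IsEigenbasis k N b l) (hτ : 0 < τ) (hT : 0 < T)
    (hJ : J * τ ≤ T) (hK : 0 ≤ K) (hE : ∀ j ≤ J, IsBdd (E j))
    (hg : ∀ j ≤ J, IsBdd (g j))
    (hEw : ∀ j ≤ J, ∀ v, Lip0 v → innerH (w j) v = inner0 (E j) v)
    (hE0 : norm0 (E 0) ≤ K) (hgK : ∀ j ≤ J, norm0 (g j) ≤ K)
    (hgd : ∀ j < J, norm0 (fun r => g (j + 1) r - g j r) ≤ K * τ)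
    (hc0 : ∀ i, c 0 i = innerH (w 0) (b i) / l i)
    (hc : ∀ j i, c (j + 1) i - c j i + τ * l i * c (j + 1) i = τ * inner0 (g j) (b i)) :
    (∀ j ≤ J, vnorm (fun i => l i * c j i) ≤ (3 + T) * K) ∧
      ∑ j ∈ Finset.range J, normHr (fun r => comb b (c (j + 1)) r - comb b (c j) r)
        ≤ (1 + T) * (2 + T) * K := by
  have hl1 := hB.one_le hN
  have hl : ∀ i, 0 ≤ l i := fun i => zero_le_one.trans (hl1 i)
  have hbb : ∀ i, IsBdd (b i) := fun i => (hB.lip0 hN i).bdd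
  -- For j ≥ 1 this is the backward difference quotient. At j = 0 truncated subtraction gives g 0,
  -- so y 0 is the projection of g 0 - E 0, and the first forcing vanishes.
  set y : ℕ → Fin n → ℝ := fun j i => inner0 (g (j - 1)) (b i) - l i * c j i with hy
  have hy1 : ∀ j i, τ * y (j + 1) i = c (j + 1) i - c j i := by
    intro j i
    have := hc j i
    simp only [hy, Nat.add_sub_cancel]
    linear_combination -this
  have hy0 : vnorm (y 0) ≤ 2 * K := by
    have e : y 0 = fun i => inner0 (fun r => g 0 r - E 0 r) (b i) := by
      ext i
      have := (zero_lt_one.trans_le (hl1 i)).ne'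
      rw [inner0_sub_left (hg 0 (Nat.zero_le _)) (hE 0 (Nat.zero_le _)) (hbb i),
        ← hEw 0 (Nat.zero_le _) _ (hB.lip0 hN i)]
      simp only [hy, hc0]
      field_simp
    rw [e]
    have hEb := (hE 0 (Nat.zero_le _)).const_mul (-1)
    have h1 := norm0_add_le (hg 0 (Nat.zero_le _)) hEb
    rw [norm0_smul, abs_neg, abs_one, one_mul] at h1
    refine (hB.vnorm_inner0_le hN ((hg 0 (Nat.zero_le _)).sub (hE 0 (Nat.zero_le _)))).trans ?_
    have e2 : (fun r => g 0 r - E 0 r) = fun r => g 0 r + -1 * E 0 r := by ext r; ring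
    rw [e2]
    linarith [hgK 0 (Nat.zero_le _)]
  have hstep : ∀ j < J, ∀ i, y (j + 1) i - y j i + τ * l i * y (j + 1) i
      = inner0 (g j) (b i) - inner0 (g (j - 1)) (b i) := by
    intro j hj i
    have h1 := hy1 j i
    have h2 : y (j + 1) i = inner0 (g j) (b i) - l i * c (j + 1) i := by simp [hy]
    have h3 : y j i = inner0 (g (j - 1)) (b i) - l i * c j i := rfl
    linear_combination l i * h1 + h2 - h3
  have hδ : ∀ j < J, vnorm (fun i => inner0 (g j) (b i) - inner0 (g (j - 1)) (b i)) ≤ τ * K := by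
    intro j hj
    rcases j with _ | j
    · simp only [Nat.zero_sub, sub_self, vnorm_zero]
      positivity
    · have h1 := hg (j + 1) hj.le
      have h2 := hg j (by omega)
      have e : (fun i => inner0 (g (j + 1)) (b i) - inner0 (g (j + 1 - 1)) (b i))
          = fun i => inner0 (fun r => g (j + 1) r - g j r) (b i) := by
        ext i
        rw [inner0_sub_left h1 h2 (hbb i), Nat.add_sub_cancel]
      rw [e, mul_comm]
      exact (hB.vnorm_inner0_le hN (h1.sub h2)).trans (hgd j (by omega))
  have hdis := fun m (hm : m ≤ J) => dissipation_estimate hl hτ hK hy0 m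
    (δ := fun j i => inner0 (g j) (b i) - inner0 (g (j - 1)) (b i))
    (fun j hj i => hstep j (hj.trans_le hm) i) (fun j hj => hδ j (hj.trans_le hm))
  have hmT : ∀ m ≤ J, (m : ℝ) * τ * K ≤ T * K := fun m hm =>
    mul_le_mul_of_nonneg_right ((mul_le_mul_of_nonneg_right (by exact_mod_cast hm) hτ.le).trans hJ) hK
  constructor
  · intro j hj
    have hgj : IsBdd (g (j - 1)) := hg _ (by omega)
    have e : (fun i => l i * c j i) = fun i => inner0 (g (j - 1)) (b i) + -1 * y j i := by
      ext i
      simp only [hy]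
      ring
    rw [e]
    refine (vnorm_add_le _ _).trans ?_
    have h1 := (hB.vnorm_inner0_le hN hgj).trans (hgK (j - 1) (by omega))
    have h2 := vnorm_mul_le (y j) (a := fun _ => -1) zero_le_one (fun _ => by simp)
    have h3 := (hdis j hj).1
    have h4 := hmT j hj
    linarith
  · have h1 := (hdis J le_rfl).2
    have h4 := hmT J le_rfl
    set x : ℕ → ℝ := fun j => normHr (comb b (y (j + 1))) with hx
    have hxs : ∑ j ∈ Finset.range J, τ * x j ^ 2 ≤ ((2 + T) * K) ^ 2 := by
      simp only [hx, hB.normHr_comb_sq hN]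
      refine h1.trans ?_
      have h5 : 0 ≤ (J : ℝ) * τ * K := by positivity
      have h6 : (2 * K + J * τ * K) ^ 2 ≤ ((2 + T) * K) ^ 2 :=
        pow_le_pow_left₀ (by positivity) (by linarith) 2
      have := sq_nonneg (vnorm (y J))
      have := sq_nonneg (2 * K + J * τ * K)
      linarith
    have e : ∀ j, normHr (fun r => comb b (c (j + 1)) r - comb b (c j) r) = τ * x j := by
      intro j
      have h7 := normHr_smul τ (comb b (y (j + 1)))
      rw [abs_of_pos hτ] at h7
      rw [hx, ← h7]
      refine normHr_congr fun r _ => ?_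
      simp only [comb, Finset.mul_sum, ← Finset.sum_sub_distrib]
      refine Finset.sum_congr rfl fun i _ => ?_
      rw [← mul_assoc, hy1]
      ring
    simp only [e, ← Finset.mul_sum] at hxs ⊢
    -- Cauchy-Schwarz over the time steps with Jτ ≤ T converts square summability into total
    -- variation.
    have hcs := sq_sum_le_card_mul_sum_sq (s := Finset.range J) (f := x)
    rw [Finset.card_range] at hcs
    refine abs_le_of_sq_le_sq' ?_ (by positivity) |>.2
    have h0 : 0 ≤ ∑ j ∈ Finset.range J, x j ^ 2 := Finset.sum_nonneg fun _ _ => sq_nonneg _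
    calc (τ * ∑ j ∈ Finset.range J, x j) ^ 2
        = τ ^ 2 * (∑ j ∈ Finset.range J, x j) ^ 2 := by ring
      _ ≤ τ ^ 2 * (J * ∑ j ∈ Finset.range J, x j ^ 2) := by gcongr
      _ = (J * τ) * (τ * ∑ j ∈ Finset.range J, x j ^ 2) := by ring
      _ ≤ T * ((2 + T) * K) ^ 2 := by gcongr
      _ ≤ ((1 + T) * (2 + T) * K) ^ 2 := by
        rw [show ((1 + T) * (2 + T) * K) ^ 2 = (1 + T) ^ 2 * ((2 + T) * K) ^ 2 by ring]
        exact mul_le_mul_of_nonneg_right (by nlinarith) (sq_nonneg _)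

end Comparison

/-- The solution of a linear scheme whose right hand side is taken from the exact solution. -/
theorem exists_linear_comparison {k : ℕ} (hk : 1 ≤ k) {T K : ℝ} (hT : 0 < T) (hK : 0 ≤ K) :
    ∃ C : ℝ, 0 < C ∧ ∀ N J : ℕ, 1 ≤ N → ∀ τ : ℝ, 0 < τ → J * τ ≤ T → ∀ w E g : ℕ → ℝ → ℝ,
      (∀ j ≤ J, Lip0 (w j)) → (∀ j ≤ J, IsBdd (E j)) → (∀ j ≤ J, IsBdd (g j)) →
      (∀ j ≤ J, ∀ v, Lip0 v → innerH (w j) v = inner0 (E j) v) →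
      norm0 (E 0) ≤ K → (∀ j ≤ J, norm0 (g j) ≤ K) →
      (∀ j < J, norm0 (fun r => g (j + 1) r - g j r) ≤ K * τ) →
      (∀ j < J, norm0 (fun r => (w (j + 1) r - w j r) / τ + E (j + 1) r - g j r) ≤ K * τ) →
      (∀ j ≤ J, ∃ χ ∈ FESpace k N, normHr (fun r => w j r - χ r) ≤ K * (1 / N) ^ k) →
      ∃ U : ℕ → ℝ → ℝ, (∀ j, U j ∈ FESpace k N) ∧
        (∀ j < J, ∀ v ∈ FESpace k N, inner0 (fun r => (U (j + 1) r - U j r) / τ) v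
          + innerH (U (j + 1)) v = inner0 (g j) v) ∧
        (∀ j ≤ J, normHr (fun r => U j r - w j r) ≤ C * (τ + (1 / N) ^ k)) ∧
        (∀ j ≤ J, ∀ r ∈ I, |U j r| ≤ C * √r) ∧
        ∑ j ∈ Finset.range J, normHr (fun r => U (j + 1) r - U j r) ≤ C := by
  obtain ⟨L, hL0, hL⟩ := exists_eigenvalue_bound k
  obtain ⟨A, hA0, hA⟩ := exists_abs_le_sqrt k hk
  set C₁ : ℝ := (2 * T + 1152 * L + 3) * K with hC₁
  set C₂ : ℝ := A * ((3 + T) * K) with hC₂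
  set C₃ : ℝ := (1 + T) * (2 + T) * K with hC₃
  have q1 : 0 ≤ C₁ := by positivity
  have q2 : 0 ≤ C₂ := by positivity
  have q3 : 0 ≤ C₃ := by positivity
  refine ⟨C₁ + C₂ + C₃ + 1, by positivity, ?_⟩
  intro N J hN τ hτ hJ w E g hw hE hg hEw hE0 hgK hgd hd hap
  obtain ⟨n, b, l, hB⟩ := exists_isEigenbasis hk hN
  have hl : ∀ i, 0 ≤ l i := fun i => zero_le_one.trans (hB.one_le hN i)
  obtain ⟨c, hc0, hc⟩ := exists_implicit_euler hl hτ (fun i => innerH (w 0) (b i) / l i)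
    fun j i => inner0 (g j) (b i)
  have hc0' : ∀ i, c 0 i = innerH (w 0) (b i) / l i := fun i => by rw [hc0]
  have h1 := normHr_comparison_sub_le hk hN hB hL0 (hL N n b l hN hB) hτ hT hJ hK hw hE hg hEw hd hap
    hc0' hc
  obtain ⟨h2, h3⟩ := comparison_dissipation hN hB hτ hT hJ hK hE hg hEw hE0 hgK hgd hc0' hc
  have hLc := fun j => hB.comb_lip0 hN (c j)
  refine ⟨fun j => comb b (c j), fun j => hB.comb_mem _, fun j hj => ?_, fun j hj => ?_,
    fun j hj r hr => ?_, ?_⟩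
  · have hX : Lip0 fun r => (comb b (c (j + 1)) r - comb b (c j) r) / τ :=
      (((hLc (j + 1)).sub (hLc j)).const_mul τ⁻¹).congr fun r _ => by ring
    refine hB.weak_ext hN hX.bdd (hLc _) (hg j hj.le) fun i => ?_
    have e : (fun r => (comb b (c (j + 1)) r - comb b (c j) r) / τ)
        = fun r => τ⁻¹ * (comb b (c (j + 1)) r - comb b (c j) r) := by ext r; ring
    rw [e, inner0_smul_left, inner0_sub_left (hLc _).bdd (hLc _).bdd (hB.lip0 hN i).bdd,
      hB.inner0_comb_basis hN, hB.inner0_comb_basis hN, hB.innerH_comb_basis hN]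
    have := hc j i
    field_simp
    linear_combination this
  · refine (h1 j hj).trans ?_
    exact mul_le_mul_of_nonneg_right (by linarith) (by positivity)
  -- The function with coefficients l i * c j i is the discrete elliptic operator applied to U_j;
  -- `h2` bounds its L²_r norm.
  · have := hA N hN _ (hB.comb_mem (c j)) _ (hB.comb_mem fun i => l i * c j i) (by
      have := hB.weak_ext hN (X := fun _ => 0) (isBdd_const 0) (hLc j)
        (hB.comb_lip0 hN fun i => l i * c j i).bdd fun i => by
          rw [hB.innerH_comb_basis hN, hB.inner0_comb_basis hN]
          simp [inner0]
      intro v hv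
      simpa [inner0] using this v hv) r hr
    rw [hB.norm0_comb hN] at this
    refine this.trans (mul_le_mul_of_nonneg_right ?_ (Real.sqrt_nonneg r))
    have h5 := mul_le_mul_of_nonneg_left (h2 j hj) hA0.le
    linarith
  · linarith

/-! ### The nonlinearity -/

/-- The primitive of the nonlinearity which vanishes at `0`. -/
noncomputable def potential (z : ℝ) : ℝ := (z ^ 2 - sin z ^ 2) / 2

/-- The second order Taylor remainder of the potential. -/
noncomputable def remainder (a e : ℝ) : ℝ := potential (a + e) - potential a - nonlin a * e

theorem hasDerivAt_nonlin (z : ℝ) : HasDerivAt nonlin (2 * sin z ^ 2) z := by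
  have h := (hasDerivAt_id z).sub (((hasDerivAt_sin (2 * z)).comp z
    ((hasDerivAt_id z).const_mul 2)).const_mul (1 / 2))
  refine HasDerivAt.congr_deriv (f := nonlin) h ?_
  rw [sin_sq_eq_half_sub]
  simp
  ring

theorem hasDerivAt_potential (z : ℝ) : HasDerivAt potential (nonlin z) z := by
  have h := (((hasDerivAt_id z).pow 2).sub ((hasDerivAt_sin z).pow 2)).div_const 2
  refine HasDerivAt.congr_deriv (f := potential) h ?_
  rw [nonlin, sin_two_mul]
  simp
  ring

theorem nonlin_zero : nonlin 0 = 0 := by simp [nonlin]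

theorem continuous_nonlin : Continuous nonlin :=
  continuous_iff_continuousAt.2 fun z => (hasDerivAt_nonlin z).continuousAt

theorem continuous_potential : Continuous potential :=
  continuous_iff_continuousAt.2 fun z => (hasDerivAt_potential z).continuousAt

theorem monotone_nonlin : Monotone nonlin :=
  monotone_of_deriv_nonneg (fun z => (hasDerivAt_nonlin z).differentiableAt) fun z => by
    rw [(hasDerivAt_nonlin z).deriv]; positivity

theorem abs_nonlin_sub_le (x y : ℝ) : |nonlin x - nonlin y| ≤ 2 * |x - y| := by
  refine Convex.norm_image_sub_le_of_norm_hasDerivWithin_le (s := univ) (f' := fun z => 2 * sin z ^ 2)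
    (fun z _ => (hasDerivAt_nonlin z).hasDerivWithinAt) (fun z _ => ?_) convex_univ (mem_univ y)
    (mem_univ x)
  rw [Real.norm_eq_abs, abs_of_nonneg (by positivity)]
  linarith [sin_sq_le_one z]

/-- The slope 2 sin² is quadratic near 0. With m of order r or √r it absorbs two or one of the
powers of r in the singular weight. -/
theorem abs_nonlin_sub_le_of_abs_le {x y m : ℝ} (hx : |x| ≤ m) (hy : |y| ≤ m) :
    |nonlin x - nonlin y| ≤ 2 * m ^ 2 * |x - y| := by
  refine Convex.norm_image_sub_le_of_norm_hasDerivWithin_le (s := Icc (-m) m)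
    (f' := fun z => 2 * sin z ^ 2)
    (fun z _ => (hasDerivAt_nonlin z).hasDerivWithinAt) (fun z hz => ?_) (convex_Icc _ _)
    (abs_le.1 hy) (abs_le.1 hx)
  rw [Real.norm_eq_abs, abs_of_nonneg (by positivity)]
  have h1 : sin z ^ 2 ≤ z ^ 2 := sq_le_sq.2 abs_sin_le_abs
  have h2 : z ^ 2 ≤ m ^ 2 := sq_le_sq' hz.1 hz.2
  linarith

theorem abs_nonlin_le (x : ℝ) : |nonlin x| ≤ 2 * |x| ^ 3 := by
  have := abs_nonlin_sub_le_of_abs_le (x := x) (y := 0) le_rfl (by simp)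
  rw [nonlin_zero, sub_zero, sub_zero] at this
  exact this.trans (le_of_eq (by ring))

/-- Tangent inequality for the convex potential: the reason an explicit treatment of the
nonlinearity does not destroy energy decay. -/
theorem nonlin_mul_sub_le (x y : ℝ) : nonlin x * (y - x) ≤ potential y - potential x := by
  have hconv : ConvexOn ℝ univ potential := by
    refine MonotoneOn.convexOn_of_deriv convex_univ continuous_potential.continuousOn
      (fun z _ => (hasDerivAt_potential z).differentiableAt.differentiableWithinAt) ?_
    intro a _ b _ hab
    rw [(hasDerivAt_potential a).deriv, (hasDerivAt_potential b).deriv]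
    exact monotone_nonlin hab
  rcases lt_trichotomy x y with h | h | h
  · have := hconv.le_slope_of_hasDerivAt (mem_univ x) (mem_univ y) h (hasDerivAt_potential x)
    rwa [slope_def_field, le_div_iff₀ (sub_pos.2 h)] at this
  · simp [h]
  · have := hconv.slope_le_of_hasDerivAt (mem_univ y) (mem_univ x) h (hasDerivAt_potential x)
    rw [slope_def_field, div_le_iff₀ (sub_pos.2 h)] at this
    linarith

theorem remainder_nonneg (a e : ℝ) : 0 ≤ remainder a e := by
  have := nonlin_mul_sub_le a (a + e)
  rw [add_sub_cancel_left] at this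
  rw [remainder]
  linarith

/-- Convexity survives subtraction of the affine part at the base point a. -/
theorem nonlin_sub_mul_le (a e e' : ℝ) :
    (nonlin (a + e) - nonlin a) * (e' - e) ≤ remainder a e' - remainder a e := by
  have := nonlin_mul_sub_le (a + e) (a + e')
  rw [add_sub_add_left_eq_sub] at this
  rw [remainder, remainder]
  linarith

/-- Comparison with the increment 0 bounds the remainder by a difference of `nonlin` times e, and
the slope of `nonlin` is at most twice (|a| + |e|)². -/
theorem remainder_le (a e : ℝ) : remainder a e ≤ 4 * (a ^ 2 + e ^ 2) * e ^ 2 := by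
  have h1 := nonlin_sub_mul_le a e 0
  have h2 : remainder a 0 = 0 := by simp [remainder]
  have h3 := abs_nonlin_sub_le_of_abs_le (x := a + e) (y := a) (m := |a| + |e|) (abs_add_le _ _)
    (by linarith [abs_nonneg e])
  have h4 := le_abs_self ((nonlin (a + e) - nonlin a) * e)
  rw [abs_mul] at h4
  have h5 := mul_le_mul_of_nonneg_right h3 (abs_nonneg e)
  rw [add_sub_cancel_left, mul_assoc, ← sq, sq_abs] at h5
  have h6 : (|a| + |e|) ^ 2 ≤ 2 * (a ^ 2 + e ^ 2) := by
    rw [← sq_abs a, ← sq_abs e]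
    nlinarith [sq_nonneg (|a| - |e|)]
  have h7 := mul_le_mul_of_nonneg_right h6 (sq_nonneg e)
  linarith

/-- The derivative in the base point is f(z+e) - f(z) - f'(z)e, quadratic in e since f'(z+s) - f'(z)
= 2 sin(2z+s) sin s. This prices the motion of the base point. -/
theorem abs_remainder_sub_le (a b e : ℝ) : |remainder a e - remainder b e| ≤ 2 * e ^ 2 * |a - b| := by
  have hg : ∀ z, |nonlin (z + e) - nonlin z - 2 * sin z ^ 2 * e| ≤ 2 * e ^ 2 := by
    intro z
    have h := Convex.norm_image_sub_le_of_norm_hasDerivWithin_le (s := Icc (-|e|) |e|)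
      (f := fun s => nonlin (z + s) - 2 * sin z ^ 2 * s)
      (f' := fun s => 2 * sin (z + s) ^ 2 - 2 * sin z ^ 2) (C := 2 * |e|) (x := 0) (y := e)
      (fun s _ => by
        have h1 := ((hasDerivAt_nonlin (z + s)).comp s ((hasDerivAt_id s).const_add z)).sub
          ((hasDerivAt_id s).const_mul (2 * sin z ^ 2))
        refine HasDerivAt.hasDerivWithinAt (HasDerivAt.congr_deriv h1 (by ring)))
      (fun s hs => by
        have e1 : 2 * sin (z + s) ^ 2 - 2 * sin z ^ 2
            = 2 * (sin (2 * z + s) * sin s) := by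
          have h2 : sin (2 * z + s) * sin s = (cos (2 * z) - cos (2 * (z + s))) / 2 := by
            have h5 := cos_sub (2 * z + s) s
            have h6 := cos_add (2 * z + s) s
            rw [add_sub_cancel_right] at h5
            rw [show 2 * z + s + s = 2 * (z + s) by ring] at h6
            rw [h5, h6]
            ring
          rw [h2, sin_sq_eq_half_sub, sin_sq_eq_half_sub]
          ring
        have h3 := abs_sin_le_one (2 * z + s)
        have h4 : |sin s| ≤ |e| := abs_sin_le_abs.trans (abs_le.2 hs)
        rw [Real.norm_eq_abs, e1, abs_mul, abs_mul, abs_of_pos (zero_lt_two' ℝ)]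
        nlinarith [abs_nonneg (sin s), abs_nonneg (sin (2 * z + s))])
      (convex_Icc _ _) ⟨by simp, by simp⟩ ⟨neg_abs_le e, le_abs_self e⟩
    simp only [add_zero, mul_zero, sub_zero, Real.norm_eq_abs] at h
    rwa [mul_assoc 2 |e|, ← sq, sq_abs, sub_right_comm] at h
  refine Convex.norm_image_sub_le_of_norm_hasDerivWithin_le (s := univ)
    (f := fun z => remainder z e) (f' := fun z => nonlin (z + e) - nonlin z - 2 * sin z ^ 2 * e)
    (fun z _ => ?_) (fun z _ => hg z) convex_univ (mem_univ b) (mem_univ a)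
  have h1 := (((hasDerivAt_potential (z + e)).comp z ((hasDerivAt_id z).add_const e)).sub
    (hasDerivAt_potential z)).sub ((hasDerivAt_nonlin z).mul_const e)
  exact HasDerivAt.hasDerivWithinAt (HasDerivAt.congr_deriv h1 (by ring))

/-! ### The weighted integral of the Taylor remainder -/

theorem Lip0.exists_abs_le_mul {v : ℝ → ℝ} (hv : Lip0 v) : ∃ K, 0 ≤ K ∧ ∀ r ∈ I, |v r| ≤ K * r := by
  obtain ⟨K, hK⟩ := hv.lip
  exact ⟨K, K.2, fun r hr => abs_le_mul_of_lipschitzOn hK hv.zero hr⟩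

theorem isBdd_div_sq {g : ℝ → ℝ} (hg : ContinuousOn g I) {B : ℝ}
    (h : ∀ r ∈ I, |g r| ≤ B * r ^ 2) : IsBdd fun r => g r / r ^ 2 := by
  refine IsBdd.of_bound (aestronglyMeasurable_div (isBdd_of_continuousOn hg).meas 2) B ?_
  filter_upwards [ae_Ioo] with r hr
  have hr0 := hr.1
  rw [abs_div, abs_of_nonneg (sq_nonneg r), div_le_iff₀ (by positivity)]
  exact h r ⟨hr.1.le, hr.2.le⟩

theorem Lip0.isBdd_nonlin_div {v : ℝ → ℝ} (hv : Lip0 v) : IsBdd fun r => nonlin (v r) / r ^ 2 := by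
  obtain ⟨K, hK0, hK⟩ := hv.exists_abs_le_mul
  refine isBdd_div_sq (continuous_nonlin.comp_continuousOn hv.continuousOn) (B := 2 * K ^ 3)
    fun r hr => (abs_nonlin_le _).trans ?_
  have h1 := pow_le_pow_left₀ (abs_nonneg _) (hK r hr) 3
  have h2 : r ^ 3 ≤ r ^ 2 := pow_le_pow_of_le_one hr.1 hr.2 (by norm_num)
  have h3 : K ^ 3 * r ^ 3 ≤ K ^ 3 * r ^ 2 := mul_le_mul_of_nonneg_left h2 (by positivity)
  rw [mul_pow] at h1
  linarith

theorem Lip0.isBdd_remainder_div {a e : ℝ → ℝ} (ha : Lip0 a) (he : Lip0 e) :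
    IsBdd fun r => remainder (a r) (e r) / r ^ 2 := by
  obtain ⟨A, hA0, hA⟩ := ha.exists_abs_le_mul
  obtain ⟨K, hK0, hK⟩ := he.exists_abs_le_mul
  have hc : ContinuousOn (fun r => remainder (a r) (e r)) I := by
    simp only [remainder]
    exact ((continuous_potential.comp_continuousOn (ha.add he).continuousOn).sub
      (continuous_potential.comp_continuousOn ha.continuousOn)).sub
      ((continuous_nonlin.comp_continuousOn ha.continuousOn).mul he.continuousOn)
  refine isBdd_div_sq hc (B := 4 * (A ^ 2 + K ^ 2) * K ^ 2) fun r hr => ?_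
  rw [abs_of_nonneg (remainder_nonneg _ _)]
  refine (remainder_le _ _).trans ?_
  have h1 := pow_le_pow_left₀ (abs_nonneg _) (hK r hr) 2
  have h2 := pow_le_pow_left₀ (abs_nonneg _) (hA r hr) 2
  rw [sq_abs, mul_pow] at h1 h2
  have h3 : r ^ 2 ≤ 1 := pow_le_one₀ hr.1 hr.2
  have h4 : a r ^ 2 + e r ^ 2 ≤ A ^ 2 + K ^ 2 :=
    add_le_add (h2.trans (mul_le_of_le_one_right (sq_nonneg A) h3))
      (h1.trans (mul_le_of_le_one_right (sq_nonneg K) h3))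
  rw [mul_assoc (4 * (A ^ 2 + K ^ 2))]
  exact mul_le_mul (mul_le_mul_of_nonneg_left h4 (by norm_num)) h1 (sq_nonneg _) (by positivity)

/-- The weighted integral of the Taylor remainder of the potential. -/
noncomputable def remainderInt (a e : ℝ → ℝ) : ℝ := ∫ r, remainder (a r) (e r) / r ^ 2 * r ∂volI

theorem remainderInt_nonneg (a e : ℝ → ℝ) : 0 ≤ remainderInt a e := by
  refine integral_nonneg_of_ae ?_
  filter_upwards [ae_Ioo] with r hr
  have := remainder_nonneg (a r) (e r)
  have := hr.1
  simp only [Pi.zero_apply]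
  positivity

theorem inner0_nonlin_sub_le {a e e' : ℝ → ℝ} (ha : Lip0 a) (he : Lip0 e) (he' : Lip0 e') :
    inner0 (fun r => (nonlin (a r + e r) - nonlin (a r)) / r ^ 2) (fun r => e' r - e r)
      ≤ remainderInt a e' - remainderInt a e := by
  have h1 := ((ha.isBdd_remainder_div he').mul isBdd_id).integrable
  have h2 := ((ha.isBdd_remainder_div he).mul isBdd_id).integrable
  have h3 : IsBdd fun r => (nonlin (a r + e r) - nonlin (a r)) / r ^ 2 := by
    simp only [sub_div]
    exact (ha.add he).isBdd_nonlin_div.sub ha.isBdd_nonlin_div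
  rw [inner0_eq, remainderInt, remainderInt, ← integral_sub h1 h2]
  refine integral_mono_ae (h3.integrable_mul (he'.sub he).bdd) (h1.sub h2) ?_
  filter_upwards [ae_Ioo] with r hr
  have hr0 := hr.1
  have h := nonlin_sub_mul_le (a r) (e r) (e' r)
  have h' := mul_le_mul_of_nonneg_right h (inv_pos.2 hr0).le
  refine le_of_eq_of_le ?_ (h'.trans (le_of_eq ?_))
  · field_simp
  · field_simp

/-- The displacement of the base point is measured in the sup norm, which H^1_r controls; the factor
e²/r² is left for the Hardy part of the norm. -/
theorem remainderInt_sub_le {a a' e : ℝ → ℝ} (ha : Lip0 a) (ha' : Lip0 a') (he : Lip0 e) :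
    remainderInt a e - remainderInt a' e ≤ 2 * normHr (fun r => a' r - a r) * normHr e ^ 2 := by
  have h1 := ((ha.isBdd_remainder_div he).mul isBdd_id).integrable
  have h2 := ((ha'.isBdd_remainder_div he).mul isBdd_id).integrable
  have h0 := normHr_nonneg fun r => a' r - a r
  have h3 : inner0 (fun r => e r / r) (fun r => e r / r) ≤ normHr e ^ 2 := by
    rw [normHr_sq, innerH]
    linarith [inner0_self_nonneg (D e)]
  refine le_trans ?_ (mul_le_mul_of_nonneg_left h3 (by positivity))
  rw [inner0_eq, remainderInt, remainderInt, ← integral_sub h1 h2, ← integral_const_mul]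
  refine integral_mono_ae (h1.sub h2) ((he.bdd_div.integrable_mul he.bdd_div).const_mul _) ?_
  filter_upwards [ae_Ioo] with r hr
  have hr0 := hr.1
  have h4 := (le_abs_self _).trans (abs_remainder_sub_le (a r) (a' r) (e r))
  have h5 := (ha'.sub ha).abs_le_normHr ⟨hr.1.le, hr.2.le⟩
  rw [abs_sub_comm] at h5
  have h6 := h4.trans (mul_le_mul_of_nonneg_left h5 (by positivity))
  have h' := mul_le_mul_of_nonneg_right h6 (inv_pos.2 hr0).le
  refine le_of_eq_of_le ?_ (h'.trans (le_of_eq ?_))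
  · field_simp
  · field_simp

/-- The remainder term is controlled by the norms, for a function of small norm. -/
theorem remainderInt_le {a e : ℝ → ℝ} (ha : Lip0 a) (he : Lip0 e) {C : ℝ}
    (hC : ∀ r ∈ I, |a r| ≤ C * √r) (hs : normHr e ^ 2 ≤ 1 / 32) :
    remainderInt a e ≤ 1 / 4 * normHr e ^ 2 + 32 * C ^ 4 * norm0 e ^ 2 := by
  have h1 := ((ha.isBdd_remainder_div he).mul isBdd_id).integrable
  have h3 : inner0 (fun r => e r / r) (fun r => e r / r) ≤ normHr e ^ 2 := by
    rw [normHr_sq, innerH]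
    linarith [inner0_self_nonneg (D e)]
  have h4 : remainderInt a e ≤ 1 / 4 * inner0 (fun r => e r / r) (fun r => e r / r)
      + 32 * C ^ 4 * inner0 e e := by
    have i1 := he.bdd_div.integrable_mul he.bdd_div
    have i2 := he.bdd.integrable_mul he.bdd
    rw [inner0_eq, inner0_eq, ← integral_const_mul, ← integral_const_mul,
      ← integral_add (i1.const_mul _) (i2.const_mul _), remainderInt]
    refine integral_mono_ae h1 ((i1.const_mul _).add (i2.const_mul _)) ?_
    filter_upwards [ae_Ioo] with r hr
    have hr0 := hr.1
    have hrI : r ∈ I := ⟨hr.1.le, hr.2.le⟩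
    have ha2 : a r ^ 2 ≤ C ^ 2 * r := by
      have := pow_le_pow_left₀ (abs_nonneg _) (hC r hrI) 2
      rwa [sq_abs, mul_pow, Real.sq_sqrt hr0.le] at this
    have he2 : e r ^ 2 ≤ 1 / 32 := by
      have := pow_le_pow_left₀ (abs_nonneg _) (he.abs_le_normHr hrI) 2
      rw [sq_abs] at this
      exact this.trans hs
    have h5 : remainder (a r) (e r) ≤ 4 * (C ^ 2 * r + 1 / 32) * e r ^ 2 :=
      (remainder_le _ _).trans (by gcongr)
    -- Young gives 4C²r ≤ 1/8 + 32C⁴r². The constant part totals 1/4, below the 1/2 in the relative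
    -- energy, and r² cancels the singular weight.
    have h6 : 4 * (C ^ 2 * r + 1 / 32) * e r ^ 2
        ≤ (1 / 4 + 32 * C ^ 4 * r ^ 2) * e r ^ 2 := by
      refine mul_le_mul_of_nonneg_right ?_ (sq_nonneg _)
      nlinarith [sq_nonneg (16 * (C ^ 2 * r) - 1)]
    have h' := mul_le_mul_of_nonneg_right (h5.trans h6) (inv_pos.2 hr0).le
    refine le_of_eq_of_le ?_ (h'.trans (le_of_eq ?_))
    · field_simp
    · field_simp
  rw [norm0_sq]
  linarith

/-! ### One step of the scheme -/

section Step

variable {k N : ℕ} {τ : ℝ} {a a' e e' κ : ℝ → ℝ}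

/-- The scheme tested with the increment e' - e, with the polarization identity for `innerH`. -/
theorem scheme_step_eq (hN : 1 ≤ N) (ha : Lip0 a) (he : e ∈ FESpace k N) (he' : e' ∈ FESpace k N)
    (hκ : IsBdd κ)
    (h : ∀ v ∈ FESpace k N, inner0 (fun r => (e' r - e r) / τ) v + innerH e' v
      = inner0 (fun r => (nonlin (a r + e r) - nonlin (a r)) / r ^ 2 + κ r) v) :
    norm0 (fun r => e' r - e r) ^ 2 / τ + normHr e' ^ 2 / 2 - normHr e ^ 2 / 2
        + normHr (fun r => e' r - e r) ^ 2 / 2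
      = inner0 (fun r => (nonlin (a r + e r) - nonlin (a r)) / r ^ 2) (fun r => e' r - e r)
        + inner0 κ (fun r => e' r - e r) := by
  have hL := FESpace.lip0 hN he
  have hL' := FESpace.lip0 hN he'
  have hη := hL'.sub hL
  have hX : IsBdd fun r => (nonlin (a r + e r) - nonlin (a r)) / r ^ 2 := by
    simp only [sub_div]
    exact (ha.add hL).isBdd_nonlin_div.sub ha.isBdd_nonlin_div
  have h1 := h _ (FESpace.sub he' he)
  rw [inner0_add_left hX hκ hη.bdd] at h1
  rw [← h1, norm0_sq, normHr_sq, normHr_sq, normHr_sq]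
  have e1 : (fun r => (e' r - e r) / τ) = fun r => τ⁻¹ * (e' r - e r) := by ext r; ring
  have e2 := innerH_sub_left hL' hL hη
  have e3 := innerH_sub_left hL' hL hL'
  have e4 := innerH_sub_left hL' hL hL
  have e5 := innerH_comm e' fun r => e' r - e r
  have e6 := innerH_comm e fun r => e' r - e r
  have e7 := innerH_comm e e'
  rw [e1, inner0_smul_left]
  linear_combination (1 / 2) * e2 - (1 / 2) * e5 - (1 / 2) * e3 - (1 / 2) * e6 - (1 / 2) * e4
    + (1 / 2) * e7

theorem inner0_nonlin_sub_le_normHr {v : ℝ → ℝ} (ha : Lip0 a) (he : Lip0 e) (hv : Lip0 v) :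
    inner0 (fun r => (nonlin (a r + e r) - nonlin (a r)) / r ^ 2) v
      ≤ 2 * normHr e * normHr v := by
  have hX : IsBdd fun r => (nonlin (a r + e r) - nonlin (a r)) / r ^ 2 := by
    simp only [sub_div]
    exact (ha.add he).isBdd_nonlin_div.sub ha.isBdd_nonlin_div
  set Y : ℝ → ℝ := fun r => r * ((nonlin (a r + e r) - nonlin (a r)) / r ^ 2) with hY
  have hYb : IsBdd Y := isBdd_id.mul hX
  have e1 : inner0 (fun r => (nonlin (a r + e r) - nonlin (a r)) / r ^ 2) v
      = inner0 Y fun r => v r / r := by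
    rw [inner0_eq, inner0_eq]
    refine integral_congr_ae ?_
    filter_upwards [ae_Ioo] with r hr
    have := hr.1.ne'
    rw [hY]
    field_simp
  have h1 : norm0 Y ≤ 2 * normHr e := by
    have h2 : norm0 Y ≤ norm0 fun r => 2 * (e r / r) := by
      refine norm0_mono (he.bdd_div.const_mul 2) ?_
      filter_upwards [ae_Ioo] with r hr
      have hr0 := hr.1
      have h3 := abs_nonlin_sub_le (a r + e r) (a r)
      rw [add_sub_cancel_left] at h3
      have e2 : Y r = (nonlin (a r + e r) - nonlin (a r)) / r := by rw [hY]; field_simp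
      rw [e2, abs_mul, abs_div, abs_div, abs_of_pos hr0, abs_of_pos (zero_lt_two' ℝ), ← mul_div_assoc]
      exact div_le_div_of_nonneg_right h3 hr0.le
    rw [norm0_smul, abs_of_pos (zero_lt_two' ℝ)] at h2
    exact h2.trans (mul_le_mul_of_nonneg_left (norm0_div_le_normHr e) zero_le_two)
  rw [e1]
  refine (le_of_abs_le (abs_inner0_le hYb hv.bdd_div)).trans ?_
  exact mul_le_mul h1 (norm0_div_le_normHr v) (norm0_nonneg _)
    (mul_nonneg zero_le_two (normHr_nonneg _))

/-- A crude growth bound, free of smallness and of τ and h, from the global Lipschitz constant 2 of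
`nonlin`. Its only role is to carry smallness to the next step. -/
theorem normHr_step_le (hN : 1 ≤ N) (hτ : 0 < τ) (ha : Lip0 a) (he : e ∈ FESpace k N)
    (he' : e' ∈ FESpace k N) (hκ : IsBdd κ)
    (h : ∀ v ∈ FESpace k N, inner0 (fun r => (e' r - e r) / τ) v + innerH e' v
      = inner0 (fun r => (nonlin (a r + e r) - nonlin (a r)) / r ^ 2 + κ r) v) :
    normHr e' ≤ 3 * normHr e + norm0 κ := by
  have hL := FESpace.lip0 hN he
  have hη := (FESpace.lip0 hN he').sub hL
  have h0 := scheme_step_eq hN ha he he' hκ h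
  have h1 := inner0_nonlin_sub_le_normHr ha hL hη
  have h2 := le_of_abs_le (abs_inner0_le hκ hη.bdd)
  have h3 := mul_le_mul_of_nonneg_left hη.norm0_le_normHr (norm0_nonneg κ)
  have h4 : 0 ≤ norm0 (fun r => e' r - e r) ^ 2 / τ := by positivity
  have h5 := normHr_nonneg e
  have h6 := norm0_nonneg κ
  refine abs_le_of_sq_le_sq' ?_ (by positivity) |>.2
  nlinarith [sq_nonneg (normHr (fun r => e' r - e r) - (2 * normHr e + norm0 κ)),
    mul_nonneg h5 h6, sq_nonneg (normHr e)]

/-- The relative energy. -/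
noncomputable def relEnergy (K : ℝ) (a e : ℝ → ℝ) : ℝ :=
  normHr e ^ 2 / 2 - remainderInt a e + K * norm0 e ^ 2

/-- Convexity makes the nonlinear term a decrease of the Taylor remainder at the fixed base point a;
moving to a' costs the distance times ‖e'‖². Growth of the L²_r term and the defect are absorbed in
‖e' - e‖²/τ, at price τ. The 36 and 19 come from ‖e'‖² ≤ 18‖e‖² + 2‖κ‖². -/
theorem relEnergy_step_le (hN : 1 ≤ N) (hτ : 0 < τ) {K : ℝ} (hK : 0 ≤ K) (ha : Lip0 a)
    (ha' : Lip0 a') (he : e ∈ FESpace k N) (he' : e' ∈ FESpace k N) (hκ : IsBdd κ)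
    (h : ∀ v ∈ FESpace k N, inner0 (fun r => (e' r - e r) / τ) v + innerH e' v
      = inner0 (fun r => (nonlin (a r + e r) - nonlin (a r)) / r ^ 2 + κ r) v) :
    relEnergy K a' e' ≤ relEnergy K a e
      + (36 * normHr (fun r => a' r - a r) + (19 * K ^ 2 + 1) * τ) * (normHr e ^ 2 + norm0 κ ^ 2) := by
  have hL := FESpace.lip0 hN he
  have hL' := FESpace.lip0 hN he'
  have hη := hL'.sub hL
  have h0 := scheme_step_eq hN ha he he' hκ h
  have h1 := inner0_nonlin_sub_le ha hL hL'
  have h2 := le_of_abs_le (abs_inner0_le hκ hη.bdd)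
  have h3 := normHr_step_le hN hτ ha he he' hκ h
  have h4 := remainderInt_sub_le ha ha' hL'
  have h5 : norm0 e' ≤ norm0 e + norm0 fun r => e' r - e r := by
    have := norm0_add_le hL.bdd hη.bdd
    simpa only [add_sub_cancel] using this
  have h6 := hL.norm0_le_normHr
  have h7 := hL'.norm0_le_normHr
  set b := normHr fun r => a' r - a r
  set x := normHr e
  set x' := normHr e'
  set z := norm0 fun r => e' r - e r
  set q := norm0 κ
  have hb : 0 ≤ b := normHr_nonneg _
  have hx : 0 ≤ x := normHr_nonneg _
  have hx' : 0 ≤ x' := normHr_nonneg _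
  have hz : 0 ≤ z := norm0_nonneg _
  have hq : 0 ≤ q := norm0_nonneg _
  have hy := norm0_nonneg e
  have hy' := norm0_nonneg e'
  have hd : norm0 e' ^ 2 - norm0 e ^ 2 ≤ z * (x' + x) := by
    have : norm0 e' ^ 2 - norm0 e ^ 2 = (norm0 e' - norm0 e) * (norm0 e' + norm0 e) := by ring
    rw [this]
    exact mul_le_mul (by linarith) (by linarith) (by linarith) hz
  have hx2 : x' ^ 2 ≤ 18 * x ^ 2 + 2 * q ^ 2 := by
    have := pow_le_pow_left₀ hx' h3 2
    nlinarith [sq_nonneg (3 * x - q)]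
  have hyoung : (q + K * (x' + x)) * z ≤ z ^ 2 / τ + τ / 2 * q ^ 2 + τ * K ^ 2 * (x' ^ 2 + x ^ 2) := by
    have e1 : z ^ 2 / τ = τ * (z / τ) ^ 2 := by field_simp
    have e2 : (q + K * (x' + x)) * z = τ * ((q + K * (x' + x)) * (z / τ)) := by field_simp
    rw [e1, e2]
    have : (q + K * (x' + x)) * (z / τ) ≤ (z / τ) ^ 2 + (q ^ 2 / 2 + K ^ 2 * (x' ^ 2 + x ^ 2)) := by
      nlinarith [sq_nonneg (z / τ - (q + K * (x' + x)) / 2), sq_nonneg (q - K * (x' + x)),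
        mul_nonneg (sq_nonneg K) (sq_nonneg (x' - x))]
    have := mul_le_mul_of_nonneg_left this hτ.le
    linarith
  have hKd := mul_le_mul_of_nonneg_left hd hK
  have g1 := mul_le_mul_of_nonneg_left hx2 hb
  have g2 := mul_le_mul_of_nonneg_left hx2 (show 0 ≤ τ * K ^ 2 by positivity)
  have g3 : 0 ≤ τ * K ^ 2 * q ^ 2 := by positivity
  have g4 : 0 ≤ b * q ^ 2 := by positivity
  have g5 : 0 ≤ τ * x ^ 2 := by positivity
  have g6 : 0 ≤ τ * q ^ 2 := by positivity
  have g7 : 0 ≤ normHr (fun r => e' r - e r) ^ 2 := sq_nonneg _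
  simp only [relEnergy]
  nlinarith

end Step

/-! ### A discrete Gronwall inequality with a continuation argument -/

/-- Coercivity x² ≤ 4E holds only while x² ≤ 1/32, so the induction carries smallness along with
Gronwall's bound. The bound at step j together with the crude growth gives x ≤ 1/6 at step j + 1,
and 1/36 < 1/32. -/
theorem gronwall_continuation {J : ℕ} {x E α : ℕ → ℝ} {s A Q : ℝ} (hx : ∀ j, 0 ≤ x j)
    (hα : ∀ j, 0 ≤ α j) (hs : 0 ≤ s) (hQ : 0 ≤ Q)
    (h1 : ∀ j < J, x (j + 1) ≤ 3 * x j + s)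
    (h2 : ∀ j < J, E (j + 1) ≤ E j + α j * (x j ^ 2 + s ^ 2))
    (h3 : ∀ j ≤ J, x j ^ 2 ≤ 1 / 32 → x j ^ 2 ≤ 4 * E j)
    (h4 : E 0 ≤ Q * x 0 ^ 2) (hA : ∑ j ∈ Finset.range J, α j ≤ A)
    (hsmall : 3 * (4 * exp (4 * A) * (Q + 1) * (x 0 + s)) + s ≤ 1 / 6) :
    ∀ j ≤ J, x j ≤ 4 * exp (4 * A) * (Q + 1) * (x 0 + s) := by
  set B : ℝ := 4 * exp (4 * A) * (Q + 1) with hB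
  have hA0 : 0 ≤ A := (Finset.sum_nonneg fun j _ => hα j).trans hA
  have hexp : 1 ≤ exp (4 * A) := one_le_exp (by positivity)
  have hB1 : 1 ≤ B := by nlinarith
  have hx0 := hx 0
  have hsq : ∀ y : ℝ, 0 ≤ y → y ≤ 1 / 6 → y ^ 2 ≤ 1 / 32 := fun y h0 h => by nlinarith
  have hP : ∀ j ≤ J, x j ^ 2 ≤ 1 / 32 →
      E j + s ^ 2 ≤ exp (4 * ∑ i ∈ Finset.range j, α i) * (Q * x 0 ^ 2 + s ^ 2) →
      x j ≤ B * (x 0 + s) := by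
    intro j hj hj1 hj2
    refine abs_le_of_sq_le_sq' ?_ (by positivity) |>.2
    have h5 : exp (4 * ∑ i ∈ Finset.range j, α i) ≤ exp (4 * A) := by
      refine exp_le_exp.2 (mul_le_mul_of_nonneg_left (le_trans ?_ hA) (by norm_num))
      exact Finset.sum_le_sum_of_subset_of_nonneg (Finset.range_mono hj) fun i _ _ => hα i
    have h6 : 0 ≤ Q * x 0 ^ 2 + s ^ 2 := by positivity
    have h7 : Q * x 0 ^ 2 + s ^ 2 ≤ (Q + 1) * (x 0 + s) ^ 2 := by
      nlinarith [mul_nonneg hx0 hs, mul_nonneg hQ (mul_nonneg hx0 hs),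
        mul_nonneg hQ (sq_nonneg s), sq_nonneg (x 0)]
    have h8 := h3 j hj hj1
    have h9 : 4 * (E j + s ^ 2) ≤ B * (x 0 + s) ^ 2 := by
      calc 4 * (E j + s ^ 2) ≤ 4 * (exp (4 * A) * ((Q + 1) * (x 0 + s) ^ 2)) := by
            refine mul_le_mul_of_nonneg_left (hj2.trans ?_) (by norm_num)
            exact mul_le_mul h5 h7 h6 (exp_pos _).le
        _ = B * (x 0 + s) ^ 2 := by rw [hB]; ring
    have h10 : B * (x 0 + s) ^ 2 ≤ (B * (x 0 + s)) ^ 2 := by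
      rw [mul_pow]
      exact mul_le_mul_of_nonneg_right (by nlinarith) (sq_nonneg _)
    linarith [sq_nonneg s]
  have hmain : ∀ j ≤ J, x j ^ 2 ≤ 1 / 32 ∧
      E j + s ^ 2 ≤ exp (4 * ∑ i ∈ Finset.range j, α i) * (Q * x 0 ^ 2 + s ^ 2) := by
    intro j
    induction j with
    | zero =>
      intro _
      refine ⟨hsq _ hx0 ?_, by simpa using h4⟩
      nlinarith
    | succ j ih =>
      intro hj
      obtain ⟨i1, i2⟩ := ih (by omega)
      have hb := hP j (by omega) i1 i2
      have hE := h3 j (by omega) i1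
      have hE0 : 0 ≤ E j := by linarith [sq_nonneg (x j)]
      refine ⟨hsq _ (hx _) ((h1 j (by omega)).trans (by linarith)), ?_⟩
      have h5 := h2 j (by omega)
      have h6 := add_one_le_exp (4 * α j)
      rw [Finset.sum_range_succ, mul_add (4 : ℝ), exp_add, mul_right_comm]
      refine le_trans ?_ (mul_le_mul_of_nonneg_right i2 (exp_pos _).le)
      have h7 : E (j + 1) + s ^ 2 ≤ (E j + s ^ 2) * (4 * α j + 1) := by
        have h8 := mul_le_mul_of_nonneg_left hE (hα j)
        have h9 := mul_nonneg (hα j) (sq_nonneg s)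
        linarith
      exact h7.trans (mul_le_mul_of_nonneg_left h6 (by positivity))
  exact fun j hj => hP j hj (hmain j hj).1 (hmain j hj).2

/-! ### Energy stability of the scheme -/

theorem energy_eq {v : ℝ → ℝ} (hv : Lip0 v) :
    energy v = normHr v ^ 2 / 2 - remainderInt (fun _ => 0) v := by
  have i1 : Integrable (fun r => D v r * D v r * r + v r / r * (v r / r) * r) volI :=
    (hv.bddD.integrable_mul hv.bddD).add (hv.bdd_div.integrable_mul hv.bdd_div)
  have i2 := ((lip0_zero.isBdd_remainder_div hv).mul isBdd_id).integrable
  rw [energy, integral_eq_volI, normHr_sq, innerH_self_eq hv, remainderInt,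
    ← integral_const_mul, ← integral_div, ← integral_sub (i1.div_const _) i2]
  refine integral_congr_ae ?_
  filter_upwards [ae_Ioo] with r hr
  have := hr.1.ne'
  simp only [remainder, potential, nonlin_zero, zero_add, sin_zero, zero_mul]
  field_simp
  ring

theorem normHr_D_sq_le_energy {v : ℝ → ℝ} (hv : Lip0 v) : norm0 (D v) ^ 2 ≤ 2 * energy v := by
  have i1 := hv.bddD.integrable_mul hv.bddD
  have i2 : Integrable (fun r => remainder 0 (v r) / r ^ 2 * r) volI :=
    ((lip0_zero.isBdd_remainder_div hv).mul isBdd_id).integrable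
  have i3 := hv.bdd_div.integrable_mul hv.bdd_div
  have h : 2 * remainderInt (fun _ => 0) v ≤ inner0 (fun r => v r / r) fun r => v r / r := by
    rw [remainderInt, inner0_eq, ← integral_const_mul]
    refine integral_mono_ae (i2.const_mul 2) i3 ?_
    filter_upwards [ae_Ioo] with r hr
    have hr0 := hr.1
    have e1 : 2 * (remainder 0 (v r) / r ^ 2 * r) = (v r ^ 2 - sin (v r) ^ 2) / r := by
      simp only [remainder, potential, nonlin_zero, zero_add, sin_zero]
      field_simp
      ring
    have e2 : v r / r * (v r / r) * r = v r ^ 2 / r := by field_simp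
    rw [e1, e2]
    exact div_le_div_of_nonneg_right (by linarith [sq_nonneg (sin (v r))]) hr0.le
  rw [energy_eq hv, normHr_sq, norm0_sq, innerH]
  linarith

/-- Convex splitting: the identity for one step with base point 0 and no defect, and the tangent
inequality for the potential. -/
theorem IsDiscreteSolution.energy_le {k N J : ℕ} {τ : ℝ} (hN : 1 ≤ N) (hτ : 0 < τ)
    {uh : ℕ → ℝ → ℝ} (h : IsDiscreteSolution k N J τ uh) : ∀ j ≤ J, energy (uh j) ≤ energy (uh 0) := by
  intro j
  induction j with
  | zero => exact fun _ => le_rfl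
  | succ j ih =>
    intro hj
    refine le_trans ?_ (ih (by omega))
    have hm := h.mem j (by omega)
    have hm' := h.mem (j + 1) hj
    have hL := FESpace.lip0 hN hm
    have hL' := FESpace.lip0 hN hm'
    have h1 := scheme_step_eq hN lip0_zero hm hm' (isBdd_const 0) (fun v hv => by
      simpa only [zero_add, nonlin_zero, sub_zero, add_zero] using h.scheme j (by omega) v hv)
    have h2 := inner0_nonlin_sub_le lip0_zero hL hL'
    have h3 : inner0 (fun _ => 0) (fun r => uh (j + 1) r - uh j r) = 0 := by simp [inner0]
    have h4 : 0 ≤ norm0 (fun r => uh (j + 1) r - uh j r) ^ 2 / τ := by positivity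
    have h5 := sq_nonneg (normHr fun r => uh (j + 1) r - uh j r)
    rw [energy_eq hL, energy_eq hL']
    linarith

theorem IsDiscreteSolution.norm0_D_le {k N J : ℕ} {τ : ℝ} (hN : 1 ≤ N) (hτ : 0 < τ)
    {uh : ℕ → ℝ → ℝ} (h : IsDiscreteSolution k N J τ uh) (h0 : energy (uh 0) ≤ 2) {j : ℕ}
    (hj : j ≤ J) : norm0 (D (uh j)) ≤ 2 := by
  have h1 := h.energy_le hN hτ j hj
  have h2 := normHr_D_sq_le_energy (FESpace.lip0 hN (h.mem j hj))
  exact abs_le_of_sq_le_sq' (by linarith) (by norm_num) |>.2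

/-! ### The error estimate for small data -/

section Consistency

variable {k : ℕ} {T M : ℝ} {u₀ : ℝ → ℝ} {u ut utt : ℝ → ℝ → ℝ}

theorem norm0_nonlin_div_le {v : ℝ → ℝ} {M : ℝ} (hM : 0 ≤ M) (hv : ∀ r ∈ I, |v r| ≤ M * r) :
    norm0 (fun r => nonlin (v r) / r ^ 2) ≤ 2 * M ^ 3 := by
  refine norm0_le_of_bound (by positivity) ?_
  filter_upwards [ae_Ioo] with r hr
  have hr0 := hr.1
  rw [abs_div, abs_of_nonneg (sq_nonneg r), div_le_iff₀ (by positivity)]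
  have h1 := pow_le_pow_left₀ (abs_nonneg _) (hv r ⟨hr.1.le, hr.2.le⟩) 3
  have h2 : r ^ 3 ≤ r ^ 2 := pow_le_pow_of_le_one hr0.le hr.2.le (by norm_num)
  have h3 : M ^ 3 * r ^ 3 ≤ M ^ 3 * r ^ 2 := mul_le_mul_of_nonneg_left h2 (by positivity)
  rw [mul_pow] at h1
  linarith [abs_nonlin_le (v r)]

theorem norm0_nonlin_div_sub_le {v w : ℝ → ℝ} {M : ℝ} (hvL : Lip0 v) (hwL : Lip0 w)
    (hv : ∀ r ∈ I, |v r| ≤ M * r) (hw : ∀ r ∈ I, |w r| ≤ M * r) :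
    norm0 (fun r => nonlin (v r) / r ^ 2 - nonlin (w r) / r ^ 2)
      ≤ 2 * M ^ 2 * norm0 (fun r => v r - w r) := by
  have h := norm0_smul (2 * M ^ 2) fun r => v r - w r
  rw [abs_of_nonneg (by positivity)] at h
  rw [← h]
  refine norm0_mono ((hvL.sub hwL).bdd.const_mul _) ?_
  filter_upwards [ae_Ioo] with r hr
  have hr0 := hr.1
  have hrI : r ∈ I := ⟨hr.1.le, hr.2.le⟩
  rw [← sub_div, abs_div, abs_of_nonneg (sq_nonneg r), div_le_iff₀ (by positivity), abs_mul,
    abs_of_nonneg (show 0 ≤ 2 * M ^ 2 by positivity)]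
  exact (abs_nonlin_sub_le_of_abs_le (hv r hrI) (hw r hrI)).trans (le_of_eq (by ring))

/-- The √r bounds make the slope of `nonlin` O(r), so only one power 1/r remains on v - w, which the
Hardy part of the norm absorbs. -/
theorem norm0_nonlin_div_sub_le_normHr {v w : ℝ → ℝ} {C : ℝ} (hvL : Lip0 v) (hwL : Lip0 w)
    (hv : ∀ r ∈ I, |v r| ≤ C * √r) (hw : ∀ r ∈ I, |w r| ≤ C * √r) :
    norm0 (fun r => nonlin (v r) / r ^ 2 - nonlin (w r) / r ^ 2)
      ≤ 2 * C ^ 2 * normHr (fun r => v r - w r) := by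
  have h := norm0_smul (2 * C ^ 2) fun r => (v r - w r) / r
  rw [abs_of_nonneg (by positivity)] at h
  refine le_trans ?_ (mul_le_mul_of_nonneg_left (norm0_div_le_normHr fun r => v r - w r)
    (by positivity))
  rw [← h]
  refine norm0_mono ((hvL.sub hwL).bdd_div.const_mul _) ?_
  filter_upwards [ae_Ioo] with r hr
  have hr0 := hr.1
  have hrI : r ∈ I := ⟨hr.1.le, hr.2.le⟩
  rw [← sub_div, abs_div, abs_of_nonneg (sq_nonneg r), div_le_iff₀ (by positivity), abs_mul,
    abs_of_nonneg (show 0 ≤ 2 * C ^ 2 by positivity), abs_div, abs_of_pos hr0]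
  refine (abs_nonlin_sub_le_of_abs_le (hv r hrI) (hw r hrI)).trans (le_of_eq ?_)
  rw [mul_pow, Real.sq_sqrt hr0.le]
  field_simp

/-- Inserting the equation at time b > 0 leaves the truncation error of the difference quotient and
the time lag of the explicitly evaluated nonlinearity. -/
theorem HasRegularity.norm0_defect_le (hT : 0 < T) (hs : IsSolution T u₀ u ut)
    (h : HasRegularity k T M u ut utt) {a b : ℝ} (ha : 0 ≤ a) (hab : a < b) (hb : b ≤ T) :
    norm0 (fun r => (u b r - u a r) / (b - a) + ellOp (u b) r - nonlin (u a r) / r ^ 2)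
      ≤ (M + 2 * M ^ 3 * (1 + T)) * (b - a) := by
  have hM := h.nonneg hT
  have haT : a ∈ Icc 0 T := ⟨ha, hab.le.trans hb⟩
  have hbT : b ∈ Icc 0 T := ⟨ha.trans hab.le, hb⟩
  have hLa := h.lip0 hT hs haT
  have hLb := h.lip0 hT hs hbT
  have h1 := h.norm0_truncation_le hT hs ha hab hb
  have h2 := norm0_nonlin_div_sub_le hLb hLa (fun r hr => h.abs_le hT hs hbT hr)
    (fun r hr => h.abs_le hT hs haT hr)
  have h3 := mul_le_mul_of_nonneg_left (h.norm0_sub_le hT hs ha hab hb)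
    (show 0 ≤ 2 * M ^ 2 by positivity)
  have hb1 : IsBdd fun r => (u b r - u a r) / (b - a) - ut b r :=
    isBdd_of_continuousOn ((((hLb.continuousOn).sub hLa.continuousOn).div_const _).sub
      (h.continuousOn_time hbT))
  have hb2 := hLb.isBdd_nonlin_div.sub hLa.isBdd_nonlin_div
  refine le_trans (norm0_mono (hb1.add hb2) ?_) ((norm0_add_le hb1 hb2).trans ?_)
  · filter_upwards [ae_Ioo] with r hr
    rw [hs.ellOp_eq ⟨ha.trans_lt hab, hb⟩ hr]
    exact le_of_eq (congrArg abs (by ring))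
  · linarith

end Consistency

/-- The comparison functions for the exact solution. -/
theorem exists_comparison {k : ℕ} (hk : 1 ≤ k) {T M : ℝ} (hT : 0 < T) (hM : 0 ≤ M) :
    ∃ C : ℝ, 0 < C ∧ ∀ (u₀ : ℝ → ℝ) (u ut utt : ℝ → ℝ → ℝ), IsSolution T u₀ u ut →
      HasRegularity k T M u ut utt → ∀ N J : ℕ, 1 ≤ N → ∀ τ : ℝ, 0 < τ → J * τ ≤ T →
      ∃ U : ℕ → ℝ → ℝ, (∀ j, U j ∈ FESpace k N) ∧
        (∀ j < J, ∀ v ∈ FESpace k N, inner0 (fun r => (U (j + 1) r - U j r) / τ) v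
          + innerH (U (j + 1)) v = inner0 (fun r => nonlin (u (j * τ) r) / r ^ 2) v) ∧
        (∀ j ≤ J, normHr (fun r => U j r - u (j * τ) r) ≤ C * (τ + (1 / N) ^ k)) ∧
        (∀ j ≤ J, ∀ r ∈ I, |U j r| ≤ C * √r) ∧
        ∑ j ∈ Finset.range J, normHr (fun r => U (j + 1) r - U j r) ≤ C := by
  -- A common bound for the elliptic term (2M), the load (2M³), its increments, the defect and the
  -- approximation error (4M).
  set K : ℝ := 7 * M + 2 * M ^ 3 * (2 + T) with hK
  have hK0 : 0 ≤ K := by positivity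
  have hM3 : 0 ≤ M ^ 3 := by positivity
  have hM3T : 0 ≤ M ^ 3 * T := by positivity
  obtain ⟨C, hC0, hC⟩ := exists_linear_comparison hk hT hK0
  refine ⟨C, hC0, fun u₀ u ut utt hs h N J hN τ hτ hJ => ?_⟩
  have ht : ∀ j ≤ J, (j : ℝ) * τ ∈ Icc 0 T := fun j hj =>
    ⟨by positivity, (mul_le_mul_of_nonneg_right (by exact_mod_cast hj) hτ.le).trans hJ⟩
  have hstep : ∀ j : ℕ, ((j + 1 : ℕ) : ℝ) * τ - j * τ = τ := fun j => by push_cast; ring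
  have hlt : ∀ j : ℕ, (j : ℝ) * τ < ((j + 1 : ℕ) : ℝ) * τ := fun j => by linarith [hstep j]
  have hL : ∀ j ≤ J, Lip0 (u (j * τ)) := fun j hj => h.lip0 hT hs (ht j hj)
  have habs : ∀ j ≤ J, ∀ r ∈ I, |u (j * τ) r| ≤ M * r := fun j hj r hr => h.abs_le hT hs (ht j hj) hr
  have hprops := fun j (hj : j ≤ J) => h.ellOp_props hk hT hs (ht j hj)
  refine hC N J hN τ hτ hJ (fun j => u (j * τ)) (fun j => ellOp (u (j * τ)))
    (fun j r => nonlin (u (j * τ) r) / r ^ 2) hL (fun j hj => (hprops j hj).1)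
    (fun j hj => (hL j hj).isBdd_nonlin_div) (fun j hj => (hprops j hj).2.2) ?_ (fun j hj => ?_)
    (fun j hj => ?_) (fun j hj => ?_) (fun j hj => ?_)
  · exact (hprops 0 (Nat.zero_le _)).2.1.trans (by linarith)
  · exact (norm0_nonlin_div_le hM (habs j hj)).trans (by linarith)
  · have h1 := norm0_nonlin_div_sub_le (hL (j + 1) hj) (hL j hj.le) (habs (j + 1) hj) (habs j hj.le)
    have h2 := h.norm0_sub_le hT hs (ht j hj.le).1 (hlt j) (ht (j + 1) hj).2
    rw [hstep] at h2
    refine h1.trans ((mul_le_mul_of_nonneg_left h2 (by positivity)).trans ?_)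
    rw [show 2 * M ^ 2 * (τ * ((1 + T) * M)) = 2 * M ^ 3 * (1 + T) * τ by ring]
    exact mul_le_mul_of_nonneg_right (by linarith) hτ.le
  · have h1 := h.norm0_defect_le hT hs (ht j hj.le).1 (hlt j) (ht (j + 1) hj).2
    rw [hstep] at h1
    refine h1.trans (mul_le_mul_of_nonneg_right (by linarith) hτ.le)
  · have hmem := h.mem_space _ (ht j hj)
    obtain ⟨χ, hχ, hχ'⟩ := FESpace.exists_approx hk hN hM (hL j hj) hmem.1
      (h.ae_abs_Dn_le (ht j hj) le_rfl)
    refine ⟨χ, hχ, hχ'.trans (mul_le_mul_of_nonneg_right (by linarith) (by positivity))⟩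

theorem exists_error_estimate_of_small {k : ℕ} (hk : 1 ≤ k) {T : ℝ} (hT : 0 < T) (M : ℝ) :
    ∃ C δ : ℝ, 0 < C ∧ 0 < δ ∧ ∀ (u₀ : ℝ → ℝ) (u ut utt : ℝ → ℝ → ℝ), IsSolution T u₀ u ut →
      HasRegularity k T M u ut utt → ∀ N J : ℕ, 1 ≤ N → ∀ τ : ℝ, 0 < τ → J * τ ≤ T →
      ∀ uh : ℕ → ℝ → ℝ, IsDiscreteSolution k N J τ uh →
      τ + (1 / N) ^ k + normHr (fun r => u₀ r - uh 0 r) ≤ δ → ∀ j ≤ J,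
        normHr (fun r => uh j r - u (j * τ) r)
          ≤ C * (τ + (1 / N) ^ k + normHr (fun r => u₀ r - uh 0 r)) := by
  rcases lt_or_ge M 0 with hM | hM
  -- The regularity assumption forces M ≥ 0, so negative M is vacuous.
  · exact ⟨1, 1, one_pos, one_pos, fun u₀ u ut utt _ h => absurd (h.nonneg hT) (not_le.2 hM)⟩
  obtain ⟨C, hC0, hC⟩ := exists_comparison hk hT hM
  -- Equals the L²_r coefficient in `remainderInt_le`, so that the relative energy is at least a
  -- quarter of the squared norm.
  set K : ℝ := 32 * C ^ 4 with hK
  set A : ℝ := 36 * C + (19 * K ^ 2 + 1) * T with hA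
  set B : ℝ := 4 * exp (4 * A) * (1 + K + 1) with hB
  set C' : ℝ := 2 * (C + M) ^ 2 * C with hC'
  have hK0 : 0 < K := by positivity
  have hB0 : 0 < B := by positivity
  have hC'0 : 0 < C' := by positivity
  set Q : ℝ := 3 * (B * (1 + C + C')) + C' with hQ
  have hQ0 : 0 < Q := by positivity
  -- The threshold is what the smallness hypothesis of `gronwall_continuation` demands once its data
  -- are bounded by (1 + C + C') times the total data size.
  refine ⟨B * (1 + C + C') + C, 1 / (6 * Q), by positivity, by positivity, ?_⟩
  intro u₀ u ut utt hs h N J hN τ hτ hJ uh huh hδ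
  obtain ⟨U, hU, hUs, hUu, hUr, hUd⟩ := hC u₀ u ut utt hs h N J hN τ hτ hJ
  have ht : ∀ j ≤ J, (j : ℝ) * τ ∈ Icc 0 T := fun j hj =>
    ⟨by positivity, (mul_le_mul_of_nonneg_right (by exact_mod_cast hj) hτ.le).trans hJ⟩
  have hLu : ∀ j ≤ J, Lip0 (u (j * τ)) := fun j hj => h.lip0 hT hs (ht j hj)
  have hLU := fun j => FESpace.lip0 hN (hU j)
  have hLh := fun j hj => FESpace.lip0 hN (huh.mem j hj)
  set σ : ℝ := τ + (1 / N) ^ k with hσ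
  have hσ0 : 0 < σ := by positivity
  set η := normHr fun r => u₀ r - uh 0 r with hη
  have hη0 : 0 ≤ η := normHr_nonneg _
  set ε : ℕ → ℝ → ℝ := fun j r => uh j r - U j r with hε
  have hεm : ∀ j ≤ J, ε j ∈ FESpace k N := fun j hj => FESpace.sub (huh.mem j hj) (hU j)
  have hεL : ∀ j ≤ J, Lip0 (ε j) := fun j hj => FESpace.lip0 hN (hεm j hj)
  set κ : ℕ → ℝ → ℝ := fun j r => nonlin (U j r) / r ^ 2 - nonlin (u (j * τ) r) / r ^ 2 with hκ
  have hκb : ∀ j ≤ J, IsBdd (κ j) := fun j hj =>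
    (hLU j).isBdd_nonlin_div.sub (hLu j hj).isBdd_nonlin_div
  have hκn : ∀ j ≤ J, norm0 (κ j) ≤ C' * σ := by
    intro j hj
    refine (norm0_nonlin_div_sub_le_normHr (C := C + M) (hLU j) (hLu j hj) (fun r hr => ?_)
      (fun r hr => ?_)).trans ?_
    · refine (hUr j hj r hr).trans (mul_le_mul_of_nonneg_right (by linarith) (Real.sqrt_nonneg r))
    · refine (h.abs_le hT hs (ht j hj) hr).trans ?_
      have : r ≤ √r := Real.le_sqrt_of_sq_le (by nlinarith [hr.1, hr.2])
      exact mul_le_mul (by linarith) this hr.1 (by positivity)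
    · rw [hC', mul_assoc (2 * (C + M) ^ 2)]
      exact mul_le_mul_of_nonneg_left (hUu j hj) (by positivity)
  have hscheme : ∀ j < J, ∀ v ∈ FESpace k N,
      inner0 (fun r => (ε (j + 1) r - ε j r) / τ) v + innerH (ε (j + 1)) v
        = inner0 (fun r => (nonlin (U j r + ε j r) - nonlin (U j r)) / r ^ 2 + κ j r) v := by
    intro j hj v hv
    have hvL := FESpace.lip0 hN hv
    have h1 := huh.scheme j hj v hv
    have h2 := hUs j hj v hv
    have q : ∀ {a b : ℝ → ℝ}, Lip0 a → Lip0 b → IsBdd fun r => (a r - b r) / τ := fun ha hb =>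
      (((ha.sub hb).bdd.const_mul τ⁻¹)).congr (Filter.Eventually.of_forall fun r => by ring)
    have e1 : (fun r => (ε (j + 1) r - ε j r) / τ)
        = fun r => (uh (j + 1) r - uh j r) / τ - (U (j + 1) r - U j r) / τ := by
      ext r; simp only [hε]; ring
    have e2 : (fun r => (nonlin (U j r + ε j r) - nonlin (U j r)) / r ^ 2 + κ j r)
        = fun r => nonlin (uh j r) / r ^ 2 - nonlin (u (j * τ) r) / r ^ 2 := by
      ext r
      simp only [hε, hκ, add_sub_cancel]
      ring
    rw [e1, e2, inner0_sub_left (q (hLh _ hj) (hLh _ hj.le)) (q (hLU _) (hLU _)) hvL.bdd,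
      inner0_sub_left (hLh _ hj.le).isBdd_nonlin_div (hLu _ hj.le).isBdd_nonlin_div hvL.bdd,
      innerH_sub_left (hLh _ hj) (hLU _) hvL]
    linarith
  have hε0 : normHr (ε 0) ≤ η + C * σ := by
    have h1 := normHr_sub_le (hLh 0 (Nat.zero_le _)) (hLu 0 (Nat.zero_le _)) (hLU 0)
    have h2 := hUu 0 (Nat.zero_le _)
    rw [normHr_sub_comm] at h2
    have h3 : normHr (fun r => uh 0 r - u ((0 : ℕ) * τ) r) = η := by
      rw [normHr_sub_comm, hη]
      refine normHr_congr fun r hr => ?_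
      rw [Nat.cast_zero, zero_mul, hs.initial r hr]
    linarith
  have hsum : normHr (ε 0) + C' * σ ≤ (1 + C + C') * (σ + η) := by
    have p1 : 0 ≤ C * η := by positivity
    have p2 : 0 ≤ C' * η := by positivity
    linarith
  have hδ' : Q * (σ + η) ≤ 1 / 6 := by
    refine (mul_le_mul_of_nonneg_left hδ hQ0.le).trans (le_of_eq ?_)
    field_simp
  have hBsum := mul_le_mul_of_nonneg_left hsum hB0.le
  have key := gronwall_continuation (J := J) (x := fun j => normHr (ε j))
    (E := fun j => relEnergy K (U j) (ε j))
    (α := fun j => 36 * normHr (fun r => U (j + 1) r - U j r) + (19 * K ^ 2 + 1) * τ)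
    (s := C' * σ) (A := A) (Q := 1 + K) (fun j => normHr_nonneg _)
    (fun j => by have := normHr_nonneg (fun r => U (j + 1) r - U j r); positivity)
    (by positivity) (by positivity) (fun j hj => ?_) (fun j hj => ?_) (fun j hj hsm => ?_) ?_ ?_ ?_
  · intro j hj
    have h1 := normHr_sub_le (hLh j hj) (hLU j) (hLu j hj)
    have h2 := hUu j hj
    have h3 : normHr (ε j) ≤ B * (normHr (ε 0) + C' * σ) := key j hj
    have p1 : 0 ≤ C * η := by positivity
    have h4 : normHr (fun r => uh j r - U j r) = normHr (ε j) := rfl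
    rw [h4] at h1
    linarith
  · have h1 := normHr_step_le hN hτ (hLU j) (hεm j hj.le) (hεm (j + 1) hj) (hκb j hj.le)
      (hscheme j hj)
    have h2 := hκn j hj.le
    linarith
  · have h1 := relEnergy_step_le hN hτ hK0.le (hLU j) (hLU (j + 1)) (hεm j hj.le) (hεm (j + 1) hj)
      (hκb j hj.le) (hscheme j hj)
    refine h1.trans (add_le_add le_rfl (mul_le_mul_of_nonneg_left ?_ ?_))
    · exact add_le_add le_rfl (pow_le_pow_left₀ (norm0_nonneg _) (hκn j hj.le) 2)
    · have := normHr_nonneg (fun r => U (j + 1) r - U j r); positivity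
  · have h1 := remainderInt_le (hLU j) (hεL j hj) (hUr j hj) hsm
    simp only [relEnergy]
    linarith
  · have h1 := remainderInt_nonneg (U 0) (ε 0)
    have h2 := pow_le_pow_left₀ (norm0_nonneg _) (hεL 0 (Nat.zero_le _)).norm0_le_normHr 2
    have h3 := mul_le_mul_of_nonneg_left h2 hK0.le
    have h4 := sq_nonneg (normHr (ε 0))
    simp only [relEnergy]
    linarith
  · rw [Finset.sum_add_distrib, ← Finset.mul_sum, Finset.sum_const, Finset.card_range, nsmul_eq_mul]
    have h1 := mul_le_mul_of_nonneg_left hJ (show 0 ≤ 19 * K ^ 2 + 1 by positivity)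
    linarith
  · have p1 : 0 ≤ C' * η := by positivity
    change 3 * (B * (normHr (ε 0) + C' * σ)) + C' * σ ≤ 1 / 6
    linarith

theorem HasRegularity.norm0_D_le {k : ℕ} {T M : ℝ} {u ut utt : ℝ → ℝ → ℝ} (hT : 0 < T)
    (h : HasRegularity k T M u ut utt) {t : ℝ} (ht : t ∈ Icc 0 T) : norm0 (D (u t)) ≤ M := by
  have := h.ae_abs_Dn_le ht (i := 1) (by omega)
  rw [Dn_one] at this
  exact norm0_le_of_bound (h.nonneg hT) this

end HeatFlow

/-! ### The theorem, by a dichotomy at the smallness threshold -/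

theorem mainTheorem1 (k : ℕ) (hk : 1 ≤ k) (T : ℝ) (hT : 0 < T) (M : ℝ) :
    (∃ C c : ℝ, 0 < C ∧ 0 < c ∧
      ∀ (u₀ : ℝ → ℝ) (u ut utt : ℝ → ℝ → ℝ),
        HeatFlow.IsSolution T u₀ u ut →
        HeatFlow.HasRegularity k T M u ut utt →
        HeatFlow.MemSobolev 2 (k + 1) u₀ →
        u₀ ∈ HeatFlow.energyBall 1 →
        ∀ (N J : ℕ), 1 ≤ N → 1 ≤ J → ∀ (h τ : ℝ), h = 1 / N → τ = T / J →
        ∀ uh : ℕ → ℝ → ℝ,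
          HeatFlow.IsDiscreteSolution k N J τ uh →
          uh 0 ∈ HeatFlow.energyBall 1 →
          ∀ j : ℕ, 1 ≤ j → j ≤ J →
            HeatFlow.norm0 (HeatFlow.D (fun r => uh j r - u (j * τ) r))
              ≤ C * (τ + h ^ k) + c * HeatFlow.normHr (fun r => u₀ r - uh 0 r)) ∧
    (∀ c₀ : ℝ, ∃ C h₀ τ₀ : ℝ, 0 < C ∧ 0 < h₀ ∧ 0 < τ₀ ∧
      ∀ (u₀ : ℝ → ℝ) (u ut utt : ℝ → ℝ → ℝ),
        HeatFlow.IsSolution T u₀ u ut →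
        HeatFlow.HasRegularity k T M u ut utt →
        HeatFlow.MemSobolev 2 (k + 1) u₀ →
        u₀ ∈ HeatFlow.energyBall 1 →
        ∀ (N J : ℕ), 1 ≤ N → 1 ≤ J → ∀ (h τ : ℝ), h = 1 / N → τ = T / J →
        h ≤ h₀ → τ ≤ τ₀ →
        ∀ uh : ℕ → ℝ → ℝ,
          HeatFlow.IsDiscreteSolution k N J τ uh →
          uh 0 ∈ HeatFlow.energyBall 1 →
          HeatFlow.normHr (fun r => u₀ r - uh 0 r) ≤ c₀ * h ^ k →
          ∀ j : ℕ, 1 ≤ j → j ≤ J →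
            HeatFlow.normHr (fun r => uh j r - u (j * τ) r) ≤ C * (τ + h ^ k)) := by
  obtain ⟨C, δ, hC, hδ, hmain⟩ := HeatFlow.exists_error_estimate_of_small hk hT M
  constructor
  -- Above the threshold the energy bounds give an error of at most 2 + |M| = Bδ, which is below B
  -- times the data size.
  · set B : ℝ := (2 + |M|) / δ with hB
    have hB0 : 0 < B := by positivity
    refine ⟨C + B, C + B, by positivity, by positivity, ?_⟩
    intro u₀ u ut utt hs hreg _ _ N J hN hJ h τ hh hτ uh huh hE j _ hj
    have hJ' : (0 : ℝ) < J := by exact_mod_cast hJ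
    have hN' : (0 : ℝ) < N := by exact_mod_cast hN
    have hτ0 : 0 < τ := by rw [hτ]; positivity
    have hJT : J * τ = T := by rw [hτ]; field_simp
    have ht : (j : ℝ) * τ ∈ Icc 0 T := by
      refine ⟨by positivity, ?_⟩
      rw [← hJT]
      exact mul_le_mul_of_nonneg_right (by exact_mod_cast hj) hτ0.le
    have hS0 : 0 ≤ τ + (1 / N : ℝ) ^ k := by positivity
    have hη := HeatFlow.normHr_nonneg fun r => u₀ r - uh 0 r
    rw [hh, ← mul_add]
    rcases le_or_gt (τ + (1 / N) ^ k + HeatFlow.normHr fun r => u₀ r - uh 0 r) δ with h1 | h1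
    · refine (HeatFlow.norm0_D_le_normHr _).trans ?_
      refine (hmain u₀ u ut utt hs hreg N J hN τ hτ0 hJT.le uh huh h1 j hj).trans ?_
      exact mul_le_mul_of_nonneg_right (by linarith) (by positivity)
    · have hLh := HeatFlow.FESpace.lip0 hN (huh.mem j hj)
      have hLu := hreg.lip0 hT hs ht
      have e : HeatFlow.norm0 (HeatFlow.D fun r => uh j r - u (j * τ) r)
          ≤ HeatFlow.norm0 (HeatFlow.D (uh j)) + HeatFlow.norm0 (HeatFlow.D (u (j * τ))) := by
        have h2 := HeatFlow.norm0_add_le hLh.bddD (hLu.bddD.const_mul (-1))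
        rw [HeatFlow.norm0_smul, abs_neg, abs_one, one_mul] at h2
        refine le_trans (HeatFlow.norm0_mono (hLh.bddD.add (hLu.bddD.const_mul (-1))) ?_) h2
        filter_upwards [hLh.D_sub hLu] with r hr
        rw [hr]
        exact le_of_eq (congrArg abs (by ring))
      have h2 := huh.norm0_D_le hN hτ0 (by linarith [hE.2]) hj
      have h3 := hreg.norm0_D_le hT ht
      have h4 : 2 + |M| = B * δ := by rw [hB]; field_simp
      have h5 := mul_le_mul_of_nonneg_left h1.le hB0.le
      have h6 : 0 ≤ C * (τ + (1 / N) ^ k + HeatFlow.normHr fun r => u₀ r - uh 0 r) := by positivity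
      linarith [le_abs_self M]
  · intro c₀
    -- Since h^k ≤ h, these make h^k(1 + |c₀|) and τ at most δ/2 each, which places the data below
    -- the threshold.
    refine ⟨C * (1 + |c₀|), δ / (2 * (1 + |c₀|)), δ / 2, by positivity, by positivity,
      by positivity, ?_⟩
    intro u₀ u ut utt hs hreg _ _ N J hN hJ h τ hh hτ hh₀ hτ₀ uh huh _ hc j _ hj
    have hJ' : (0 : ℝ) < J := by exact_mod_cast hJ
    have hN' : (0 : ℝ) < N := by exact_mod_cast hN
    have hτ0 : 0 < τ := by rw [hτ]; positivity
    have hJT : J * τ = T := by rw [hτ]; field_simp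
    have hh0 : 0 < h := by rw [hh]; positivity
    have hh1 : h ≤ 1 := by
      rw [hh, div_le_one hN']
      exact_mod_cast hN
    have hhk : h ^ k ≤ h := pow_le_of_le_one hh0.le hh1 (by omega)
    have hc' : HeatFlow.normHr (fun r => u₀ r - uh 0 r) ≤ |c₀| * h ^ k :=
      hc.trans (mul_le_mul_of_nonneg_right (le_abs_self c₀) (by positivity))
    have hsmall : h ^ k * (1 + |c₀|) ≤ δ / 2 := by
      refine (mul_le_mul_of_nonneg_right (hhk.trans hh₀) (by positivity)).trans (le_of_eq ?_)
      field_simp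
    have h1 := hmain u₀ u ut utt hs hreg N J hN τ hτ0 hJT.le uh huh (by rw [← hh]; linarith) j hj
    rw [← hh] at h1
    refine h1.trans ?_
    rw [mul_assoc]
    refine mul_le_mul_of_nonneg_left ?_ hC.le
    have : 0 ≤ τ * |c₀| := by positivity
    linarith
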